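/- **Theorem 4.8.** Let $\mu>0$, let $L^2_\mu(\mathbb R)$ be the $L^2$ space of the measure $|t|^{2\mu}dt$ with norm $\|\cdot\|_\mu$, and put $$\gamma_\mu(2m)=\frac{2^{2m}m!\,\Gamma(m+\mu+\frac12)}{\Gamma(\mu+\frac12)},\quad \gamma_\mu(2m+1)=\frac{2^{2m+1}m!\,\Gamma(m+\mu+\frac32)}{\Gamma(\mu+\frac12)},\quad \mathbf e_\mu(z)=\sum_{n\ge0}\frac{z^n}{\gamma_\mu(n)},$$ $$(\mathfrak D_\mu f)(z)=f'(z)+\frac{\mu}{z}\bigl(f(z)-f(-z)\bigr)\quad(f\text{ entire}).$$ Let $\mathfrak S$ be the space of functions $p(x)e^{-x^2}$, $p$ a complex polynomial. For real $y$ and $g\in\mathfrak S$ let $\mathfrak T_yg=\mathbf e_\mu(y\mathfrak D_\mu)g=\sum_n\frac{y^n}{\gamma_\mu(n)}\mathfrak D_\mu^ng$. For a function $\phi:\mathbb R\to\mathbb C$ in $L^\infty(\mathbb R)$ or in $L^2_\mu(\mathbb R)$ let $$(\mathfrak T_y\phi)(x)=\frac12\int_{-1}^1\Bigl(1+\frac{x+y}{\widetilde\omega(t)}\Bigr)\phi(\widetilde\omega(t))\,\alpha_\mu(dt)+\frac12\int_{-1}^1\Bigl(1-\frac{x+y}{\widetilde\omega(t)}\Bigr)\phi(-\widetilde\omega(t))\,\alpha_\mu(dt),$$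 where $\widetilde\omega(t)=(x^2+2xyt+y^2)^{1/2}$ and $\alpha_\mu(dt)=B(\frac12,\mu)^{-1}(1-t)^{\mu-1}(1+t)^\mu dt$ on $(-1,1)$. Then: 1. Let $\phi\in L^\infty(\mathbb R)$. For every real $y$, $\mathfrak T_y\phi$ is the extension of $\mathbf e_\mu(y\mathfrak D_\mu)$ to bounded functions, that is, up to equality almost everywhere it is the unique $\psi\in L^\infty(\mathbb R)$ with $\int\psi\,g\,|x|^{2\mu}dx=\int\phi\,(\mathfrak T_{-y}g)\,|x|^{2\mu}dx$ for all $g\in\mathfrak S$ (the series $\mathfrak T_{-y}g$ converges at every real point, with sum integrable for $|x|^{2\mu}dx$). Moreover $$(\mathfrak T_y\phi)(x)=(\mathfrak T_x\phi)(y)\quad\text{for almost all real }x,y.$$ 2. Let $\phi\in L^2_\mu(\mathbb R)$ and $y\in\mathbb R$. Then $\mathfrak T_y\phi=\mathbf e_\mu(iyP_\mu)\phi$ almost everywhere, where $P_\mu=\mathcal F_\mu^*Q\,\mathcal F_\mu$ is the selfadjoint realization of $-i\mathfrak D_\mu$, $Q$ is multiplication by the variable, and $\mathcal F_\mu$ is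 the closure in $L^2_\mu(\mathbb R)$ of $f\mapsto\bigl(2^{\mu+1/2}\Gamma(\mu+\tfrac12)\bigr)^{-1}\int_{\mathbb R}\mathbf e_\mu(-ixt)f(t)|t|^{2\mu}dt$ on $\mathfrak S$. That is, $\psi=\mathfrak T_y\phi$ is, up to equality almost everywhere, the unique $\psi\in L^2_\mu(\mathbb R)$ with $(\mathcal F_\mu\psi)(t)=\mathbf e_\mu(iyt)(\mathcal F_\mu\phi)(t)$. Moreover $\mathfrak T_y\phi\in L^2_\mu(\mathbb R)$ and $$\|\mathfrak T_y\phi\|_\mu\le\|\phi\|_\mu.$$ -/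

import Mathlib

open MeasureTheory Set

noncomputable section

namespace GenHermite

/-- The generalized factorial `γ_μ(n)`:
`γ_μ(2m) = 2^{2m} m! Γ(m+μ+1/2) / Γ(μ+1/2)` and
`γ_μ(2m+1) = 2^{2m+1} m! Γ(m+μ+3/2) / Γ(μ+1/2)`
(natural-number division is intended: `n / 2 = m` in both cases). -/
def gammaMu (μ : ℝ) (n : ℕ) : ℝ :=
  2 ^ n * ((n / 2).factorial : ℝ) * Real.Gamma (((n + 1) / 2 : ℕ) + μ + 1 / 2)
    / Real.Gamma (μ + 1 / 2)

/-- The generalized exponential function `e_μ(z) = ∑ zⁿ / γ_μ(n)`. -/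
def expMu (μ : ℝ) (z : ℂ) : ℂ := ∑' n : ℕ, z ^ n / (gammaMu μ n : ℂ)

/-- The measure `|t|^{2μ} dt` on the real line; `L²_μ(ℝ)` is its `L²` space. -/
def weightMeasure (μ : ℝ) : Measure ℝ :=
  volume.withDensity fun t => ENNReal.ofReal (|t| ^ (2 * μ))

/-- The generalized derivative of an entire function,
`(𝔇_μ f)(z) = f'(z) + (μ/z) (f(z) - f(-z))`, with its limit value `(1+2μ) f'(0)` at `z = 0`. -/
def dunklDeriv (μ : ℝ) (f : ℂ → ℂ) (z : ℂ) : ℂ :=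
  if z = 0 then (1 + 2 * (μ : ℂ)) * deriv f 0
  else deriv f z + (μ : ℂ) / z * (f z - f (-z))

/-- The entire function `p(z) exp(-z²)`. As `p` runs through the complex polynomials, the
restrictions to `ℝ` are the linear span `𝔖` of the functions `xⁿ exp(-x²)`. -/
def gaussPoly (p : Polynomial ℂ) (z : ℂ) : ℂ := p.eval z * Complex.exp (-z ^ 2)

/-- The `n`-th term of the series `(𝔗_y f)(z) = ∑ₙ (yⁿ / γ_μ(n)) (𝔇_μⁿ f)(z)` that defines
`𝔗_y f = e_μ(y 𝔇_μ) f` for an entire function `f`. -/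
def translationTerm (μ y : ℝ) (f : ℂ → ℂ) (z : ℂ) (n : ℕ) : ℂ :=
  (y : ℂ) ^ n / (gammaMu μ n : ℂ) * (dunklDeriv μ)^[n] f z

/-- `ψ ∈ L^∞(ℝ)` is the image of `φ` under the extension of `𝔗_y = e_μ(y 𝔇_μ)` to bounded
functions: since `𝔇_μ` is skew-symmetric for `|x|^{2μ} dx`, this is
`∫ ψ g |x|^{2μ} dx = ∫ φ (𝔗_{-y} g) |x|^{2μ} dx` for all `g` of the form `p(x) exp(-x²)`, where
`h = 𝔗_{-y} g` is given by its defining series (whose pointwise convergence is required). -/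
def IsBoundedTranslate (μ y : ℝ) (φ ψ : ℝ → ℂ) : Prop :=
  MemLp ψ ⊤ volume ∧
    ∀ p : Polynomial ℂ, ∃ h : ℝ → ℂ,
      (∀ x : ℝ, HasSum (translationTerm μ (-y) (gaussPoly p) x) (h x)) ∧
      Integrable h (weightMeasure μ) ∧
      ∫ x, ψ x * gaussPoly p x ∂(weightMeasure μ) = ∫ x, φ x * h x ∂(weightMeasure μ)

/-- The generalized Fourier integral
`(2^{μ+1/2} Γ(μ+1/2))⁻¹ ∫ e_μ(-ixt) f(t) |t|^{2μ} dt`. -/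
def fourierIntegralMu (μ : ℝ) (f : ℝ → ℂ) (x : ℝ) : ℂ :=
  (((2 : ℝ) ^ (μ + 1 / 2) * Real.Gamma (μ + 1 / 2) : ℝ) : ℂ)⁻¹ *
    ∫ t, expMu μ (-(Complex.I * x * t)) * f t ∂(weightMeasure μ)

/-- `g = 𝓕_μ f` in `L²_μ(ℝ)`: the pair `(f, g)` lies in the closure, in `L²_μ × L²_μ`, of the
graph of the generalized Fourier integral on `𝔖`. -/
def IsFourierMu (μ : ℝ) (f g : ℝ → ℂ) : Prop :=
  MemLp f 2 (weightMeasure μ) ∧ MemLp g 2 (weightMeasure μ) ∧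
    ∀ ε : ENNReal, 0 < ε → ∃ p : Polynomial ℂ,
      eLpNorm (fun x : ℝ => f x - gaussPoly p x) 2 (weightMeasure μ) < ε ∧
      eLpNorm (fun x : ℝ => g x - fourierIntegralMu μ (fun t : ℝ => gaussPoly p t) x) 2
        (weightMeasure μ) < ε

/-- `ψ = e_μ(i y P_μ) φ` in `L²_μ(ℝ)`, where `P_μ = 𝓕_μ* Q 𝓕_μ` is the selfadjoint realization of
`-i 𝔇_μ` (`Q` is multiplication by the variable): functions of `P_μ` act through `𝓕_μ` as
multiplication operators, that is, `(𝓕_μ ψ)(t) = e_μ(i y t) (𝓕_μ φ)(t)`. -/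
def IsL2Translate (μ y : ℝ) (φ ψ : ℝ → ℂ) : Prop :=
  ∃ g : ℝ → ℂ, IsFourierMu μ φ g ∧
    IsFourierMu μ ψ (fun t : ℝ => expMu μ (Complex.I * y * t) * g t)

/-- The probability measure `α_μ(dt) = B(1/2, μ)⁻¹ (1-t)^{μ-1} (1+t)^μ dt` on `(-1, 1)`. -/
def alphaMu (μ : ℝ) : Measure ℝ :=
  (volume.restrict (Ioo (-1) 1)).withDensity fun t =>
    ENNReal.ofReal ((1 - t) ^ (μ - 1) * (1 + t) ^ μ / ProbabilityTheory.beta (1 / 2) μ)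

/-- `ω̃(t) = (x² + 2xyt + y²)^{1/2}`. -/
def omegaTilde (x y t : ℝ) : ℝ := Real.sqrt (x ^ 2 + 2 * x * y * t + y ^ 2)

/-- The function `𝔗_y φ` on the real line, in integral form. That it is the operator
`e_μ(y 𝔇_μ)` is not part of this definition; see `IsBoundedTranslate` and `IsL2Translate`. -/
def genTranslation (μ y : ℝ) (φ : ℝ → ℂ) (x : ℝ) : ℂ :=
  1 / 2 * (∫ t, ((1 + (x + y) / omegaTilde x y t : ℝ) : ℂ) * φ (omegaTilde x y t) ∂(alphaMu μ)) +
  1 / 2 * (∫ t, ((1 - (x + y) / omegaTilde x y t : ℝ) : ℂ) * φ (-omegaTilde x y t) ∂(alphaMu μ))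

end GenHermite

end

/-!
Substituting `z = ω̃(t)` turns `𝔗_y` into an integral operator against `|z|^{2μ} dz`, whose kernel
is bounded by Schur's test on every `L^p` and whose transpose is `𝔗_{-y}`. On monomials the integral
formula produces the generalized binomials `∑ γ_μ(n) / (γ_μ(k) γ_μ(n-k)) x^k y^(n-k)`, and these are
also the terms of `e_μ(y 𝔇_μ) xⁿ`; hence the integral and the series agree on entire functions, and
transposition characterizes `𝔗_y φ` for bounded `φ`. Uniqueness holds because a function with all
exponential moments is determined by its moments.

The characters `e_μ(-ix·)` are eigenfunctions of `𝔗_{-y}`, so the transform `𝓕_μ` conjugates `𝔗_y`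
to multiplication by `e_μ(iyt)`. As `|e_μ(iyt)| ≤ 1` and `𝓕_μ` is isometric, `𝔗_y` is a contraction
of `L²_μ`. The isometry is proved on `𝔖`, where `𝓕_μ` maps `p(x) exp(-x²)` to
`q(x) exp(-x²/4)` and intertwines multiplication by the variable with `i 𝔇_μ`.
-/

noncomputable section

namespace GenHermite

variable {μ : ℝ}

/-! ### Power series of entire functions -/

/-- `f` is the sum of the everywhere convergent power series with coefficients `a`. -/
def HasEntireSeries (a : ℕ → ℂ) (f : ℂ → ℂ) : Prop :=
  ∀ z, HasSum (fun n => a n * z ^ n) (f z)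

section EntireSeries

variable {a : ℕ → ℂ} {f g : ℂ → ℂ}

lemma exists_hasEntireSeries (hf : Differentiable ℂ f) : ∃ a, HasEntireSeries a f := by
  refine ⟨fun n => (n.factorial : ℂ)⁻¹ * iteratedDeriv n f 0, fun z => ?_⟩
  refine HasSum.congr_fun (Complex.hasSum_taylorSeries_of_entire hf 0 z) fun n => ?_
  simp only [sub_zero, smul_eq_mul]
  ring

lemma HasEntireSeries.unique (hf : HasEntireSeries a f) (hg : HasEntireSeries a g) : f = g :=
  funext fun z => (hf z).unique (hg z)

lemma HasEntireSeries.apply_zero (h : HasEntireSeries a f) : f 0 = a 0 := by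
  refine (h 0).unique ?_
  simpa using hasSum_single (f := fun n => a n * 0 ^ n) 0 fun n hn => by simp [hn]

lemma HasEntireSeries.summable_norm (h : HasEntireSeries a f) (r : ℝ) :
    Summable fun n => ‖a n‖ * |r| ^ n := by
  simpa [norm_mul, norm_pow] using (h r).summable.norm

lemma norm_mul_pow_le_of_mem_ball (a : ℕ → ℂ) {R : ℝ} (n : ℕ) {z : ℂ}
    (hz : z ∈ Metric.ball 0 R) : ‖a n * z ^ n‖ ≤ ‖a n‖ * |R| ^ n := by
  rw [norm_mul, norm_pow]
  have : ‖z‖ ≤ |R| := (mem_ball_zero_iff.1 hz).le.trans (le_abs_self R)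
  gcongr

lemma HasEntireSeries.differentiable (h : HasEntireSeries a f) : Differentiable ℂ f := by
  intro z
  have hz : z ∈ Metric.ball (0 : ℂ) (‖z‖ + 1) := by simp
  have hd := Complex.differentiableOn_tsum_of_summable_norm (h.summable_norm (‖z‖ + 1))
    (fun n => Differentiable.differentiableOn (by fun_prop)) Metric.isOpen_ball
    (fun n w hw => norm_mul_pow_le_of_mem_ball a n hw)
  rw [funext fun w => (h w).tsum_eq] at hd
  exact hd.differentiableAt (Metric.isOpen_ball.mem_nhds hz)

lemma HasEntireSeries.deriv (h : HasEntireSeries a f) :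
    HasEntireSeries (fun n => a (n + 1) * (n + 1 : ℕ)) (deriv f) := by
  intro z
  have hz : z ∈ Metric.ball (0 : ℂ) (‖z‖ + 1) := by simp
  have hs := Complex.hasSum_deriv_of_summable_norm (h.summable_norm (‖z‖ + 1))
    (fun n => Differentiable.differentiableOn (by fun_prop)) Metric.isOpen_ball
    (fun n w hw => norm_mul_pow_le_of_mem_ball a n hw) hz
  rw [funext fun w => (h w).tsum_eq] at hs
  simpa [mul_assoc] using (hasSum_nat_add_iff' 1).2 hs

end EntireSeries

/-! ### The operator `𝔇_μ` and the generalized exponential -/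

/-- The factor in `𝔇_μ zⁿ = dunklCoeff μ n * zⁿ⁻¹`: it is `n` for even `n` and `n + 2μ` for odd
`n`. -/
def dunklCoeff (μ : ℝ) (n : ℕ) : ℝ := n + μ * (1 - (-1) ^ n)

lemma dunklCoeff_zero (μ : ℝ) : dunklCoeff μ 0 = 0 := by simp [dunklCoeff]

lemma dunklCoeff_even (μ : ℝ) {n : ℕ} (hn : Even n) : dunklCoeff μ n = n := by
  simp [dunklCoeff, hn.neg_one_pow]

lemma dunklCoeff_odd (μ : ℝ) {n : ℕ} (hn : Odd n) : dunklCoeff μ n = n + 2 * μ := by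
  simp only [dunklCoeff, hn.neg_one_pow]; ring

lemma le_dunklCoeff (hμ : 0 < μ) (n : ℕ) : (n : ℝ) ≤ dunklCoeff μ n := by
  rcases n.even_or_odd with h | h
  · rw [dunklCoeff_even μ h]
  · rw [dunklCoeff_odd μ h]; linarith

lemma dunklCoeff_succ_pos (hμ : 0 < μ) (n : ℕ) : 0 < dunklCoeff μ (n + 1) :=
  (by positivity : (0 : ℝ) < (n + 1 : ℕ)).trans_le (le_dunklCoeff hμ _)

lemma dunklCoeff_add (μ : ℝ) {j k : ℕ} (h : Odd (j + k)) :
    dunklCoeff μ j + dunklCoeff μ k = dunklCoeff μ (j + k) := by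
  rcases j.even_or_odd with hj | hj
  · have hk : Odd k := by grind
    rw [dunklCoeff_even μ hj, dunklCoeff_odd μ hk, dunklCoeff_odd μ h]; push_cast; ring
  · have hk : Even k := by grind
    rw [dunklCoeff_odd μ hj, dunklCoeff_even μ hk, dunklCoeff_odd μ h]; push_cast; ring

lemma gammaMu_zero (hμ : 0 < μ) : gammaMu μ 0 = 1 := by
  have : Real.Gamma (μ + 1 / 2) ≠ 0 := (Real.Gamma_pos_of_pos (by linarith)).ne'
  simp [gammaMu, div_self (by simpa using this : Real.Gamma (μ + 2⁻¹) ≠ 0)]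

lemma gammaMu_succ (hμ : 0 < μ) (n : ℕ) :
    gammaMu μ (n + 1) = dunklCoeff μ (n + 1) * gammaMu μ n := by
  have : Real.Gamma (μ + 1 / 2) ≠ 0 := (Real.Gamma_pos_of_pos (by linarith)).ne'
  rcases n.even_or_odd' with ⟨m, rfl | rfl⟩
  · rw [dunklCoeff_odd μ ⟨m, rfl⟩]
    have e1 : (2 * m + 1) / 2 = m := by lia
    have e2 : (2 * m + 1 + 1) / 2 = m + 1 := by lia
    have e3 : (2 * m) / 2 = m := by lia
    have hΓ : ((m + 1 : ℕ) : ℝ) + μ + 1 / 2 = (m + μ + 1 / 2) + 1 := by push_cast; ring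
    simp only [gammaMu, e1, e2, e3, hΓ, Real.Gamma_add_one (by positivity : m + μ + 1 / 2 ≠ 0)]
    push_cast
    field_simp
    ring
  · rw [dunklCoeff_even μ (by grind)]
    have e1 : (2 * m + 1) / 2 = m := by lia
    have e2 : (2 * m + 1 + 1) / 2 = m + 1 := by lia
    have e3 : (2 * m + 1 + 1 + 1) / 2 = m + 1 := by lia
    simp only [gammaMu, e1, e2, e3, Nat.factorial_succ]
    push_cast
    field_simp
    ring

lemma factorial_le_gammaMu (hμ : 0 < μ) (n : ℕ) : (n.factorial : ℝ) ≤ gammaMu μ n := by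
  induction n with
  | zero => simp [gammaMu_zero hμ]
  | succ n ih =>
    rw [gammaMu_succ hμ, Nat.factorial_succ, Nat.cast_mul]
    exact mul_le_mul (le_dunklCoeff hμ _) ih (by positivity) (dunklCoeff_succ_pos hμ n).le

lemma gammaMu_pos (hμ : 0 < μ) (n : ℕ) : 0 < gammaMu μ n :=
  (by positivity : (0 : ℝ) < n.factorial).trans_le (factorial_le_gammaMu hμ n)

lemma gammaMu_ne_zero (hμ : 0 < μ) (n : ℕ) : (gammaMu μ n : ℂ) ≠ 0 :=
  mod_cast (gammaMu_pos hμ n).ne'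

lemma HasEntireSeries.dunklDeriv {a : ℕ → ℂ} {f : ℂ → ℂ} (h : HasEntireSeries a f) (μ : ℝ) :
    HasEntireSeries (fun n => dunklCoeff μ (n + 1) * a (n + 1)) (dunklDeriv μ f) := by
  intro z
  by_cases hz : z = 0
  · subst hz
    rw [GenHermite.dunklDeriv, if_pos rfl, h.deriv.apply_zero]
    convert hasSum_single (f := fun n => dunklCoeff μ (n + 1) * a (n + 1) * (0 : ℂ) ^ n) 0
      (fun n hn => by simp [hn]) using 1
    rw [dunklCoeff_odd μ (by simp)]
    push_cast
    ring
  · rw [GenHermite.dunklDeriv, if_neg hz]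
    have hsub := (hasSum_nat_add_iff' 1).2 ((h z).sub (h (-z)))
    simp only [Finset.range_one, Finset.sum_singleton, pow_zero, sub_self, sub_zero] at hsub
    refine HasSum.congr_fun ((h.deriv z).add (hsub.mul_left ((μ : ℂ) / z))) fun n => ?_
    simp only [GenHermite.dunklCoeff, neg_pow z (n + 1)]
    push_cast
    field_simp
    ring

lemma HasEntireSeries.dunklDeriv_iterate {a : ℕ → ℂ} {f : ℂ → ℂ} (h : HasEntireSeries a f)
    (hμ : 0 < μ) (j : ℕ) :
    HasEntireSeries (fun n => ((gammaMu μ (n + j) / gammaMu μ n : ℝ) : ℂ) * a (n + j))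
      ((GenHermite.dunklDeriv μ)^[j] f) := by
  induction j with
  | zero => simpa [div_self (gammaMu_ne_zero hμ _)] using h
  | succ j ih =>
    rw [Function.iterate_succ_apply']
    convert ih.dunklDeriv μ using 2 with n
    have hγ := gammaMu_ne_zero hμ n
    have hd : (dunklCoeff μ (n + 1) : ℂ) ≠ 0 := mod_cast (dunklCoeff_succ_pos hμ n).ne'
    rw [show n + (j + 1) = n + 1 + j by ring, gammaMu_succ hμ n]
    push_cast
    field_simp

lemma norm_expMu_term_le (hμ : 0 < μ) (z : ℂ) (n : ℕ) :
    ‖z ^ n / (gammaMu μ n : ℂ)‖ ≤ ‖z‖ ^ n / n.factorial := by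
  rw [norm_div, norm_pow, Complex.norm_real, Real.norm_of_nonneg (gammaMu_pos hμ n).le]
  gcongr
  exact factorial_le_gammaMu hμ n

lemma hasEntireSeries_expMu (hμ : 0 < μ) (c : ℂ) :
    HasEntireSeries (fun n => c ^ n / (gammaMu μ n : ℂ)) (fun z => expMu μ (c * z)) := by
  intro z
  have : Summable fun n : ℕ => (c * z) ^ n / (gammaMu μ n : ℂ) :=
    .of_norm_bounded (Real.summable_pow_div_factorial _) (norm_expMu_term_le hμ _)
  refine HasSum.congr_fun this.hasSum fun n => ?_
  rw [mul_pow]; ring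

lemma norm_expMu_le (hμ : 0 < μ) (z : ℂ) : ‖expMu μ z‖ ≤ Real.exp ‖z‖ :=
  tsum_of_norm_bounded
    (by rw [Real.exp_eq_exp_ℝ]; exact NormedSpace.expSeries_div_hasSum_exp ‖z‖)
    (norm_expMu_term_le hμ z)

lemma expMu_zero (hμ : 0 < μ) : expMu μ 0 = 1 := by
  simpa [gammaMu_zero hμ] using (hasEntireSeries_expMu hμ 0).apply_zero

lemma differentiable_expMu (hμ : 0 < μ) : Differentiable ℂ (expMu μ) := by
  simpa using (hasEntireSeries_expMu hμ 1).differentiable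

lemma continuous_expMu (hμ : 0 < μ) : Continuous (expMu μ) :=
  (differentiable_expMu hμ).continuous

lemma conj_expMu (μ : ℝ) (z : ℂ) :
    (starRingEnd ℂ) (expMu μ z) = expMu μ ((starRingEnd ℂ) z) := by
  simp [expMu, Complex.conj_tsum]

lemma dunklDeriv_expMu (hμ : 0 < μ) (c : ℂ) :
    dunklDeriv μ (fun z => expMu μ (c * z)) = fun z => c * expMu μ (c * z) := by
  refine ((hasEntireSeries_expMu hμ c).dunklDeriv μ).unique fun z => ?_
  refine HasSum.congr_fun ((hasEntireSeries_expMu hμ c z).mul_left c) fun n => ?_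
  have hd : (dunklCoeff μ (n + 1) : ℂ) ≠ 0 := mod_cast (dunklCoeff_succ_pos hμ n).ne'
  have hγ := gammaMu_ne_zero hμ n
  simp only [gammaMu_succ hμ n]
  push_cast
  field_simp
  ring

/-! ### Solutions of `𝔇_μ f = i λ f` on the real line -/

section Energy

variable {l : ℝ} {f f' : ℝ → ℂ}

lemma hasDerivAt_norm_sq_add_norm_sq_neg (hf : ∀ x, HasDerivAt f (f' x) x) (x : ℝ) :
    HasDerivAt (fun x => ‖f x‖ ^ 2 + ‖f (-x)‖ ^ 2)
      (2 * (f' x * (starRingEnd ℂ) (f x)).re - 2 * (f' (-x) * (starRingEnd ℂ) (f (-x))).re) x := by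
  have hsq : ∀ x, HasDerivAt (fun x => ‖f x‖ ^ 2) (2 * (f' x * (starRingEnd ℂ) (f x)).re) x :=
    fun x => (hf x).norm_sq.congr_deriv (by simp [Complex.inner, mul_comm])
  exact ((hsq x).add ((hsq (-x)).comp x (hasDerivAt_neg x))).congr_deriv (by ring)

lemma antitoneOn_norm_sq_add_norm_sq_neg (hμ : 0 < μ) (hf : ∀ x, HasDerivAt f (f' x) x)
    (heq : ∀ x : ℝ, x ≠ 0 → f' x + μ / x * (f x - f (-x)) = Complex.I * l * f x) :
    AntitoneOn (fun x => ‖f x‖ ^ 2 + ‖f (-x)‖ ^ 2) (Ici 0) := by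
  have hd := hasDerivAt_norm_sq_add_norm_sq_neg hf
  refine antitoneOn_of_deriv_nonpos (convex_Ici 0)
    (fun x _ => (hd x).continuousAt.continuousWithinAt)
    (fun x _ => (hd x).differentiableAt.differentiableWithinAt) fun x hx => ?_
  rw [interior_Ici, mem_Ioi] at hx
  have hpos : f' x = Complex.I * l * f x - ((μ / x : ℝ) : ℂ) * (f x - f (-x)) := by
    rw [← heq x hx.ne']; push_cast; ring
  have hneg : f' (-x) = Complex.I * l * f (-x) + ((μ / x : ℝ) : ℂ) * (f (-x) - f x) := by
    have := heq (-x) (by linarith)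
    rw [neg_neg] at this
    rw [← this]; push_cast; field_simp; ring
  have hdissipation :
      0 ≤ μ / x * (((f x).re - (f (-x)).re) ^ 2 + ((f x).im - (f (-x)).im) ^ 2) := by
    positivity
  rw [(hd x).deriv, hpos, hneg]
  simp only [Complex.mul_re, Complex.sub_re, Complex.add_re, Complex.sub_im, Complex.add_im,
    Complex.mul_im, Complex.I_re, Complex.I_im, Complex.ofReal_re, Complex.ofReal_im,
    Complex.conj_re, Complex.conj_im]
  nlinarith [hdissipation]

lemma norm_sq_add_norm_sq_neg_le (hμ : 0 < μ) (hf : ∀ x, HasDerivAt f (f' x) x)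
    (heq : ∀ x : ℝ, x ≠ 0 → f' x + μ / x * (f x - f (-x)) = Complex.I * l * f x) {x : ℝ}
    (hx : 0 ≤ x) : ‖f x‖ ^ 2 + ‖f (-x)‖ ^ 2 ≤ 2 * ‖f 0‖ ^ 2 := by
  have := antitoneOn_norm_sq_add_norm_sq_neg hμ hf heq self_mem_Ici (mem_Ici.2 hx) hx
  simp only [neg_zero] at this
  linarith

end Energy

lemma norm_expMu_I_mul_le (hμ : 0 < μ) (x : ℝ) : ‖expMu μ (Complex.I * x)‖ ≤ 1 := by
  have hneg : ∀ x : ℝ, ‖expMu μ (Complex.I * (-x : ℝ))‖ = ‖expMu μ (Complex.I * x)‖ := fun x => by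
    rw [← RCLike.norm_conj, conj_expMu]; simp
  wlog hx : 0 ≤ x generalizing x
  · rw [← hneg]
    exact this (-x) (by linarith)
  have hderiv : ∀ x : ℝ, HasDerivAt (fun x : ℝ => expMu μ (Complex.I * x))
      (deriv (fun z : ℂ => expMu μ (Complex.I * z)) x) x := fun x =>
    ((hasEntireSeries_expMu hμ Complex.I).differentiable x).hasDerivAt.comp_ofReal
  have henergy := norm_sq_add_norm_sq_neg_le (l := 1) hμ hderiv (fun x hx => ?_) hx
  · simp only [hneg, Complex.ofReal_zero, mul_zero, expMu_zero hμ, norm_one] at henergy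
    nlinarith [norm_nonneg (expMu μ (Complex.I * x))]
  · have := congrFun (dunklDeriv_expMu hμ Complex.I) x
    rw [dunklDeriv, if_neg (mod_cast hx)] at this
    simpa using this

/-! ### The measure `α_μ` -/

section Jacobi

variable {a b : ℝ}

lemma intervalIntegrable_jacobi (ha : -1 < a) (hb : -1 < b) :
    IntervalIntegrable (fun t : ℝ => (1 - t) ^ a * (1 + t) ^ b) volume (-1) 1 := by
  refine IntervalIntegrable.trans (b := 0) ?_ ?_
  · have hleft : IntervalIntegrable (fun t : ℝ => (1 + t) ^ b) volume (-1) 0 := by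
      simpa using (intervalIntegral.intervalIntegrable_rpow' (a := 0) (b := 1) hb).comp_add_left 1
    refine hleft.continuousOn_mul (ContinuousOn.rpow_const (by fun_prop) fun t ht => Or.inl ?_)
    rw [uIcc_of_le (by norm_num)] at ht
    linarith [ht.2]
  · have hright : IntervalIntegrable (fun t : ℝ => (1 - t) ^ a) volume 0 1 := by
      simpa using
        ((intervalIntegral.intervalIntegrable_rpow' (a := 0) (b := 1) ha).comp_sub_left 1).symm
    refine hright.mul_continuousOn (ContinuousOn.rpow_const (by fun_prop) fun t ht => Or.inl ?_)
    rw [uIcc_of_le (by norm_num)] at ht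
    linarith [ht.1]

lemma integrableOn_jacobi (ha : -1 < a) (hb : -1 < b) :
    IntegrableOn (fun t : ℝ => (1 - t) ^ a * (1 + t) ^ b) (Ioo (-1) 1) :=
  (intervalIntegrable_iff_integrableOn_Ioo_of_le (by norm_num)).1 (intervalIntegrable_jacobi ha hb)

lemma integral_rpow_mul_one_sub_rpow (ha : 0 < a) (hb : 0 < b) :
    ∫ s in (0 : ℝ)..1, s ^ (a - 1) * (1 - s) ^ (b - 1) = ProbabilityTheory.beta a b := by
  rw [ProbabilityTheory.beta_eq_betaIntegralReal _ _ ha hb, Complex.betaIntegral]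
  have hcast : ∀ s ∈ uIcc (0 : ℝ) 1, (s : ℂ) ^ ((a : ℂ) - 1) * (1 - (s : ℂ)) ^ ((b : ℂ) - 1) =
      ((s ^ (a - 1) * (1 - s) ^ (b - 1) : ℝ) : ℂ) := by
    intro s hs
    rw [uIcc_of_le (by norm_num)] at hs
    rw [Complex.ofReal_mul, Complex.ofReal_cpow hs.1, Complex.ofReal_cpow (by linarith [hs.2])]
    push_cast
    rfl
  rw [intervalIntegral.integral_congr hcast, intervalIntegral.integral_ofReal, Complex.ofReal_re]

lemma integral_jacobi (ha : 0 < a) (hb : 0 < b) :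
    ∫ t in (-1 : ℝ)..1, (1 - t) ^ (a - 1) * (1 + t) ^ (b - 1) =
      2 ^ (a + b - 1) * ProbabilityTheory.beta b a := by
  have hsub := intervalIntegral.integral_comp_mul_add (a := 0) (b := 1)
    (fun t : ℝ => (1 - t) ^ (a - 1) * (1 + t) ^ (b - 1)) two_ne_zero (-1)
  have hscale : ∀ s ∈ uIcc (0 : ℝ) 1,
      (1 - (2 * s + -1)) ^ (a - 1) * (1 + (2 * s + -1)) ^ (b - 1) =
        2 ^ (a - 1 + (b - 1)) * (s ^ (b - 1) * (1 - s) ^ (a - 1)) := by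
    intro s hs
    rw [uIcc_of_le (by norm_num)] at hs
    rw [show 1 - (2 * s + -1) = 2 * (1 - s) by ring, show 1 + (2 * s + -1) = 2 * s by ring,
      Real.mul_rpow (by norm_num) (by linarith [hs.2]), Real.mul_rpow (by norm_num) hs.1,
      Real.rpow_add (by norm_num)]
    ring
  rw [intervalIntegral.integral_congr hscale, intervalIntegral.integral_const_mul,
    integral_rpow_mul_one_sub_rpow hb ha] at hsub
  norm_num at hsub
  rw [show a + b - 1 = a - 1 + (b - 1) + 1 by ring, Real.rpow_add_one (by norm_num)]
  linear_combination -2 * hsub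

end Jacobi

lemma two_rpow_mul_beta (hμ : 0 < μ) :
    2 ^ (2 * μ) * ProbabilityTheory.beta (μ + 1) μ = ProbabilityTheory.beta (1 / 2) μ := by
  have hdup := Real.Gamma_mul_Gamma_add_half (μ + 1 / 2)
  rw [show μ + 1 / 2 + 1 / 2 = μ + 1 by ring, show 2 * (μ + 1 / 2) = μ + 1 + μ by ring,
    show 1 - (μ + 1 + μ) = - (2 * μ) by ring, Real.rpow_neg (by norm_num)] at hdup
  have : Real.Gamma (μ + 1 / 2) ≠ 0 := (Real.Gamma_pos_of_pos (by linarith)).ne'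
  have : Real.Gamma (μ + 1 + μ) ≠ 0 := (Real.Gamma_pos_of_pos (by linarith)).ne'
  rw [ProbabilityTheory.beta, ProbabilityTheory.beta, Real.Gamma_one_half_eq, add_comm (1 / 2) μ]
  field_simp at hdup ⊢
  linear_combination hdup

/-- The density of `α_μ` on `(-1, 1)`. -/
def alphaDensity (μ t : ℝ) : ℝ :=
  (1 - t) ^ (μ - 1) * (1 + t) ^ μ / ProbabilityTheory.beta (1 / 2) μ

lemma beta_half_pos (hμ : 0 < μ) : 0 < ProbabilityTheory.beta (1 / 2) μ :=
  ProbabilityTheory.beta_pos (by norm_num) hμ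

lemma alphaDensity_nonneg (hμ : 0 < μ) {t : ℝ} (ht : t ∈ Ioo (-1 : ℝ) 1) :
    0 ≤ alphaDensity μ t := by
  have h1 : 0 ≤ 1 - t := by linarith [ht.2]
  have h2 : 0 ≤ 1 + t := by linarith [ht.1]
  have := (beta_half_pos hμ).le
  unfold alphaDensity
  positivity

lemma measurable_alphaDensity (μ : ℝ) : Measurable (alphaDensity μ) := by
  unfold alphaDensity
  fun_prop

lemma intervalIntegrable_alphaDensity (hμ : 0 < μ) :
    IntervalIntegrable (alphaDensity μ) volume (-1) 1 :=
  (intervalIntegrable_jacobi (by linarith) (by linarith)).div_const _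

lemma intervalIntegral_alphaDensity (hμ : 0 < μ) : ∫ t in (-1 : ℝ)..1, alphaDensity μ t = 1 := by
  have hjacobi := integral_jacobi hμ (by linarith : 0 < μ + 1)
  rw [show μ + (μ + 1) - 1 = 2 * μ by ring, two_rpow_mul_beta hμ, add_sub_cancel_right] at hjacobi
  simp only [alphaDensity]
  rw [intervalIntegral.integral_div, hjacobi, div_self (beta_half_pos hμ).ne']

lemma alphaMu_eq_withDensity (μ : ℝ) : alphaMu μ =
    (volume.restrict (Ioo (-1) 1)).withDensity fun t => ENNReal.ofReal (alphaDensity μ t) := rfl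

lemma lintegral_alphaMu (μ : ℝ) (f : ℝ → ENNReal) :
    ∫⁻ t, f t ∂(alphaMu μ) = ∫⁻ t in Ioo (-1) 1, ENNReal.ofReal (alphaDensity μ t) * f t := by
  rw [alphaMu_eq_withDensity, lintegral_withDensity_eq_lintegral_mul_non_measurable _
    (measurable_alphaDensity μ).ennreal_ofReal (.of_forall fun _ => ENNReal.ofReal_lt_top)]
  simp only [Pi.mul_apply]

section

variable {E : Type*} [NormedAddCommGroup E] [NormedSpace ℝ E]

lemma integral_alphaMu (hμ : 0 < μ) (f : ℝ → E) :
    ∫ t, f t ∂(alphaMu μ) = ∫ t in Ioo (-1) 1, alphaDensity μ t • f t := by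
  rw [alphaMu_eq_withDensity, integral_withDensity_eq_integral_toReal_smul
    (measurable_alphaDensity μ).ennreal_ofReal (.of_forall fun _ => ENNReal.ofReal_lt_top)]
  exact setIntegral_congr_fun measurableSet_Ioo fun t ht => by
    simp only [ENNReal.toReal_ofReal (alphaDensity_nonneg hμ ht)]

lemma intervalIntegral_alphaMu (hμ : 0 < μ) (f : ℝ → E) :
    ∫ t, f t ∂(alphaMu μ) = ∫ t in (-1)..1, alphaDensity μ t • f t := by
  rw [integral_alphaMu hμ, intervalIntegral.integral_of_le (by norm_num),
    integral_Ioc_eq_integral_Ioo]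

lemma integrable_alphaMu_iff (hμ : 0 < μ) (f : ℝ → E) :
    Integrable f (alphaMu μ) ↔ IntegrableOn (fun t => alphaDensity μ t • f t) (Ioo (-1) 1) := by
  rw [alphaMu_eq_withDensity, integrable_withDensity_iff_integrable_smul'
    (measurable_alphaDensity μ).ennreal_ofReal (.of_forall fun _ => ENNReal.ofReal_lt_top)]
  exact integrableOn_congr_fun (fun t ht => by
    simp only [ENNReal.toReal_ofReal (alphaDensity_nonneg hμ ht)]) measurableSet_Ioo

end

lemma isProbabilityMeasure_alphaMu (hμ : 0 < μ) : IsProbabilityMeasure (alphaMu μ) := by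
  refine ⟨?_⟩
  rw [← lintegral_one, lintegral_alphaMu]
  simp only [mul_one]
  rw [← ofReal_integral_eq_lintegral_ofReal (by
      rw [← IntegrableOn, ← intervalIntegrable_iff_integrableOn_Ioo_of_le (by norm_num)]
      exact intervalIntegrable_alphaDensity hμ)
    ((ae_restrict_iff' measurableSet_Ioo).2 (.of_forall fun t ht => alphaDensity_nonneg hμ ht)),
    ← integral_Ioc_eq_integral_Ioo, ← intervalIntegral.integral_of_le (by norm_num),
    intervalIntegral_alphaDensity hμ, ENNReal.ofReal_one]

lemma ae_alphaMu (μ : ℝ) : ∀ᵐ t ∂(alphaMu μ), t ∈ Ioo (-1 : ℝ) 1 :=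
  (withDensity_absolutelyContinuous _ _).ae_le (ae_restrict_mem measurableSet_Ioo)

lemma integrable_alphaMu_of_continuous {E : Type*} [NormedAddCommGroup E]
    [SecondCountableTopology E] (hμ : 0 < μ) {f : ℝ → E} (hf : Continuous f) :
    Integrable f (alphaMu μ) := by
  have := isProbabilityMeasure_alphaMu hμ
  obtain ⟨C, hC⟩ := isCompact_Icc.exists_bound_of_continuousOn
    (hf.continuousOn (s := Icc (-1) 1))
  refine Integrable.of_bound hf.aestronglyMeasurable C ?_
  filter_upwards [ae_alphaMu μ] with t ht using hC t (Ioo_subset_Icc_self ht)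

lemma alphaDensity_mul_one_sub {t : ℝ} (ht : t ∈ Ioo (-1 : ℝ) 1) :
    alphaDensity μ t * (1 - t) = (1 - t ^ 2) ^ μ / ProbabilityTheory.beta (1 / 2) μ := by
  have h1 : 0 < 1 - t := by linarith [ht.2]
  have h2 : 0 < 1 + t := by linarith [ht.1]
  rw [show 1 - t ^ 2 = (1 - t) * (1 + t) by ring, Real.mul_rpow h1.le h2.le, alphaDensity,
    Real.rpow_sub_one h1.ne']
  field_simp

lemma hasDerivAt_one_sub_sq_rpow {t : ℝ} (ht : t ∈ Ioo (-1 : ℝ) 1) :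
    HasDerivAt (fun t : ℝ => -((1 - t ^ 2) ^ μ / ProbabilityTheory.beta (1 / 2) μ))
      (μ * (alphaDensity μ t - alphaDensity μ (-t))) t := by
  have h1 : 0 < 1 - t := by linarith [ht.2]
  have h2 : 0 < 1 + t := by linarith [ht.1]
  have hprod : 1 - t ^ 2 = (1 - t) * (1 + t) := by ring
  have hd : HasDerivAt (fun t : ℝ => 1 - t ^ 2) (-(2 * t)) t := by
    simpa using (hasDerivAt_pow 2 t).const_sub 1
  refine ((hd.rpow_const (p := μ) (Or.inl (by rw [hprod]; positivity))).div_const _).neg.congr_deriv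
    ?_
  rw [hprod, Real.mul_rpow h1.le h2.le, alphaDensity, alphaDensity, Real.rpow_sub_one h1.ne',
    Real.rpow_sub_one h2.ne', sub_neg_eq_add, ← sub_eq_add_neg, Real.rpow_sub_one h2.ne']
  field_simp
  ring

lemma intervalIntegrable_alphaDensity_neg (hμ : 0 < μ) :
    IntervalIntegrable (fun t => alphaDensity μ (-t)) volume (-1) 1 := by
  simpa using ((intervalIntegrable_alphaDensity hμ).comp_mul_left (c := -1)).symm

lemma integral_comp_neg_alphaMu (hμ : 0 < μ) (F : ℝ → ℝ) :
    ∫ t, F (-t) ∂(alphaMu μ) = ∫ t in (-1)..1, alphaDensity μ (-t) * F t := by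
  rw [intervalIntegral_alphaMu hμ]
  simpa using intervalIntegral.integral_comp_neg (a := -1) (b := 1)
    (fun t => alphaDensity μ (-t) * F t)

/-- Integration by parts against `α_μ`. -/
lemma integral_alphaMu_sub_comp_neg (hμ : 0 < μ) {F F' : ℝ → ℝ}
    (hF : ∀ t, HasDerivAt F (F' t) t) (hF' : Continuous F') :
    μ * (∫ t, F t ∂(alphaMu μ) - ∫ t, F (-t) ∂(alphaMu μ)) = ∫ t, F' t * (1 - t) ∂(alphaMu μ) := by
  have hFc : Continuous F := continuous_iff_continuousAt.2 fun t => (hF t).continuousAt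
  have hd := intervalIntegrable_alphaDensity hμ
  have hd' := intervalIntegrable_alphaDensity_neg hμ
  set v : ℝ → ℝ := fun t => -((1 - t ^ 2) ^ μ / ProbabilityTheory.beta (1 / 2) μ) with hv
  have hv_cont : Continuous v :=
    ((Continuous.rpow_const (by fun_prop) fun _ => Or.inr hμ.le).div_const _).neg
  have hv_end : v 1 = 0 ∧ v (-1) = 0 := by simp [hv, Real.zero_rpow hμ.ne']
  have hparts := intervalIntegral.integral_mul_deriv_eq_deriv_mul_of_hasDerivAt
    (a := -1) (b := 1) (v := v) hFc.continuousOn hv_cont.continuousOn (fun t _ => hF t)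
    (fun t ht => hasDerivAt_one_sub_sq_rpow (by simpa using ht)) (hF'.intervalIntegrable _ _)
    ((hd.sub hd').const_mul μ)
  calc μ * (∫ t, F t ∂(alphaMu μ) - ∫ t, F (-t) ∂(alphaMu μ))
    _ = ∫ t in (-1)..1, F t * (μ * (alphaDensity μ t - alphaDensity μ (-t))) := by
        rw [integral_comp_neg_alphaMu hμ, intervalIntegral_alphaMu hμ]
        simp only [smul_eq_mul]
        rw [← intervalIntegral.integral_sub (hd.mul_continuousOn hFc.continuousOn)
            (hd'.mul_continuousOn hFc.continuousOn), ← intervalIntegral.integral_const_mul]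
        exact intervalIntegral.integral_congr fun t _ => by ring
    _ = ∫ t in (-1)..1, alphaDensity μ t * (F' t * (1 - t)) := by
        rw [hparts, hv_end.1, hv_end.2, mul_zero, mul_zero, sub_zero, zero_sub,
          ← intervalIntegral.integral_neg]
        refine intervalIntegral.integral_congr_Ioo_of_le (by norm_num) fun t ht => ?_
        simp only [hv]
        linear_combination (-F' t) * alphaDensity_mul_one_sub (μ := μ) ht
    _ = ∫ t, F' t * (1 - t) ∂(alphaMu μ) := (intervalIntegral_alphaMu hμ _).symm

open Finset.HasAntidiagonal (antidiagonal)

/-! ### The moments of `α_μ` and the generalized binomial -/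

/-- The generalized binomial `∑ γ_μ(n) / (γ_μ(j) γ_μ(k)) xʲ yᵏ` over `j + k = n`, the value at `x`
of `e_μ(y 𝔇_μ)` applied to the `n`-th power. -/
def dunklBinom (μ : ℝ) (n : ℕ) (x y : ℝ) : ℝ :=
  ∑ p ∈ antidiagonal n, gammaMu μ n / (gammaMu μ p.1 * gammaMu μ p.2) * (x ^ p.1 * y ^ p.2)

lemma dunklBinom_zero (hμ : 0 < μ) (x y : ℝ) : dunklBinom μ 0 x y = 1 := by
  simp [dunklBinom, gammaMu_zero hμ]

lemma dunklBinom_zero_left (hμ : 0 < μ) (n : ℕ) (y : ℝ) : dunklBinom μ n 0 y = y ^ n := by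
  cases n with
  | zero => simp [dunklBinom_zero hμ]
  | succ n =>
    rw [dunklBinom, Finset.Nat.sum_antidiagonal_succ]
    simp [gammaMu_zero hμ, div_self (gammaMu_pos hμ (n + 1)).ne']

lemma dunklBinom_succ_of_even (hμ : 0 < μ) {n : ℕ} (hn : Even n) (x y : ℝ) :
    dunklBinom μ (n + 1) x y = (x + y) * dunklBinom μ n x y := by
  have hsplit : dunklBinom μ (n + 1) x y =
      ∑ p ∈ antidiagonal (n + 1), (gammaMu μ n * dunklCoeff μ p.1 /
        (gammaMu μ p.1 * gammaMu μ p.2) * (x ^ p.1 * y ^ p.2)) +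
      ∑ p ∈ antidiagonal (n + 1), (gammaMu μ n * dunklCoeff μ p.2 /
        (gammaMu μ p.1 * gammaMu μ p.2) * (x ^ p.1 * y ^ p.2)) := by
    rw [← Finset.sum_add_distrib, dunklBinom]
    refine Finset.sum_congr rfl fun p hp => ?_
    rw [Finset.HasAntidiagonal.mem_antidiagonal] at hp
    rw [gammaMu_succ hμ, ← hp, ← dunklCoeff_add μ (by rw [hp]; exact hn.add_one)]
    ring
  rw [hsplit, Finset.Nat.sum_antidiagonal_succ, Finset.Nat.sum_antidiagonal_succ', add_mul,
    dunklBinom, Finset.mul_sum, Finset.mul_sum]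
  simp only [dunklCoeff_zero, mul_zero, zero_div, zero_mul, zero_add]
  congr 1 <;>
  · refine Finset.sum_congr rfl fun p _ => ?_
    have h1 := (gammaMu_pos hμ p.1).ne'
    have h2 := (gammaMu_pos hμ p.2).ne'
    have h3 := (dunklCoeff_succ_pos hμ p.1).ne'
    have h4 := (dunklCoeff_succ_pos hμ p.2).ne'
    simp only [gammaMu_succ hμ]
    field_simp
    ring

lemma differentiable_dunklBinom (μ : ℝ) (n : ℕ) (y : ℝ) :
    Differentiable ℝ fun x => dunklBinom μ n x y := by
  unfold dunklBinom
  fun_prop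

lemma deriv_dunklBinom (μ : ℝ) (n : ℕ) (x y : ℝ) :
    deriv (fun x => dunklBinom μ n x y) x = ∑ p ∈ antidiagonal n,
      gammaMu μ n / (gammaMu μ p.1 * gammaMu μ p.2) * (p.1 * x ^ (p.1 - 1) * y ^ p.2) :=
  HasDerivAt.deriv <| HasDerivAt.fun_sum fun p _ =>
    ((hasDerivAt_pow p.1 x).mul_const _).const_mul _

lemma dunkl_dunklBinom (hμ : 0 < μ) (n : ℕ) {x : ℝ} (hx : x ≠ 0) (y : ℝ) :
    deriv (fun x => dunklBinom μ (n + 1) x y) x +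
      μ / x * (dunklBinom μ (n + 1) x y - dunklBinom μ (n + 1) (-x) y) =
      dunklCoeff μ (n + 1) * dunklBinom μ n x y := by
  rw [deriv_dunklBinom]
  simp only [dunklBinom]
  rw [← Finset.sum_sub_distrib, Finset.mul_sum, ← Finset.sum_add_distrib, Finset.mul_sum,
    Finset.Nat.sum_antidiagonal_succ]
  simp only [pow_zero, sub_self, mul_zero, Nat.cast_zero, zero_mul, zero_add]
  refine Finset.sum_congr rfl fun p _ => ?_
  have h1 := (gammaMu_pos hμ p.1).ne'
  have h2 := (gammaMu_pos hμ p.2).ne'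
  have h3 := (dunklCoeff_succ_pos hμ p.1).ne'
  have hmonomial : ((p.1 + 1 : ℕ) : ℝ) * x ^ p.1 * y ^ p.2 +
      μ / x * (x ^ (p.1 + 1) * y ^ p.2 - (-1) ^ (p.1 + 1) * x ^ (p.1 + 1) * y ^ p.2) =
      dunklCoeff μ (p.1 + 1) * (x ^ p.1 * y ^ p.2) := by
    rw [dunklCoeff]; field_simp; ring
  simp only [gammaMu_succ hμ, neg_pow x, Nat.add_sub_cancel]
  field_simp at hmonomial ⊢
  linear_combination (dunklCoeff μ (n + 1) * gammaMu μ n) * hmonomial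

lemma eq_zero_of_dunkl_eq_zero (hμ : 0 < μ) {f f' : ℝ → ℝ} (hf : ∀ x, HasDerivAt f (f' x) x)
    (heq : ∀ x : ℝ, x ≠ 0 → f' x + μ / x * (f x - f (-x)) = 0) (h0 : f 0 = 0) (x : ℝ) :
    f x = 0 := by
  have hboth : ∀ x, 0 ≤ x → f x = 0 ∧ f (-x) = 0 := by
    intro x hx
    have := norm_sq_add_norm_sq_neg_le (l := 0) hμ (fun x => (hf x).ofReal_comp) (fun x hx => by
      simp only [Complex.ofReal_zero, mul_zero, zero_mul]
      exact_mod_cast heq x hx) hx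
    simp only [h0, Complex.norm_real, Real.norm_eq_abs, sq_abs] at this
    constructor <;> nlinarith [sq_nonneg (f x), sq_nonneg (f (-x))]
  rcases le_total 0 x with h | h
  · exact (hboth x h).1
  · simpa using (hboth (-x) (by linarith)).2

lemma hasDerivAt_integral_of_ae_mem_isCompact {T : Type*} [TopologicalSpace T] [MeasurableSpace T]
    [OpensMeasurableSpace T] {ν : Measure T} [IsFiniteMeasure ν] {K : Set T} (hK : IsCompact K)
    (hνK : ∀ᵐ t ∂ν, t ∈ K) {F F' : ℝ → T → ℝ} (hF : ∀ x, Continuous (F x))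
    (hF' : Continuous F'.uncurry) (hd : ∀ x t, HasDerivAt (F · t) (F' x t) x) (x : ℝ) :
    HasDerivAt (fun x => ∫ t, F x t ∂ν) (∫ t, F' x t ∂ν) x := by
  obtain ⟨C, hC⟩ := hK.exists_bound_of_continuousOn (hF x).continuousOn
  obtain ⟨C', hC'⟩ := ((isCompact_closedBall x 1).prod hK).exists_bound_of_continuousOn
    hF'.continuousOn
  refine (hasDerivAt_integral_of_dominated_loc_of_deriv_le (bound := fun _ => C')
    (Metric.ball_mem_nhds x one_pos) (.of_forall fun x => (hF x).aestronglyMeasurable)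
    (.of_bound (hF x).aestronglyMeasurable C ?_)
    (hF'.comp (Continuous.prodMk_right x)).aestronglyMeasurable ?_ (integrable_const C')
    (.of_forall fun t z _ => hd z t)).2
  · filter_upwards [hνK] with t ht using hC t ht
  · filter_upwards [hνK] with t ht z hz using
      hC' (z, t) ⟨Metric.ball_subset_closedBall hz, ht⟩

lemma hasDerivAt_integral_alphaMu_pow (hμ : 0 < μ) (m : ℕ) (x y : ℝ) :
    HasDerivAt (fun x => ∫ t, (x ^ 2 + 2 * x * y * t + y ^ 2) ^ (m + 1) ∂(alphaMu μ))
      (∫ t, ((m + 1 : ℕ) * (x ^ 2 + 2 * x * y * t + y ^ 2) ^ m * (2 * x + 2 * y * t)) ∂(alphaMu μ))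
      x := by
  have := isProbabilityMeasure_alphaMu hμ
  refine hasDerivAt_integral_of_ae_mem_isCompact
    (F := fun x t => (x ^ 2 + 2 * x * y * t + y ^ 2) ^ (m + 1))
    (F' := fun x t => (m + 1 : ℕ) * (x ^ 2 + 2 * x * y * t + y ^ 2) ^ m * (2 * x + 2 * y * t))
    isCompact_Icc ((ae_alphaMu μ).mono fun t ht => Ioo_subset_Icc_self ht)
    (fun x => by fun_prop) (by unfold Function.uncurry; fun_prop) (fun x t => ?_) x
  have hW : HasDerivAt (fun x => x ^ 2 + 2 * x * y * t + y ^ 2) (2 * x + 2 * y * t) x := by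
    have := ((hasDerivAt_pow 2 x).fun_add
      (((hasDerivAt_id' x).const_mul 2).mul_const y |>.mul_const t)).add_const (y ^ 2)
    exact this.congr_deriv (by norm_num)
  simpa using hW.fun_pow (m + 1)

/-- `𝔇_μ` in `x` of the moments of `α_μ`; the difference `f(x) - f(-x)` is computed by integration
by parts in `t`. -/
lemma dunkl_integral_alphaMu_pow (hμ : 0 < μ) (m : ℕ) {x : ℝ} (hx : x ≠ 0) (y : ℝ) :
    (∫ t, ((m + 1 : ℕ) * (x ^ 2 + 2 * x * y * t + y ^ 2) ^ m * (2 * x + 2 * y * t)) ∂(alphaMu μ)) +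
      μ / x * ((∫ t, (x ^ 2 + 2 * x * y * t + y ^ 2) ^ (m + 1) ∂(alphaMu μ)) -
        ∫ t, ((-x) ^ 2 + 2 * -x * y * t + y ^ 2) ^ (m + 1) ∂(alphaMu μ)) =
      2 * (m + 1) * (x + y) * ∫ t, (x ^ 2 + 2 * x * y * t + y ^ 2) ^ m ∂(alphaMu μ) := by
  have hderiv : ∀ t, HasDerivAt (fun t => (x ^ 2 + 2 * x * y * t + y ^ 2) ^ (m + 1))
      ((m + 1 : ℕ) * (x ^ 2 + 2 * x * y * t + y ^ 2) ^ m * (2 * x * y)) t := fun t => by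
    have hW : HasDerivAt (fun t => x ^ 2 + 2 * x * y * t + y ^ 2) (2 * x * y) t := by
      simpa using (((hasDerivAt_id' t).const_mul (2 * x * y)).const_add (x ^ 2)).add_const (y ^ 2)
    simpa using hW.fun_pow (m + 1)
  have hparts := integral_alphaMu_sub_comp_neg hμ hderiv (by fun_prop)
  have hreflect : ∀ t : ℝ, (-x) ^ 2 + 2 * -x * y * t + y ^ 2 = x ^ 2 + 2 * x * y * -t + y ^ 2 :=
    fun t => by ring
  simp only [hreflect]
  rw [div_mul_eq_mul_div, hparts, ← integral_div,
    ← integral_add (integrable_alphaMu_of_continuous hμ (by fun_prop))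
      (integrable_alphaMu_of_continuous hμ (by fun_prop)), ← integral_const_mul]
  refine integral_congr_ae (.of_forall fun t => ?_)
  push_cast
  field_simp
  ring

/-- Both sides have the same image under `𝔇_μ` and the same value at `x = 0`. -/
lemma integral_alphaMu_pow (hμ : 0 < μ) (m : ℕ) (x y : ℝ) :
    ∫ t, (x ^ 2 + 2 * x * y * t + y ^ 2) ^ m ∂(alphaMu μ) = dunklBinom μ (2 * m) x y := by
  have := isProbabilityMeasure_alphaMu hμ
  induction m generalizing x with
  | zero => simp [dunklBinom_zero hμ]
  | succ m ih =>
    refine sub_eq_zero.1 (eq_zero_of_dunkl_eq_zero hμ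
      (fun x => (hasDerivAt_integral_alphaMu_pow hμ m x y).sub
        (differentiable_dunklBinom μ (2 * (m + 1)) y x).hasDerivAt) (fun x hx => ?_) ?_ x)
    · have hint := dunkl_integral_alphaMu_pow hμ m hx y
      have hbinom := dunkl_dunklBinom hμ (2 * m + 1) hx y
      rw [ih] at hint
      rw [dunklBinom_succ_of_even hμ (even_two_mul m), dunklCoeff_even μ (by grind)] at hbinom
      rw [show 2 * (m + 1) = 2 * m + 1 + 1 by ring]
      simp only [Pi.sub_apply]
      push_cast at hint hbinom ⊢
      linear_combination hint - hbinom
    · simp [dunklBinom_zero_left hμ, ← pow_mul]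

/-! ### Generalized translation of entire functions -/

lemma sq_add_mul_add_sq_eq (x y t : ℝ) :
    x ^ 2 + 2 * x * y * t + y ^ 2 = (1 - t ^ 2) * x ^ 2 + (t * x + y) ^ 2 := by ring

lemma one_sub_sq_pos {t : ℝ} (ht : t ∈ Ioo (-1 : ℝ) 1) : 0 < 1 - t ^ 2 := by
  nlinarith [ht.1, ht.2]

lemma omegaTilde_sq {x y t : ℝ} (ht : t ∈ Ioo (-1 : ℝ) 1) :
    omegaTilde x y t ^ 2 = x ^ 2 + 2 * x * y * t + y ^ 2 := by
  have := one_sub_sq_pos ht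
  rw [omegaTilde, Real.sq_sqrt]
  rw [sq_add_mul_add_sq_eq]
  positivity

lemma omegaTilde_nonneg (x y t : ℝ) : 0 ≤ omegaTilde x y t := Real.sqrt_nonneg _

lemma omegaTilde_pos {x y t : ℝ} (hx : x ≠ 0) (ht : t ∈ Ioo (-1 : ℝ) 1) :
    0 < omegaTilde x y t := by
  have := one_sub_sq_pos ht
  rw [omegaTilde, Real.sqrt_pos, sq_add_mul_add_sq_eq]
  positivity

lemma omegaTilde_le {x y t : ℝ} (ht : t ∈ Ioo (-1 : ℝ) 1) : omegaTilde x y t ≤ |x| + |y| := by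
  refine (abs_le_of_sq_le_sq' ?_ (by positivity)).2
  have hxyt : x * y * t ≤ |x| * |y| :=
    calc x * y * t ≤ |x * y * t| := le_abs_self _
      _ = |x| * |y| * |t| := by rw [abs_mul, abs_mul]
      _ ≤ |x| * |y| * 1 := by gcongr; exact abs_le.2 ⟨ht.1.le, ht.2.le⟩
      _ = |x| * |y| := mul_one _
  rw [omegaTilde_sq ht, add_sq, sq_abs, sq_abs]
  linarith

@[fun_prop]
lemma continuous_omegaTilde (x y : ℝ) : Continuous (omegaTilde x y) := by
  unfold omegaTilde; fun_prop

lemma omegaTilde_neg_neg (x y t : ℝ) : omegaTilde (-x) (-y) t = omegaTilde x y t := by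
  simp [omegaTilde]

lemma omegaTilde_comm (x y t : ℝ) : omegaTilde x y t = omegaTilde y x t := by
  simp only [omegaTilde]; ring_nf

lemma abs_add_div_omegaTilde_le {x y t : ℝ} (ht : t ∈ Ioo (-1 : ℝ) 1) :
    |(x + y) / omegaTilde x y t| ≤ √(2 / (1 + t)) := by
  have h1 : 0 < 1 + t := by linarith [ht.1]
  rcases (omegaTilde_nonneg x y t).eq_or_lt with h | h
  · rw [← h, div_zero, abs_zero]
    exact Real.sqrt_nonneg _
  · refine Real.abs_le_sqrt ?_
    rw [div_pow, div_le_div_iff₀ (by positivity) h1, omegaTilde_sq ht]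
    nlinarith [mul_nonneg (by linarith [ht.2] : 0 ≤ 1 - t) (sq_nonneg (x - y))]

lemma abs_one_add_div_omegaTilde_le {x y t : ℝ} (ht : t ∈ Ioo (-1 : ℝ) 1) :
    |1 + (x + y) / omegaTilde x y t| ≤ 1 + √(2 / (1 + t)) :=
  (abs_add_le _ _).trans (by rw [abs_one]; gcongr; exact abs_add_div_omegaTilde_le ht)

lemma integrable_sqrt_two_div_alphaMu (hμ : 0 < μ) :
    Integrable (fun t => √(2 / (1 + t))) (alphaMu μ) := by
  rw [integrable_alphaMu_iff hμ]
  refine (integrableOn_congr_fun (fun t ht => ?_) measurableSet_Ioo).1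
    (((integrableOn_jacobi (a := μ - 1) (b := μ - 1 / 2) (by linarith)
      (by linarith)).const_mul √2).div_const (ProbabilityTheory.beta (1 / 2) μ))
  have h1 : 0 < 1 + t := by linarith [ht.1]
  rw [alphaDensity, smul_eq_mul, Real.sqrt_div (by norm_num), Real.rpow_sub h1, ← Real.sqrt_eq_rpow]
  field_simp

lemma integrable_one_add_sqrt_alphaMu (hμ : 0 < μ) :
    Integrable (fun t => 1 + √(2 / (1 + t))) (alphaMu μ) := by
  have := isProbabilityMeasure_alphaMu hμ
  exact (integrable_const 1).add (integrable_sqrt_two_div_alphaMu hμ)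

/-- The integrand of `genTranslation`, with both halves collected. -/
def translationIntegrand (x y : ℝ) (φ : ℝ → ℂ) (t : ℝ) : ℂ :=
  1 / 2 * (((1 + (x + y) / omegaTilde x y t : ℝ) : ℂ) * φ (omegaTilde x y t) +
    ((1 - (x + y) / omegaTilde x y t : ℝ) : ℂ) * φ (-omegaTilde x y t))

section Integrand

variable {x y : ℝ} {φ : ℝ → ℂ}

lemma norm_one_add_div_mul_le {C t : ℝ} (ht : t ∈ Ioo (-1 : ℝ) 1)
    (hφ : ∀ z, |z| ≤ |x| + |y| → ‖φ z‖ ≤ C) :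
    ‖((1 + (x + y) / omegaTilde x y t : ℝ) : ℂ) * φ (omegaTilde x y t)‖ ≤
      (1 + √(2 / (1 + t))) * C := by
  rw [norm_mul, Complex.norm_real, Real.norm_eq_abs]
  gcongr
  · exact abs_one_add_div_omegaTilde_le ht
  · exact hφ _ (by rw [abs_of_nonneg (omegaTilde_nonneg _ _ _)]; exact omegaTilde_le ht)

lemma one_sub_div_mul_eq (x y : ℝ) (φ : ℝ → ℂ) (t : ℝ) :
    ((1 - (x + y) / omegaTilde x y t : ℝ) : ℂ) * φ (-omegaTilde x y t) =
      ((1 + (-x + -y) / omegaTilde (-x) (-y) t : ℝ) : ℂ) *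
        (fun z => φ (-z)) (omegaTilde (-x) (-y) t) := by
  rw [omegaTilde_neg_neg, ← neg_add, neg_div, ← sub_eq_add_neg]

lemma norm_translationIntegrand_le {C t : ℝ} (ht : t ∈ Ioo (-1 : ℝ) 1)
    (hφ : ∀ z, |z| ≤ |x| + |y| → ‖φ z‖ ≤ C) :
    ‖translationIntegrand x y φ t‖ ≤ (1 + √(2 / (1 + t))) * C := by
  have hplus := norm_one_add_div_mul_le ht hφ
  have hminus := norm_one_add_div_mul_le (x := -x) (y := -y) (φ := fun z => φ (-z)) ht
    (C := C) fun z hz => hφ _ (by simpa using hz)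
  rw [translationIntegrand, one_sub_div_mul_eq, norm_mul]
  refine (mul_le_mul_of_nonneg_left ((norm_add_le _ _).trans (add_le_add hplus hminus))
    (norm_nonneg _)).trans_eq ?_
  norm_num
  ring

lemma integrable_one_add_div_mul (hμ : 0 < μ) (hφ : Continuous φ) (x y : ℝ) :
    Integrable (fun t => ((1 + (x + y) / omegaTilde x y t : ℝ) : ℂ) * φ (omegaTilde x y t))
      (alphaMu μ) := by
  obtain ⟨C, hC⟩ := (isCompact_Icc (a := -(|x| + |y|))
    (b := |x| + |y|)).exists_bound_of_continuousOn hφ.continuousOn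
  refine ((integrable_one_add_sqrt_alphaMu hμ).mul_const C).mono' ?_ ?_
  · have := (continuous_omegaTilde x y).measurable
    have := (hφ.comp (continuous_omegaTilde x y)).measurable
    exact Measurable.aestronglyMeasurable (by fun_prop)
  · filter_upwards [ae_alphaMu μ] with t ht
    exact norm_one_add_div_mul_le ht fun z hz => hC z (abs_le.1 hz)

lemma integrable_one_sub_div_mul (hμ : 0 < μ) (hφ : Continuous φ) (x y : ℝ) :
    Integrable (fun t => ((1 - (x + y) / omegaTilde x y t : ℝ) : ℂ) * φ (-omegaTilde x y t))
      (alphaMu μ) := by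
  simp only [one_sub_div_mul_eq]
  exact integrable_one_add_div_mul hμ (hφ.comp continuous_neg) (-x) (-y)

lemma integrable_translationIntegrand (hμ : 0 < μ) (hφ : Continuous φ) (x y : ℝ) :
    Integrable (translationIntegrand x y φ) (alphaMu μ) :=
  ((integrable_one_add_div_mul hμ hφ x y).add (integrable_one_sub_div_mul hμ hφ x y)).const_mul _

lemma genTranslation_eq_integral (hμ : 0 < μ) (hφ : Continuous φ) (x y : ℝ) :
    genTranslation μ y φ x = ∫ t, translationIntegrand x y φ t ∂(alphaMu μ) := by
  simp only [translationIntegrand]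
  rw [integral_const_mul, integral_add (integrable_one_add_div_mul hμ hφ x y)
    (integrable_one_sub_div_mul hμ hφ x y), mul_add]
  rfl

lemma translationIntegrand_pow_even {t : ℝ} (ht : t ∈ Ioo (-1 : ℝ) 1) (m : ℕ) :
    translationIntegrand x y (fun z => (z : ℂ) ^ (2 * m)) t =
      ((x ^ 2 + 2 * x * y * t + y ^ 2) ^ m : ℝ) := by
  rw [translationIntegrand, ← omegaTilde_sq ht, ← pow_mul]
  push_cast
  rw [(even_two_mul m).neg_pow]
  ring

lemma translationIntegrand_pow_odd {t : ℝ} (hx : x ≠ 0) (ht : t ∈ Ioo (-1 : ℝ) 1) (m : ℕ) :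
    translationIntegrand x y (fun z => (z : ℂ) ^ (2 * m + 1)) t =
      ((x + y) * (x ^ 2 + 2 * x * y * t + y ^ 2) ^ m : ℝ) := by
  have hω : (omegaTilde x y t : ℂ) ≠ 0 := mod_cast (omegaTilde_pos hx ht).ne'
  rw [translationIntegrand, ← omegaTilde_sq ht, ← pow_mul]
  push_cast
  rw [(odd_two_mul_add_one m).neg_pow, pow_succ]
  field_simp
  ring

end Integrand

lemma genTranslation_pow (hμ : 0 < μ) (n : ℕ) {x : ℝ} (hx : x ≠ 0) (y : ℝ) :
    genTranslation μ y (fun z => (z : ℂ) ^ n) x = dunklBinom μ n x y := by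
  rw [genTranslation_eq_integral hμ (by fun_prop)]
  obtain ⟨m, rfl | rfl⟩ := n.even_or_odd'
  · rw [← integral_alphaMu_pow hμ, ← integral_complex_ofReal]
    refine integral_congr_ae ?_
    filter_upwards [ae_alphaMu μ] with t ht using translationIntegrand_pow_even ht m
  · rw [dunklBinom_succ_of_even hμ (even_two_mul m), ← integral_alphaMu_pow hμ,
      ← integral_const_mul, ← integral_complex_ofReal]
    refine integral_congr_ae ?_
    filter_upwards [ae_alphaMu μ] with t ht using translationIntegrand_pow_odd hx ht m

lemma hasSum_genTranslation (hμ : 0 < μ) {a : ℕ → ℂ} {f : ℂ → ℂ} (hf : HasEntireSeries a f)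
    {x : ℝ} (hx : x ≠ 0) (y : ℝ) :
    HasSum (fun n => a n * (dunklBinom μ n x y : ℂ)) (genTranslation μ y (fun x : ℝ => f x) x) := by
  have hfc : Continuous fun x : ℝ => f x := hf.differentiable.continuous.comp (by fun_prop)
  have hterm : ∀ n, Continuous fun z : ℝ => a n * (z : ℂ) ^ n := fun n => by fun_prop
  rw [genTranslation_eq_integral hμ hfc]
  refine HasSum.congr_fun (hasSum_integral_of_dominated_convergence (μ := alphaMu μ)
    (F := fun n => translationIntegrand x y fun z => a n * (z : ℂ) ^ n)
    (fun n t => (1 + √(2 / (1 + t))) * (‖a n‖ * |(|x| + |y|)| ^ n)) (fun n => ?_) (fun n => ?_)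
    ?_ ?_ ?_) fun n => ?_
  · exact (integrable_translationIntegrand hμ (hterm n) x y).aestronglyMeasurable
  · filter_upwards [ae_alphaMu μ] with t ht
    refine norm_translationIntegrand_le ht fun z hz => ?_
    rw [norm_mul, norm_pow, Complex.norm_real, Real.norm_eq_abs]
    exact mul_le_mul_of_nonneg_left
      (pow_le_pow_left₀ (abs_nonneg _) (hz.trans (le_abs_self _)) _) (norm_nonneg _)
  · exact .of_forall fun t => (hf.summable_norm _).mul_left _
  · simp only [tsum_mul_left]
    exact (integrable_one_add_sqrt_alphaMu hμ).mul_const _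
  · refine .of_forall fun t => ?_
    have := hf (-omegaTilde x y t : ℝ)
    push_cast at this
    simpa [translationIntegrand] using (((hf (omegaTilde x y t)).mul_left _).add
      (this.mul_left _)).mul_left (1 / 2 : ℂ)
  · rw [← genTranslation_pow hμ n hx, genTranslation_eq_integral hμ (by fun_prop),
      ← integral_const_mul]
    refine integral_congr_ae (.of_forall fun t => ?_)
    simp only [translationIntegrand]
    ring

lemma dunklBinom_le_pow (hμ : 0 < μ) (n : ℕ) {x y : ℝ} (hx : 0 ≤ x) (hy : 0 ≤ y) :
    dunklBinom μ n x y ≤ (x + y) ^ n := by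
  have := isProbabilityMeasure_alphaMu hμ
  have heven : ∀ m, dunklBinom μ (2 * m) x y ≤ (x + y) ^ (2 * m) := by
    intro m
    rw [← integral_alphaMu_pow hμ m x y]
    have hconst : ∫ _, (x + y) ^ (2 * m) ∂(alphaMu μ) = (x + y) ^ (2 * m) := by simp
    rw [← hconst]
    refine integral_mono_ae (integrable_alphaMu_of_continuous hμ (by fun_prop))
      (integrable_const _) ?_
    filter_upwards [ae_alphaMu μ] with t ht
    have hω := omegaTilde_le (x := x) (y := y) ht
    rw [abs_of_nonneg hx, abs_of_nonneg hy] at hω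
    rw [← omegaTilde_sq ht, ← pow_mul]
    exact pow_le_pow_left₀ (omegaTilde_nonneg _ _ _) hω _
  rcases n.even_or_odd' with ⟨m, rfl | rfl⟩
  · exact heven m
  · rw [dunklBinom_succ_of_even hμ (even_two_mul m), pow_succ, mul_comm]
    gcongr
    exact heven m

/-- The terms of the double series of `e_μ(y 𝔇_μ) f (x)`; summing over `p.2` first gives the
translation series, summing along antidiagonals gives generalized binomials. -/
def translationDoubleTerm (μ : ℝ) (a : ℕ → ℂ) (x y : ℝ) (p : ℕ × ℕ) : ℂ :=
  a (p.1 + p.2) *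
    ((gammaMu μ (p.1 + p.2) / (gammaMu μ p.1 * gammaMu μ p.2) * (x ^ p.1 * y ^ p.2) : ℝ) : ℂ)

lemma sum_antidiagonal_translationDoubleTerm (a : ℕ → ℂ) (x y : ℝ) (n : ℕ) :
    ∑ p ∈ antidiagonal n, translationDoubleTerm μ a x y p = a n * (dunklBinom μ n x y : ℂ) := by
  rw [dunklBinom, Complex.ofReal_sum, Finset.mul_sum]
  refine Finset.sum_congr rfl fun p hp => ?_
  rw [Finset.HasAntidiagonal.mem_antidiagonal] at hp
  rw [translationDoubleTerm, hp]

lemma sum_antidiagonal_norm_translationDoubleTerm (hμ : 0 < μ) (a : ℕ → ℂ) (x y : ℝ) (n : ℕ) :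
    ∑ p ∈ antidiagonal n, ‖translationDoubleTerm μ a x y p‖ = ‖a n‖ * dunklBinom μ n |x| |y| := by
  rw [dunklBinom, Finset.mul_sum]
  refine Finset.sum_congr rfl fun p hp => ?_
  rw [Finset.HasAntidiagonal.mem_antidiagonal] at hp
  have hpos : 0 < gammaMu μ n / (gammaMu μ p.1 * gammaMu μ p.2) :=
    div_pos (gammaMu_pos hμ n) (mul_pos (gammaMu_pos hμ p.1) (gammaMu_pos hμ p.2))
  rw [translationDoubleTerm, hp, norm_mul, Complex.norm_real, Real.norm_eq_abs, abs_mul, abs_mul,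
    abs_pow, abs_pow, abs_of_pos hpos]

lemma summable_translationDoubleTerm (hμ : 0 < μ) {a : ℕ → ℂ} {f : ℂ → ℂ}
    (hf : HasEntireSeries a f) (x y : ℝ) : Summable (translationDoubleTerm μ a x y) := by
  rw [← Finset.HasAntidiagonal.sigmaAntidiagonalEquivProd.summable_iff]
  refine Summable.of_norm ((summable_sigma_of_nonneg fun _ => norm_nonneg _).2
    ⟨fun n => (hasSum_fintype _).summable, ?_⟩)
  refine Summable.of_nonneg_of_le (fun n => tsum_nonneg fun _ => norm_nonneg _) (fun n => ?_)
    (hf.summable_norm (|x| + |y|))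
  have hsum := sum_antidiagonal_norm_translationDoubleTerm hμ a x y n
  rw [← Finset.sum_coe_sort] at hsum
  rw [tsum_fintype, abs_of_nonneg (by positivity : 0 ≤ |x| + |y|)]
  refine hsum.le.trans ?_
  gcongr
  exact dunklBinom_le_pow hμ n (abs_nonneg x) (abs_nonneg y)

lemma hasSum_translationTerm (hμ : 0 < μ) {a : ℕ → ℂ} {f : ℂ → ℂ} (hf : HasEntireSeries a f)
    (x y : ℝ) :
    HasSum (translationTerm μ y f x) (∑' n, a n * (dunklBinom μ n x y : ℂ)) := by
  have hdouble := (summable_translationDoubleTerm hμ hf x y).hasSum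
  have hdiag : HasSum (fun n => a n * (dunklBinom μ n x y : ℂ))
      (∑' p, translationDoubleTerm μ a x y p) := by
    refine HasSum.congr_fun ((Finset.HasAntidiagonal.sigmaAntidiagonalEquivProd.hasSum_iff.2
      hdouble).sigma fun n => hasSum_fintype _) fun n => ?_
    rw [← sum_antidiagonal_translationDoubleTerm, ← Finset.sum_coe_sort]
    rfl
  rw [hdiag.tsum_eq]
  refine ((Equiv.prodComm ℕ ℕ).hasSum_iff.2 hdouble).prod_fiberwise fun j => ?_
  refine HasSum.congr_fun ((hf.dunklDeriv_iterate hμ j x).mul_left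
    ((y : ℂ) ^ j / (gammaMu μ j : ℂ))) fun k => ?_
  have h2 := gammaMu_ne_zero hμ j
  have h3 := gammaMu_ne_zero hμ k
  simp only [translationDoubleTerm, Function.comp, Equiv.prodComm_apply, Prod.swap_prod_mk]
  push_cast
  field_simp

lemma genTranslation_expMu (hμ : 0 < μ) (c : ℂ) {x : ℝ} (hx : x ≠ 0) (y : ℝ) :
    genTranslation μ y (fun x : ℝ => expMu μ (c * x)) x = expMu μ (c * x) * expMu μ (c * y) := by
  have hs := hasEntireSeries_expMu hμ c
  refine (hasSum_genTranslation hμ hs hx y).unique ?_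
  have hsx := (hs x).summable.norm
  have hsy := (hs y).summable.norm
  have hx_sum : expMu μ (c * x) = _ := (hs x).tsum_eq.symm
  have hy_sum : expMu μ (c * y) = _ := (hs y).tsum_eq.symm
  rw [hx_sum, hy_sum, tsum_mul_tsum_eq_tsum_sum_antidiagonal_of_summable_norm hsx hsy]
  refine HasSum.congr_fun
    (summable_norm_sum_mul_antidiagonal_of_summable_norm hsx hsy).of_norm.hasSum fun n => ?_
  rw [dunklBinom, Complex.ofReal_sum, Finset.mul_sum]
  refine Finset.sum_congr rfl fun p hp => ?_
  rw [Finset.HasAntidiagonal.mem_antidiagonal] at hp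
  subst hp
  have h1 := gammaMu_ne_zero hμ (p.1 + p.2)
  have h2 := gammaMu_ne_zero hμ p.1
  have h3 := gammaMu_ne_zero hμ p.2
  rw [pow_add]
  push_cast
  field_simp

lemma hasSum_translationTerm_genTranslation (hμ : 0 < μ) {f : ℂ → ℂ} (hf : Differentiable ℂ f)
    {x : ℝ} (hx : x ≠ 0) (y : ℝ) :
    HasSum (translationTerm μ y f x) (genTranslation μ y (fun x : ℝ => f x) x) := by
  obtain ⟨a, ha⟩ := exists_hasEntireSeries hf
  rw [← (hasSum_genTranslation hμ ha hx y).tsum_eq]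
  exact hasSum_translationTerm hμ ha x y

lemma summable_translationTerm (hμ : 0 < μ) {f : ℂ → ℂ} (hf : Differentiable ℂ f) (x y : ℝ) :
    Summable (translationTerm μ y f x) := by
  obtain ⟨a, ha⟩ := exists_hasEntireSeries hf
  exact (hasSum_translationTerm hμ ha x y).summable

/-! ### Schur's test -/

section Schur

open ENNReal (HolderConjugate)

variable {α β E 𝕜 : Type*} [MeasurableSpace α] [MeasurableSpace β] [NormedAddCommGroup E]
  [NormedSpace ℝ E] [RCLike 𝕜] {ν : Measure α} {ρ : Measure β} {k : α → β → ℝ} {C p q : ENNReal}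

/-- Schur's condition: the rows and the columns of the kernel `k` have `L¹`-norm at most `C`, so
that `φ ↦ ∫ k(·, z) φ(z) dρ(z)` has norm at most `C` from `L^p(ρ)` to `L^p(ν)` for `1 ≤ p ≤ ∞`. -/
structure IsSchurKernel (k : α → β → ℝ) (ν : Measure α) (ρ : Measure β) (C : ENNReal) : Prop where
  measurable : Measurable (Function.uncurry k)
  row_le : ∀ᵐ x ∂ν, ∫⁻ z, ‖k x z‖ₑ ∂ρ ≤ C
  col_le : ∀ᵐ z ∂ρ, ∫⁻ x, ‖k x z‖ₑ ∂ν ≤ C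

lemma ae_lt_top_of_eLpNorm_ne_top {f : α → ENNReal} (hf : AEMeasurable f ν) (hp : p ≠ 0)
    (h : eLpNorm f p ν ≠ ⊤) : ∀ᵐ x ∂ν, f x < ⊤ := by
  rcases eq_or_ne p ⊤ with rfl | hp'
  · rw [eLpNorm_exponent_top] at h
    filter_upwards [enorm_ae_le_eLpNormEssSup f ν] with x hx using hx.trans_lt h.lt_top
  · have hpos := ENNReal.toReal_pos hp hp'
    have hlint := (lintegral_rpow_enorm_lt_top_of_eLpNorm_lt_top hp hp' h.lt_top).ne
    filter_upwards [ae_lt_top' (hf.pow_const _) hlint] with x hx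
    rwa [ENNReal.rpow_lt_top_iff_of_pos hpos] at hx

namespace IsSchurKernel

lemma abs (hk : IsSchurKernel k ν ρ C) : IsSchurKernel (fun x z => |k x z|) ν ρ C where
  measurable := measurable_norm.comp hk.measurable
  row_le := by simpa using hk.row_le
  col_le := by simpa using hk.col_le

lemma swap (hk : IsSchurKernel k ν ρ C) : IsSchurKernel (fun z x => k x z) ρ ν C where
  measurable := hk.measurable.comp measurable_swap
  row_le := hk.col_le
  col_le := hk.row_le

lemma measurable_row (hk : IsSchurKernel k ν ρ C) (x : α) : Measurable (k x) :=
  hk.measurable.comp measurable_prodMk_left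

lemma aestronglyMeasurable_smul (hk : IsSchurKernel k ν ρ C) {φ : β → E}
    (hφ : AEStronglyMeasurable φ ρ) :
    AEStronglyMeasurable (fun q : α × β => k q.1 q.2 • φ q.2) (ν.prod ρ) :=
  hk.measurable.aestronglyMeasurable.smul hφ.comp_snd

lemma lintegral_row_rpow_le (hk : IsSchurKernel k ν ρ C) {f : β → ENNReal} (hf : AEMeasurable f ρ)
    {r : ℝ} (hr : 1 ≤ r) :
    ∀ᵐ x ∂ν, (∫⁻ z, ‖k x z‖ₑ * f z ∂ρ) ^ r ≤ C ^ (r - 1) * ∫⁻ z, ‖k x z‖ₑ * f z ^ r ∂ρ := by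
  filter_upwards [hk.row_le] with x hx
  set κ : Measure β := ρ.withDensity fun z => ‖k x z‖ₑ
  have hκ : ∀ g : β → ENNReal, ∫⁻ z, ‖k x z‖ₑ * g z ∂ρ = ∫⁻ z, g z ∂κ := fun g =>
    (lintegral_withDensity_eq_lintegral_mul_non_measurable _ (hk.measurable_row x).enorm
      (.of_forall fun z => enorm_lt_top) g).symm
  have hmass : κ univ ≤ C := by rwa [withDensity_apply _ .univ, setLIntegral_univ]
  have hr0 : 0 < r := one_pos.trans_le hr
  have hjensen := eLpNorm'_le_eLpNorm'_mul_rpow_measure_univ (μ := κ) (f := f) one_pos hr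
    ((hf.mono_ac (withDensity_absolutelyContinuous _ _)).aestronglyMeasurable)
  rw [hκ, hκ]
  simp only [eLpNorm', enorm_eq_self, ENNReal.rpow_one, div_one, one_div] at hjensen
  calc (∫⁻ z, f z ∂κ) ^ r ≤ ((∫⁻ z, f z ^ r ∂κ) ^ r⁻¹ * κ univ ^ (1 - r⁻¹)) ^ r := by
        gcongr
    _ = κ univ ^ (r - 1) * ∫⁻ z, f z ^ r ∂κ := by
        rw [ENNReal.mul_rpow_of_nonneg _ _ hr0.le, ← ENNReal.rpow_mul, ← ENNReal.rpow_mul,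
          inv_mul_cancel₀ hr0.ne', sub_mul, inv_mul_cancel₀ hr0.ne', one_mul, ENNReal.rpow_one,
          mul_comm]
    _ ≤ C ^ (r - 1) * ∫⁻ z, f z ^ r ∂κ := by
        gcongr

variable [SFinite ρ]

lemma lintegral_lintegral_le [SFinite ν] (hk : IsSchurKernel k ν ρ C) {f : β → ENNReal}
    (hf : AEMeasurable f ρ) :
    ∫⁻ x, ∫⁻ z, ‖k x z‖ₑ * f z ∂ρ ∂ν ≤ C * ∫⁻ z, f z ∂ρ := by
  rw [lintegral_lintegral_swap (hk.measurable.enorm.aemeasurable.mul hf.comp_snd),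
    ← lintegral_const_mul'' _ hf]
  refine lintegral_mono_ae ?_
  filter_upwards [hk.col_le] with z hz
  rw [lintegral_mul_const _ (hk.swap.measurable_row z).enorm]
  gcongr

lemma eLpNorm_lintegral_le [SFinite ν] (hk : IsSchurKernel k ν ρ C) {φ : β → E}
    (hφ : AEStronglyMeasurable φ ρ) (hp : 1 ≤ p) :
    eLpNorm (fun x => ∫⁻ z, ‖k x z • φ z‖ₑ ∂ρ) p ν ≤ C * eLpNorm φ p ρ := by
  simp only [enorm_smul]
  rcases eq_or_ne p ⊤ with rfl | hp'
  · rw [eLpNorm_exponent_top, eLpNorm_exponent_top]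
    refine essSup_le_of_ae_le _ ?_
    filter_upwards [hk.row_le] with x hx
    calc ∫⁻ z, ‖k x z‖ₑ * ‖φ z‖ₑ ∂ρ ≤ ∫⁻ z, ‖k x z‖ₑ * eLpNormEssSup φ ρ ∂ρ := by
          refine lintegral_mono_ae ?_
          filter_upwards [enorm_ae_le_eLpNormEssSup φ ρ] with z hz
          gcongr
      _ ≤ C * eLpNormEssSup φ ρ := by
          rw [lintegral_mul_const _ (hk.measurable_row x).enorm]
          gcongr
  · have hp0 : p ≠ 0 := (one_pos.trans_le hp).ne'
    have hr := ENNReal.toReal_mono hp' hp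
    rw [ENNReal.toReal_one] at hr
    have hr0 : 0 < p.toReal := one_pos.trans_le hr
    have hm : AEMeasurable (fun z => ‖φ z‖ₑ ^ p.toReal) ρ := hφ.enorm.pow_const _
    rw [eLpNorm_eq_lintegral_rpow_enorm_toReal hp0 hp',
      eLpNorm_eq_lintegral_rpow_enorm_toReal hp0 hp', one_div, ENNReal.rpow_inv_le_iff hr0,
      ENNReal.mul_rpow_of_nonneg _ _ hr0.le, ENNReal.rpow_inv_rpow hr0.ne']
    simp only [enorm_eq_self]
    calc ∫⁻ x, (∫⁻ z, ‖k x z‖ₑ * ‖φ z‖ₑ ∂ρ) ^ p.toReal ∂ν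
        ≤ ∫⁻ x, C ^ (p.toReal - 1) * ∫⁻ z, ‖k x z‖ₑ * ‖φ z‖ₑ ^ p.toReal ∂ρ ∂ν :=
          lintegral_mono_ae (hk.lintegral_row_rpow_le hφ.enorm hr)
      _ = C ^ (p.toReal - 1) * ∫⁻ x, ∫⁻ z, ‖k x z‖ₑ * ‖φ z‖ₑ ^ p.toReal ∂ρ ∂ν :=
          lintegral_const_mul'' _
            (hk.measurable.enorm.aemeasurable.mul hm.comp_snd).lintegral_prod_right'
      _ ≤ C ^ (p.toReal - 1) * (C * ∫⁻ z, ‖φ z‖ₑ ^ p.toReal ∂ρ) := by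
          gcongr
          exact hk.lintegral_lintegral_le hm
      _ = C ^ p.toReal * ∫⁻ z, ‖φ z‖ₑ ^ p.toReal ∂ρ := by
          rw [← mul_assoc]
          nth_rw 2 [← ENNReal.rpow_one C]
          rw [← ENNReal.rpow_add_of_nonneg _ _ (by linarith) zero_le_one, sub_add_cancel]

variable [SFinite ν]

lemma ae_integrable (hk : IsSchurKernel k ν ρ C) (hC : C ≠ ⊤) (hp : 1 ≤ p) {φ : β → E}
    (hφ : MemLp φ p ρ) : ∀ᵐ x ∂ν, Integrable (fun z => k x z • φ z) ρ := by
  have hm := (hk.aestronglyMeasurable_smul (ν := ν) hφ.1).enorm.lintegral_prod_right'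
  filter_upwards [ae_lt_top_of_eLpNorm_ne_top hm (one_pos.trans_le hp).ne'
    (ne_top_of_le_ne_top (ENNReal.mul_ne_top hC hφ.2.ne) (hk.eLpNorm_lintegral_le hφ.1 hp))]
    with x hx using ⟨(hk.measurable_row x).aestronglyMeasurable.smul hφ.1, hx⟩

lemma eLpNorm_integral_le (hk : IsSchurKernel k ν ρ C) (hp : 1 ≤ p) {φ : β → E}
    (hφ : AEStronglyMeasurable φ ρ) :
    eLpNorm (fun x => ∫ z, k x z • φ z ∂ρ) p ν ≤ C * eLpNorm φ p ρ :=
  (eLpNorm_mono_enorm fun _ => enorm_integral_le_lintegral_enorm _).trans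
    (hk.eLpNorm_lintegral_le hφ hp)

lemma memLp_integral (hk : IsSchurKernel k ν ρ C) (hC : C ≠ ⊤) (hp : 1 ≤ p) {φ : β → E}
    (hφ : MemLp φ p ρ) : MemLp (fun x => ∫ z, k x z • φ z ∂ρ) p ν :=
  ⟨(hk.aestronglyMeasurable_smul hφ.1).integral_prod_right',
    (hk.eLpNorm_integral_le hp hφ.1).trans_lt (ENNReal.mul_lt_top hC.lt_top hφ.2)⟩

lemma integrable_prod (hk : IsSchurKernel k ν ρ C) (hC : C ≠ ⊤) [HolderConjugate p q]
    {φ : β → 𝕜} {g : α → 𝕜} (hφ : MemLp φ p ρ) (hg : MemLp g q ν) :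
    Integrable (fun r : α × β => k r.1 r.2 • φ r.2 * g r.1) (ν.prod ρ) := by
  have hp : 1 ≤ p := HolderConjugate.one_le p q
  have hm : AEStronglyMeasurable (fun r : α × β => k r.1 r.2 • φ r.2 * g r.1) (ν.prod ρ) :=
    (hk.aestronglyMeasurable_smul hφ.1).mul hg.1.comp_fst
  refine (integrable_prod_iff hm).2 ⟨?_, ?_⟩
  · filter_upwards [hk.ae_integrable hC hp hφ] with x hx using hx.mul_const _
  · refine ((hk.abs.memLp_integral hC hp hφ.norm).integrable_mul hg.norm).congr
      (.of_forall fun x => ?_)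
    simp only [norm_mul, norm_smul, integral_mul_const, Real.norm_eq_abs, smul_eq_mul, Pi.mul_apply]

lemma integral_integral_mul (hk : IsSchurKernel k ν ρ C) (hC : C ≠ ⊤) [HolderConjugate p q]
    {φ : β → 𝕜} {g : α → 𝕜} (hφ : MemLp φ p ρ) (hg : MemLp g q ν) :
    ∫ x, (∫ z, k x z • φ z ∂ρ) * g x ∂ν = ∫ z, φ z * ∫ x, k x z • g x ∂ν ∂ρ := by
  simp only [← integral_mul_const, ← integral_const_mul]
  rw [integral_integral_swap (hk.integrable_prod hC hφ hg)]
  simp only [smul_mul_assoc, mul_smul_comm]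

end IsSchurKernel

end Schur

/-! ### The generalized translation as an integral operator -/

section Weight

variable {E : Type*} [NormedAddCommGroup E] [NormedSpace ℝ E]

instance sigmaFinite_weightMeasure (μ : ℝ) : SigmaFinite (weightMeasure μ) :=
  SigmaFinite.withDensity_ofReal _

lemma measurable_ofReal_abs_rpow (μ : ℝ) :
    Measurable fun x : ℝ => ENNReal.ofReal (|x| ^ (2 * μ)) := by
  fun_prop

lemma ae_ne_zero : ∀ᵐ x : ℝ, x ≠ 0 := by
  simp [ae_iff]

lemma ae_weightMeasure (μ : ℝ) : ae (weightMeasure μ) = ae (volume : Measure ℝ) := by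
  refine le_antisymm (withDensity_absolutelyContinuous _ _).ae_le
    (withDensity_absolutelyContinuous' (measurable_ofReal_abs_rpow μ).aemeasurable ?_).ae_le
  filter_upwards [ae_ne_zero] with x hx
  simpa using Real.rpow_pos_of_pos (abs_pos.2 hx) _

lemma ae_weightMeasure_ne_zero (μ : ℝ) : ∀ᵐ x ∂(weightMeasure μ), x ≠ 0 := by
  rw [ae_weightMeasure]
  exact ae_ne_zero

lemma lintegral_weightMeasure (μ : ℝ) (f : ℝ → ENNReal) :
    ∫⁻ x, f x ∂(weightMeasure μ) = ∫⁻ x, ENNReal.ofReal (|x| ^ (2 * μ)) * f x :=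
  lintegral_withDensity_eq_lintegral_mul_non_measurable _ (measurable_ofReal_abs_rpow μ)
    (.of_forall fun _ => ENNReal.ofReal_lt_top) f

lemma integral_weightMeasure (μ : ℝ) (f : ℝ → E) :
    ∫ x, f x ∂(weightMeasure μ) = ∫ x, |x| ^ (2 * μ) • f x := by
  rw [weightMeasure, integral_withDensity_eq_integral_toReal_smul (measurable_ofReal_abs_rpow μ)
    (.of_forall fun _ => ENNReal.ofReal_lt_top)]
  simp only [ENNReal.toReal_ofReal (Real.rpow_nonneg (abs_nonneg _) _)]

lemma integrable_weightMeasure_iff (μ : ℝ) (f : ℝ → E) :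
    Integrable f (weightMeasure μ) ↔ Integrable fun x => |x| ^ (2 * μ) • f x := by
  rw [weightMeasure, integrable_withDensity_iff_integrable_smul' (measurable_ofReal_abs_rpow μ)
    (.of_forall fun _ => ENNReal.ofReal_lt_top)]
  simp only [ENNReal.toReal_ofReal (Real.rpow_nonneg (abs_nonneg _) _)]

end Weight

/-- Sixteen times the squared area of the triangle with sides `x, y, z`, by Heron's formula. -/
def heron (x y z : ℝ) : ℝ := (x + y + z) * (y + z - x) * (x + z - y) * (x + y - z)

/-- The kernel of the generalized translation by `y ≠ 0` with respect to `|z|^{2μ} dz`. -/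
def translationKernel (μ y x z : ℝ) : ℝ :=
  if 0 < heron x y z then
    (x + y + z) * (y + z - x) * (x + z - y) / (4 * x * y * z) * (heron x y z / 4) ^ (μ - 1) *
      |x * y * z| ^ (1 - 2 * μ) / ProbabilityTheory.beta (1 / 2) μ
  else 0

lemma translationKernel_neg_swap (μ y x z : ℝ) :
    translationKernel μ (-y) z x = translationKernel μ y x z := by
  have hheron : heron z (-y) x = heron x y z := by simp only [heron]; ring
  have habs : |z * -y * x| = |x * y * z| := by rw [← abs_neg]; congr 1; ring
  rw [translationKernel, translationKernel, hheron, habs]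
  congr 4
  rw [← neg_div_neg_eq]
  ring

lemma measurable_translationKernel (μ y : ℝ) :
    Measurable (Function.uncurry (translationKernel μ y)) := by
  have hheron : Measurable fun q : ℝ × ℝ => heron q.1 y q.2 := by unfold heron; fun_prop
  exact Measurable.ite (hheron measurableSet_Ioi) (by fun_prop) measurable_const

/-- The solution `t` of `omegaTilde x y t = |z|`. Up to sign, it is the cosine of the angle
between the sides `x` and `y` of the triangle with sides `x, y, z`. -/
def cosAngle (x y z : ℝ) : ℝ := (z ^ 2 - x ^ 2 - y ^ 2) / (2 * x * y)

lemma hasDerivAt_cosAngle (x y z : ℝ) : HasDerivAt (cosAngle x y) (z / (x * y)) z := by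
  refine ((((hasDerivAt_pow 2 z).sub_const (x ^ 2)).sub_const (y ^ 2)).div_const
    (2 * x * y)).congr_deriv ?_
  rw [mul_assoc]
  simp [mul_div_mul_left]

lemma measurable_heron (x y : ℝ) : Measurable (heron x y) := by
  unfold heron; fun_prop

/-- The range of the substitution `z = omegaTilde x y t`. -/
def thirdSides (x y : ℝ) : Set ℝ := {z | 0 < z ∧ 0 < heron x y z}

lemma measurableSet_thirdSides (x y : ℝ) : MeasurableSet (thirdSides x y) := by
  exact measurableSet_Ioi.inter (measurable_heron x y measurableSet_Ioi)

section ChangeOfVariables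

variable {x y z : ℝ}

lemma one_sub_cosAngle_sq (hx : x ≠ 0) (hy : y ≠ 0) (z : ℝ) :
    1 - cosAngle x y z ^ 2 = heron x y z / 4 / |x * y| ^ 2 := by
  rw [cosAngle, heron, sq_abs]
  field_simp
  ring

lemma cosAngle_mem_Ioo_iff (hx : x ≠ 0) (hy : y ≠ 0) :
    cosAngle x y z ∈ Ioo (-1 : ℝ) 1 ↔ 0 < heron x y z := by
  have : 0 < |x * y| ^ 2 := by positivity
  rw [mem_Ioo, ← abs_lt, ← sq_lt_one_iff_abs_lt_one, ← sub_pos, one_sub_cosAngle_sq hx hy,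
    div_pos_iff_of_pos_right this, div_pos_iff_of_pos_right four_pos]

lemma omegaTilde_cosAngle (hx : x ≠ 0) (hy : y ≠ 0) (hz : 0 ≤ z) :
    omegaTilde x y (cosAngle x y z) = z := by
  have : x ^ 2 + 2 * x * y * ((z ^ 2 - x ^ 2 - y ^ 2) / (2 * x * y)) + y ^ 2 = z ^ 2 := by
    field_simp
    ring
  rw [omegaTilde, cosAngle, this, Real.sqrt_sq hz]

lemma cosAngle_omegaTilde (hx : x ≠ 0) (hy : y ≠ 0) {t : ℝ} (ht : t ∈ Ioo (-1 : ℝ) 1) :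
    cosAngle x y (omegaTilde x y t) = t := by
  rw [cosAngle, omegaTilde_sq ht]
  field_simp
  ring

lemma injOn_cosAngle (hx : x ≠ 0) (hy : y ≠ 0) : InjOn (cosAngle x y) (thirdSides x y) :=
  fun z hz w hw h => by
    rw [← omegaTilde_cosAngle hx hy hz.1.le, h, omegaTilde_cosAngle hx hy hw.1.le]

lemma image_cosAngle (hx : x ≠ 0) (hy : y ≠ 0) :
    cosAngle x y '' thirdSides x y = Ioo (-1) 1 := by
  refine Subset.antisymm (image_subset_iff.2 fun z hz => (cosAngle_mem_Ioo_iff hx hy).2 hz.2)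
    fun t ht => ⟨omegaTilde x y t, ⟨omegaTilde_pos hx ht, ?_⟩, cosAngle_omegaTilde hx hy ht⟩
  rwa [← cosAngle_mem_Ioo_iff hx hy, cosAngle_omegaTilde hx hy ht]

lemma alphaDensity_cosAngle (hx : x ≠ 0) (hy : y ≠ 0) (hH : 0 < heron x y z) :
    alphaDensity μ (cosAngle x y z) = (1 + cosAngle x y z) * (heron x y z / 4) ^ (μ - 1) *
      (|x * y| ^ (1 - 2 * μ) * |x * y|) / ProbabilityTheory.beta (1 / 2) μ := by
  obtain ⟨hlower, hupper⟩ := (cosAngle_mem_Ioo_iff hx hy).2 hH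
  have hsub : 0 < 1 - cosAngle x y z := by linarith
  have hadd : 0 < 1 + cosAngle x y z := by linarith
  have hxy : 0 < |x * y| := by positivity
  have hmul : ((1 - cosAngle x y z) * (1 + cosAngle x y z)) ^ (μ - 1) =
      (heron x y z / 4) ^ (μ - 1) * (|x * y| ^ (1 - 2 * μ) * |x * y|) := by
    rw [show (1 - cosAngle x y z) * (1 + cosAngle x y z) = 1 - cosAngle x y z ^ 2 by ring,
      one_sub_cosAngle_sq hx hy, Real.div_rpow (by positivity) (by positivity), div_eq_mul_inv,
      ← Real.rpow_neg (by positivity), ← Real.rpow_natCast_mul hxy.le, ← Real.rpow_add_one hxy.ne']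
    congr 2
    push_cast
    ring
  rw [alphaDensity, mul_assoc, ← hmul, Real.mul_rpow hsub.le hadd.le, Real.rpow_sub_one hadd.ne']
  field_simp

lemma rpow_mul_translationKernel (hx : x ≠ 0) (hy : y ≠ 0) (hz : z ≠ 0)
    (hH : 0 < heron x y z) :
    |z| ^ (2 * μ) * translationKernel μ y x z =
      |z / (x * y)| * (alphaDensity μ (cosAngle x y z) * (1 / 2 * (1 + (x + y) / z))) := by
  have hxy : 0 < |x * y| := by positivity
  have hz' : 0 < |z| := by positivity
  have hz_rpow : |z| ^ (2 * μ) * |z| ^ (1 - 2 * μ) = |z| := by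
    rw [← Real.rpow_add hz', add_sub_cancel, Real.rpow_one]
  have hfactor : (1 + cosAngle x y z) * (1 / 2 * (1 + (x + y) / z)) =
      (x + y + z) * (y + z - x) * (x + z - y) / (4 * x * y * z) := by
    rw [cosAngle]
    field_simp
    ring
  rw [translationKernel, if_pos hH, alphaDensity_cosAngle hx hy hH, ← hfactor, abs_mul (x * y) z,
    Real.mul_rpow hxy.le hz'.le, abs_div]
  nth_rw 3 [← hz_rpow]
  field_simp

lemma setIntegral_Ioo_eq_thirdSides {E : Type*} [NormedAddCommGroup E] [NormedSpace ℝ E]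
    (hx : x ≠ 0) (hy : y ≠ 0) (f : ℝ → E) :
    ∫ t in Ioo (-1) 1, f t = ∫ z in thirdSides x y, |z / (x * y)| • f (cosAngle x y z) := by
  rw [← image_cosAngle hx hy]
  exact integral_image_eq_integral_abs_deriv_smul (measurableSet_thirdSides x y)
    (fun z _ => (hasDerivAt_cosAngle x y z).hasDerivWithinAt) (injOn_cosAngle hx hy) f

lemma setLIntegral_Ioo_eq_thirdSides (hx : x ≠ 0) (hy : y ≠ 0) (f : ℝ → ENNReal) :
    ∫⁻ t in Ioo (-1) 1, f t =
      ∫⁻ z in thirdSides x y, ENNReal.ofReal |z / (x * y)| * f (cosAngle x y z) := by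
  rw [← image_cosAngle hx hy]
  exact lintegral_image_eq_lintegral_abs_deriv_mul (measurableSet_thirdSides x y)
    (fun z _ => (hasDerivAt_cosAngle x y z).hasDerivWithinAt) (injOn_cosAngle hx hy) f

lemma integral_Ioi_eq_integral_alphaMu (hμ : 0 < μ) (hx : x ≠ 0) (hy : y ≠ 0) (φ : ℝ → ℂ) :
    ∫ z in Ioi 0, |z| ^ (2 * μ) • translationKernel μ y x z • φ z =
      1 / 2 * ∫ t, ((1 + (x + y) / omegaTilde x y t : ℝ) : ℂ) * φ (omegaTilde x y t)
        ∂(alphaMu μ) := by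
  rw [setIntegral_eq_of_subset_of_forall_sdiff_eq_zero (s := thirdSides x y) measurableSet_Ioi
      (fun z hz => hz.1) fun z hz => ?_, integral_alphaMu hμ, setIntegral_Ioo_eq_thirdSides hx hy,
      ← integral_const_mul]
  · refine setIntegral_congr_fun (measurableSet_thirdSides x y) fun z hz => ?_
    have := congrArg (fun r : ℝ => (r : ℂ))
      (rpow_mul_translationKernel (μ := μ) hx hy hz.1.ne' hz.2)
    simp only [omegaTilde_cosAngle hx hy hz.1.le, Complex.real_smul]
    push_cast at this ⊢
    linear_combination φ z * this
  · rw [translationKernel, if_neg fun h => hz.2 ⟨hz.1, h⟩, zero_smul, smul_zero]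

lemma lintegral_Ioi_eq_lintegral_alphaMu (hμ : 0 < μ) (hx : x ≠ 0) (hy : y ≠ 0) :
    ∫⁻ z in Ioi 0, ENNReal.ofReal (|z| ^ (2 * μ)) * ‖translationKernel μ y x z‖ₑ =
      ∫⁻ t, ‖1 / 2 * (1 + (x + y) / omegaTilde x y t)‖ₑ ∂(alphaMu μ) := by
  have hsupport : (fun z => ENNReal.ofReal (|z| ^ (2 * μ)) * ‖translationKernel μ y x z‖ₑ).support ⊆
      heron x y ⁻¹' Ioi 0 := Function.support_subset_iff'.2 fun z hz => by
    rw [translationKernel, if_neg (show ¬ 0 < heron x y z from hz), enorm_zero, mul_zero]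
  have hinter : heron x y ⁻¹' Ioi 0 ∩ Ioi 0 = thirdSides x y := inter_comm _ _
  rw [← setLIntegral_eq_of_support_subset hsupport,
    Measure.restrict_restrict (measurable_heron x y measurableSet_Ioi), hinter, lintegral_alphaMu,
    setLIntegral_Ioo_eq_thirdSides hx hy]
  refine setLIntegral_congr_fun (measurableSet_thirdSides x y) fun z hz => ?_
  have := congrArg (fun r : ℝ => ‖r‖ₑ) (rpow_mul_translationKernel (μ := μ) hx hy hz.1.ne' hz.2)
  have hα := alphaDensity_nonneg hμ ((cosAngle_mem_Ioo_iff hx hy).2 hz.2)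
  simp only [enorm_mul, Real.enorm_of_nonneg hα, Real.enorm_of_nonneg (abs_nonneg _),
    Real.enorm_of_nonneg (Real.rpow_nonneg (abs_nonneg _) _)] at this
  simp only [omegaTilde_cosAngle hx hy hz.1.le, enorm_mul, this]

end ChangeOfVariables

lemma lintegral_eq_lintegral_Ioi_add_comp_neg {f : ℝ → ENNReal} (hf : Measurable f) :
    ∫⁻ z, f z = (∫⁻ z in Ioi 0, f z) + ∫⁻ z in Ioi 0, f (-z) := by
  rw [← lintegral_add_compl f (measurableSet_Ioi (a := (0 : ℝ))), compl_Ioi,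
    setLIntegral_congr Iio_ae_eq_Iic.symm,
    ← (Measure.measurePreserving_neg (volume : Measure ℝ)).setLIntegral_comp_preimage
      measurableSet_Iio hf]
  simp

lemma translationKernel_neg_right (μ y x z : ℝ) :
    translationKernel μ y x (-z) = translationKernel μ (-y) (-x) z := by
  have hheron : heron x y (-z) = heron (-x) (-y) z := by
    simp only [heron]
    ring
  have habs : |x * y * -z| = |-x * -y * z| := by rw [neg_mul_neg, mul_neg, abs_neg]
  simp only [translationKernel, hheron, habs]
  congr 4
  rw [← neg_div_neg_eq]
  ring

/-- The bound furnished by Schur's test for the norm of the generalized translations. -/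
def translationBound (μ : ℝ) : ENNReal :=
  ∫⁻ t, ENNReal.ofReal (1 + √(2 / (1 + t))) ∂(alphaMu μ)

lemma translationBound_ne_top (hμ : 0 < μ) : translationBound μ ≠ ⊤ :=
  (integrable_one_add_sqrt_alphaMu hμ).lintegral_lt_top.ne

lemma one_le_translationBound (hμ : 0 < μ) : 1 ≤ translationBound μ := by
  have := isProbabilityMeasure_alphaMu hμ
  calc (1 : ENNReal) = ∫⁻ _, 1 ∂(alphaMu μ) := by simp
    _ ≤ translationBound μ := by
      refine lintegral_mono fun t => ENNReal.one_le_ofReal.2 ?_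
      exact le_add_of_nonneg_right (Real.sqrt_nonneg _)

lemma lintegral_Ioi_translationKernel_le (hμ : 0 < μ) {x y : ℝ} (hx : x ≠ 0) (hy : y ≠ 0) :
    ∫⁻ z in Ioi 0, ENNReal.ofReal (|z| ^ (2 * μ)) * ‖translationKernel μ y x z‖ₑ ≤
      translationBound μ / 2 := by
  have hhalf : translationBound μ / 2 =
      ∫⁻ t, ENNReal.ofReal (1 + √(2 / (1 + t))) * 2⁻¹ ∂(alphaMu μ) := by
    rw [lintegral_mul_const _ (by fun_prop), translationBound, div_eq_mul_inv]
  rw [lintegral_Ioi_eq_lintegral_alphaMu hμ hx hy, hhalf]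
  refine lintegral_mono_ae ?_
  filter_upwards [ae_alphaMu μ] with t ht
  rw [enorm_mul, mul_comm]
  gcongr
  · rw [Real.enorm_eq_ofReal_abs]
    exact ENNReal.ofReal_le_ofReal (abs_one_add_div_omegaTilde_le ht)
  · simp [Real.enorm_eq_ofReal_abs]

lemma lintegral_translationKernel_le (hμ : 0 < μ) {x y : ℝ} (hx : x ≠ 0) (hy : y ≠ 0) :
    ∫⁻ z, ‖translationKernel μ y x z‖ₑ ∂(weightMeasure μ) ≤ translationBound μ := by
  have hmeas : Measurable fun z =>
      ENNReal.ofReal (|z| ^ (2 * μ)) * ‖translationKernel μ y x z‖ₑ :=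
    (measurable_ofReal_abs_rpow μ).mul
      ((measurable_translationKernel μ y).comp measurable_prodMk_left).enorm
  rw [lintegral_weightMeasure, lintegral_eq_lintegral_Ioi_add_comp_neg hmeas,
    ← ENNReal.add_halves (translationBound μ)]
  simp only [translationKernel_neg_right, abs_neg]
  exact add_le_add (lintegral_Ioi_translationKernel_le hμ hx hy)
    (lintegral_Ioi_translationKernel_le hμ (neg_ne_zero.2 hx) (neg_ne_zero.2 hy))

lemma isSchurKernel_translationKernel (hμ : 0 < μ) {y : ℝ} (hy : y ≠ 0) :
    IsSchurKernel (translationKernel μ y) (weightMeasure μ) (weightMeasure μ)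
      (translationBound μ) where
  measurable := measurable_translationKernel μ y
  row_le := by
    filter_upwards [ae_weightMeasure_ne_zero μ] with x hx
      using lintegral_translationKernel_le hμ hx hy
  col_le := by
    filter_upwards [ae_weightMeasure_ne_zero μ] with z hz
    simpa only [translationKernel_neg_swap] using
      lintegral_translationKernel_le hμ hz (neg_ne_zero.2 hy)

lemma genTranslation_eq_integral_translationKernel (hμ : 0 < μ) {x y : ℝ} (hx : x ≠ 0)
    (hy : y ≠ 0) {φ : ℝ → ℂ}
    (hφ : Integrable (fun z => translationKernel μ y x z • φ z) (weightMeasure μ)) :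
    genTranslation μ y φ x = ∫ z, translationKernel μ y x z • φ z ∂(weightMeasure μ) := by
  have hint := (integrable_weightMeasure_iff _ _).1 hφ
  have hneg : ∫ z in Ioi 0, |z| ^ (2 * μ) • translationKernel μ y x (-z) • φ (-z) =
      1 / 2 * ∫ t, ((1 - (x + y) / omegaTilde x y t : ℝ) : ℂ) * φ (-omegaTilde x y t)
        ∂(alphaMu μ) := by
    simpa only [translationKernel_neg_right, one_sub_div_mul_eq] using
      integral_Ioi_eq_integral_alphaMu hμ (neg_ne_zero.2 hx) (neg_ne_zero.2 hy) fun z => φ (-z)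
  rw [integral_weightMeasure, ← intervalIntegral.integral_Iic_add_Ioi hint.integrableOn
    hint.integrableOn (b := 0), add_comm, genTranslation, ← hneg,
    ← integral_Ioi_eq_integral_alphaMu hμ hx hy, ← neg_zero, ← integral_comp_neg_Ioi]
  simp only [neg_zero, abs_neg]

section Lp

variable {φ φ' : ℝ → ℂ} {p q : ENNReal}

lemma genTranslation_zero (hμ : 0 < μ) (φ : ℝ → ℂ) {x : ℝ} (hx : x ≠ 0) :
    genTranslation μ 0 φ x = φ x := by
  have := isProbabilityMeasure_alphaMu hμ
  have hω : ∀ t, omegaTilde x 0 t = |x| := fun t => by simp [omegaTilde, Real.sqrt_sq_eq_abs]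
  simp only [genTranslation, hω, add_zero, integral_const, probReal_univ, one_smul]
  rcases abs_cases x with ⟨habs, -⟩ | ⟨habs, -⟩
  · rw [habs, div_self hx]
    norm_num
    ring
  · rw [habs, div_neg, div_self hx]
    norm_num
    ring

lemma genTranslation_zero_ae_eq (hμ : 0 < μ) (φ : ℝ → ℂ) :
    genTranslation μ 0 φ =ᵐ[weightMeasure μ] φ := by
  filter_upwards [ae_weightMeasure_ne_zero μ] with x hx using genTranslation_zero hμ φ hx

lemma genTranslation_ae_eq_integral (hμ : 0 < μ) {y : ℝ} (hy : y ≠ 0) (hp : 1 ≤ p)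
    (hφ : MemLp φ p (weightMeasure μ)) : genTranslation μ y φ =ᵐ[weightMeasure μ]
      fun x => ∫ z, translationKernel μ y x z • φ z ∂(weightMeasure μ) := by
  filter_upwards [ae_weightMeasure_ne_zero μ, (isSchurKernel_translationKernel hμ hy).ae_integrable
    (translationBound_ne_top hμ) hp hφ] with x hx hint
    using genTranslation_eq_integral_translationKernel hμ hx hy hint

lemma memLp_genTranslation (hμ : 0 < μ) (y : ℝ) (hp : 1 ≤ p)
    (hφ : MemLp φ p (weightMeasure μ)) : MemLp (genTranslation μ y φ) p (weightMeasure μ) := by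
  rcases eq_or_ne y 0 with rfl | hy
  · exact hφ.ae_eq (genTranslation_zero_ae_eq hμ φ).symm
  · exact ((isSchurKernel_translationKernel hμ hy).memLp_integral (translationBound_ne_top hμ) hp
      hφ).ae_eq (genTranslation_ae_eq_integral hμ hy hp hφ).symm

lemma eLpNorm_genTranslation_le_mul (hμ : 0 < μ) (y : ℝ) (hp : 1 ≤ p)
    (hφ : MemLp φ p (weightMeasure μ)) : eLpNorm (genTranslation μ y φ) p (weightMeasure μ) ≤
      translationBound μ * eLpNorm φ p (weightMeasure μ) := by
  rcases eq_or_ne y 0 with rfl | hy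
  · rw [eLpNorm_congr_ae (genTranslation_zero_ae_eq hμ φ)]
    exact le_mul_of_one_le_left' (one_le_translationBound hμ)
  · rw [eLpNorm_congr_ae (genTranslation_ae_eq_integral hμ hy hp hφ)]
    exact (isSchurKernel_translationKernel hμ hy).eLpNorm_integral_le hp hφ.1

lemma genTranslation_sub_ae_eq (hμ : 0 < μ) (y : ℝ) (hp : 1 ≤ p)
    (hφ : MemLp φ p (weightMeasure μ)) (hφ' : MemLp φ' p (weightMeasure μ)) :
    genTranslation μ y (φ - φ') =ᵐ[weightMeasure μ]
      genTranslation μ y φ - genTranslation μ y φ' := by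
  rcases eq_or_ne y 0 with rfl | hy
  · filter_upwards [ae_weightMeasure_ne_zero μ] with x hx
    simp only [Pi.sub_apply, genTranslation_zero hμ _ hx]
  filter_upwards [genTranslation_ae_eq_integral hμ hy hp hφ,
    genTranslation_ae_eq_integral hμ hy hp hφ',
    genTranslation_ae_eq_integral hμ hy hp (hφ.sub hφ'),
    (isSchurKernel_translationKernel hμ hy).ae_integrable (translationBound_ne_top hμ) hp hφ,
    (isSchurKernel_translationKernel hμ hy).ae_integrable (translationBound_ne_top hμ) hp hφ']
    with x h h' hsub hi hi'
  rw [Pi.sub_apply, h, h', hsub, ← integral_sub hi hi']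
  simp only [Pi.sub_apply, smul_sub]

lemma genTranslation_congr_ae (hμ : 0 < μ) (y : ℝ) (hp : 1 ≤ p)
    (hφ : MemLp φ p (weightMeasure μ)) (h : φ =ᵐ[weightMeasure μ] φ') :
    genTranslation μ y φ =ᵐ[weightMeasure μ] genTranslation μ y φ' := by
  rcases eq_or_ne y 0 with rfl | hy
  · exact (genTranslation_zero_ae_eq hμ φ).trans (h.trans (genTranslation_zero_ae_eq hμ φ').symm)
  filter_upwards [genTranslation_ae_eq_integral hμ hy hp hφ,
    genTranslation_ae_eq_integral hμ hy hp (hφ.ae_eq h)] with x hx hx'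
  rw [hx, hx']
  refine integral_congr_ae ?_
  filter_upwards [h] with z hz
  rw [hz]

lemma integral_genTranslation_mul (hμ : 0 < μ) (y : ℝ) [ENNReal.HolderConjugate p q] {g : ℝ → ℂ}
    (hφ : MemLp φ p (weightMeasure μ)) (hg : MemLp g q (weightMeasure μ)) :
    ∫ x, genTranslation μ y φ x * g x ∂(weightMeasure μ) =
      ∫ z, φ z * genTranslation μ (-y) g z ∂(weightMeasure μ) := by
  rcases eq_or_ne y 0 with rfl | hy
  · refine integral_congr_ae ?_
    filter_upwards [ae_weightMeasure_ne_zero μ] with x hx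
    rw [neg_zero, genTranslation_zero hμ _ hx, genTranslation_zero hμ _ hx]
  calc ∫ x, genTranslation μ y φ x * g x ∂(weightMeasure μ)
      = ∫ x, (∫ z, translationKernel μ y x z • φ z ∂(weightMeasure μ)) * g x
          ∂(weightMeasure μ) :=
        integral_congr_ae ((genTranslation_ae_eq_integral hμ hy
          (ENNReal.HolderConjugate.one_le p q) hφ).mul .rfl)
    _ = ∫ z, φ z * ∫ x, translationKernel μ (-y) z x • g x ∂(weightMeasure μ)
          ∂(weightMeasure μ) := by
        simp only [translationKernel_neg_swap]
        exact (isSchurKernel_translationKernel hμ hy).integral_integral_mul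
          (translationBound_ne_top hμ) hφ hg
    _ = ∫ z, φ z * genTranslation μ (-y) g z ∂(weightMeasure μ) :=
        integral_congr_ae (Filter.EventuallyEq.rfl.mul (genTranslation_ae_eq_integral hμ
          (neg_ne_zero.2 hy) (ENNReal.HolderConjugate.one_le q p) hg).symm)

end Lp

/-! ### Moment problems with exponential moments and density of `𝔖` -/

section ExpMoments

variable {ν : Measure ℝ} {G : ℝ → ℂ}

lemma charFun_withDensity_ofReal {H : ℝ → ℝ} (hH : Integrable H ν) (ξ : ℝ) :
    charFun (ν.withDensity fun x => ENNReal.ofReal (H x)) ξ =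
      ∫ x : ℝ, Complex.exp (ξ * x * Complex.I) * (max (H x) 0 : ℝ) ∂ν := by
  rw [charFun_apply_real, integral_withDensity_eq_integral_toReal_smul₀
    hH.1.aemeasurable.ennreal_ofReal (.of_forall fun _ => ENNReal.ofReal_lt_top)]
  simp only [ENNReal.toReal_ofReal', Complex.real_smul, mul_comm]

lemma integrable_exp_I_mul (hG : Integrable G ν) (ξ : ℝ) :
    Integrable (fun x : ℝ => Complex.exp (ξ * x * Complex.I) * G x) ν := by
  refine hG.bdd_mul (c := 1) (Continuous.aestronglyMeasurable (by fun_prop))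
    (.of_forall fun x => ?_)
  exact_mod_cast (Complex.norm_exp_ofReal_mul_I (ξ * x)).le

lemma integrable_exp_I_mul_posPart {H : ℝ → ℝ} (hH : Integrable H ν) (ξ : ℝ) :
    Integrable (fun x : ℝ => Complex.exp (ξ * x * Complex.I) * (max (H x) 0 : ℝ)) ν :=
  integrable_exp_I_mul (G := fun x => ((max (H x) 0 : ℝ) : ℂ)) hH.pos_part.ofReal ξ

lemma ae_eq_zero_of_integral_exp_eq_zero_real {H : ℝ → ℝ} (hH : Integrable H ν)
    (h0 : ∀ ξ : ℝ, ∫ x : ℝ, Complex.exp (ξ * x * Complex.I) * (H x : ℂ) ∂ν = 0) :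
    H =ᵐ[ν] 0 := by
  have hneg : Integrable (fun x => -H x) ν := hH.neg
  have : IsFiniteMeasure (ν.withDensity fun x => ENNReal.ofReal (H x)) :=
    isFiniteMeasure_withDensity hH.lintegral_lt_top.ne
  have : IsFiniteMeasure (ν.withDensity fun x => ENNReal.ofReal (-H x)) :=
    isFiniteMeasure_withDensity hneg.lintegral_lt_top.ne
  have hparts : (ν.withDensity fun x => ENNReal.ofReal (H x)) =
      ν.withDensity fun x => ENNReal.ofReal (-H x) := by
    refine Measure.ext_of_charFun (funext fun ξ => ?_)
    rw [charFun_withDensity_ofReal hH, charFun_withDensity_ofReal hneg, ← sub_eq_zero,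
      ← integral_sub (integrable_exp_I_mul_posPart hH ξ)
        (integrable_exp_I_mul_posPart hneg ξ), ← h0 ξ]
    congr 1 with x
    rw [← mul_sub, ← Complex.ofReal_sub]
    congr 2
    exact max_zero_sub_max_neg_zero_eq_self (H x)
  have hae := (withDensity_eq_iff hH.1.aemeasurable.ennreal_ofReal
    hneg.1.aemeasurable.ennreal_ofReal hH.lintegral_lt_top.ne).1 hparts
  filter_upwards [hae] with x hx
  rcases le_total 0 (H x) with h | h
  · rw [ENNReal.ofReal_of_nonpos (neg_nonpos.2 h), ENNReal.ofReal_eq_zero] at hx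
    exact le_antisymm hx h
  · rw [ENNReal.ofReal_of_nonpos h, eq_comm, ENNReal.ofReal_eq_zero] at hx
    exact le_antisymm h (neg_nonpos.1 hx)

lemma ae_eq_zero_of_integral_exp_eq_zero (hG : Integrable G ν)
    (h0 : ∀ ξ : ℝ, ∫ x : ℝ, Complex.exp (ξ * x * Complex.I) * G x ∂ν = 0) : G =ᵐ[ν] 0 := by
  have hconj (ξ : ℝ) :
      ∫ x : ℝ, Complex.exp (ξ * x * Complex.I) * (starRingEnd ℂ) (G x) ∂ν = 0 := by
    rw [← map_zero (starRingEnd ℂ), ← h0 (-ξ), ← integral_conj]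
    simp [← Complex.exp_conj]
  have hGc : Integrable (fun x => (starRingEnd ℂ) (G x)) ν :=
    Complex.conjLIE.toContinuousLinearEquiv.toContinuousLinearMap.integrable_comp hG
  have hre := ae_eq_zero_of_integral_exp_eq_zero_real hG.re fun ξ => by
    have h := integral_add (integrable_exp_I_mul hG ξ) (integrable_exp_I_mul hGc ξ)
    simp only [h0, hconj, ← mul_add, Complex.add_conj, add_zero] at h
    simpa [mul_left_comm _ (2 : ℂ), integral_const_mul] using h
  have him := ae_eq_zero_of_integral_exp_eq_zero_real hG.im fun ξ => by
    have h := integral_sub (integrable_exp_I_mul hG ξ) (integrable_exp_I_mul hGc ξ)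
    simp only [h0, hconj, ← mul_sub, Complex.sub_conj, sub_zero] at h
    simpa [← mul_assoc, integral_mul_const, mul_right_comm _ (2 : ℂ)] using h
  filter_upwards [hre, him] with x h1 h2 using Complex.ext h1 h2

/-- All exponential moments `∫ e^{a|x|} |G(x)| dν` of the density `G` are finite. -/
def HasExpMoments (ν : Measure ℝ) (G : ℝ → ℂ) : Prop :=
  ∀ a : ℝ, Integrable (fun x => (Real.exp (a * |x|) : ℂ) * G x) ν

namespace HasExpMoments

protected lemma integrable (hG : HasExpMoments ν G) : Integrable G ν := by
  simpa using hG 0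

protected lemma sub {G' : ℝ → ℂ} (hG : HasExpMoments ν G) (hG' : HasExpMoments ν G') :
    HasExpMoments ν (fun x => G x - G' x) := fun a => by
  simpa only [mul_sub, Pi.sub_def] using (hG a).sub (hG' a)

lemma mul_of_norm_le (hG : HasExpMoments ν G) {E : ℝ → ℂ} {a : ℝ}
    (hE : AEStronglyMeasurable E ν) (hle : ∀ x, ‖E x‖ ≤ Real.exp (a * |x|)) :
    HasExpMoments ν (fun x => E x * G x) := fun c => by
  refine (hG (c + a)).mono ?_ (.of_forall fun x => ?_)
  · exact (Continuous.aestronglyMeasurable (by fun_prop)).mul (hE.mul hG.integrable.1)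
  · rw [add_mul, Real.exp_add, Complex.ofReal_mul, mul_assoc, norm_mul, norm_mul, norm_mul,
      norm_mul, Complex.norm_real (Real.exp (a * |x|)), Real.norm_of_nonneg (Real.exp_pos _).le]
    gcongr
    exact hle x

lemma ofReal_mul (hG : HasExpMoments ν G) : HasExpMoments ν (fun x => (x : ℂ) * G x) :=
  hG.mul_of_norm_le (a := 1) (Continuous.aestronglyMeasurable (by fun_prop)) fun x => by
    rw [Complex.norm_real, Real.norm_eq_abs, one_mul]
    linarith [Real.add_one_le_exp |x|]

lemma pow_mul (hG : HasExpMoments ν G) (n : ℕ) :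
    HasExpMoments ν (fun x => (x : ℂ) ^ n * G x) := by
  induction n with
  | zero => simpa using hG
  | succ n ih => simpa only [pow_succ', mul_assoc] using ih.ofReal_mul

lemma integrable_comp_mul (hG : HasExpMoments ν G) {E : ℂ → ℂ} (hE : Continuous E)
    (hle : ∀ z, ‖E z‖ ≤ Real.exp ‖z‖) (z : ℂ) :
    Integrable (fun x : ℝ => E (z * x) * G x) ν :=
  (hG.mul_of_norm_le (a := ‖z‖) (Continuous.aestronglyMeasurable (by fun_prop)) fun x =>
    (hle _).trans_eq (by rw [norm_mul, Complex.norm_real, Real.norm_eq_abs])).integrable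

lemma hasEntireSeries_integral (hG : HasExpMoments ν G) {a : ℕ → ℂ} {E : ℂ → ℂ}
    (hE : HasEntireSeries a E) (ha : ∀ n, ‖a n‖ ≤ (n.factorial : ℝ)⁻¹) :
    HasEntireSeries (fun n => a n * ∫ x : ℝ, (x : ℂ) ^ n * G x ∂ν)
      (fun z => ∫ x : ℝ, E (z * x) * G x ∂ν) := fun z => by
  have h := hasSum_integral_of_dominated_convergence
    (F := fun (n : ℕ) (x : ℝ) => a n * (z * x) ^ n * G x)
    (bound := fun n x => (‖z‖ * |x|) ^ n / n.factorial * ‖G x‖)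
    (fun n => (Continuous.aestronglyMeasurable (by fun_prop)).mul hG.integrable.1)
    (fun n => .of_forall fun x => ?_)
    (.of_forall fun x => (Real.summable_pow_div_factorial _).mul_right _) ?_
    (.of_forall fun x => (hE (z * x)).mul_right (G x))
  · refine h.congr_fun fun n => ?_
    rw [mul_right_comm, ← integral_const_mul]
    congr 1 with x
    ring
  · rw [norm_mul, norm_mul, norm_pow, norm_mul, Complex.norm_real, Real.norm_eq_abs,
      div_eq_inv_mul]
    gcongr
    exact ha n
  · refine (hG ‖z‖).norm.congr (.of_forall fun x => ?_)
    simp only [tsum_mul_right]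
    rw [norm_mul, Complex.norm_real, Real.norm_of_nonneg (Real.exp_pos _).le,
      Real.exp_eq_exp_ℝ, NormedSpace.exp_eq_tsum_div]

lemma ae_eq_zero_of_moments (hG : HasExpMoments ν G)
    (h0 : ∀ n : ℕ, ∫ x : ℝ, (x : ℂ) ^ n * G x ∂ν = 0) : G =ᵐ[ν] 0 := by
  have hexp : HasEntireSeries (fun n => (n.factorial : ℂ)⁻¹) Complex.exp := fun z => by
    have h := NormedSpace.expSeries_div_hasSum_exp (𝔸 := ℂ) z
    rw [← Complex.exp_eq_exp_ℂ] at h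
    exact h.congr_fun fun n => (div_eq_inv_mul _ _).symm
  refine ae_eq_zero_of_integral_exp_eq_zero hG.integrable fun ξ => ?_
  have h := hG.hasEntireSeries_integral hexp (fun n => by simp) (ξ * Complex.I)
  simp only [h0, mul_zero, zero_mul, mul_right_comm _ Complex.I] at h
  exact h.unique hasSum_zero

end HasExpMoments

end ExpMoments

section Gaussian

lemma integrable_abs_rpow_mul_gaussian {b s : ℝ} (hb : 0 < b) (hs : -1 < s) :
    Integrable fun x : ℝ => |x| ^ s * Real.exp (-b * x ^ 2) := by
  have hpos : IntegrableOn (fun x : ℝ => |x| ^ s * Real.exp (-b * x ^ 2)) (Ioi 0) :=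
    (integrableOn_congr_fun (fun x hx => by rw [abs_of_pos hx]) measurableSet_Ioi).1
      (integrableOn_rpow_mul_exp_neg_mul_sq hb hs)
  have hneg : IntegrableOn (fun x : ℝ => |x| ^ s * Real.exp (-b * x ^ 2)) (Iio 0) := by
    rw [← (Measure.measurePreserving_neg (volume : Measure ℝ)).integrableOn_comp_preimage
      (Homeomorph.neg ℝ).measurableEmbedding]
    simpa [Function.comp_def] using hpos
  rw [← integrableOn_univ, ← Iic_union_Ioi (a := (0 : ℝ)), integrableOn_union,
    integrableOn_Iic_iff_integrableOn_Iio]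
  exact ⟨hneg, hpos⟩

lemma exp_abs_mul_gaussian_le (a : ℝ) {b : ℝ} (hb : 0 < b) (x : ℝ) :
    Real.exp (a * |x|) * Real.exp (-b * x ^ 2) ≤
      Real.exp (a ^ 2 / (2 * b)) * Real.exp (-(b / 2) * x ^ 2) := by
  rw [← Real.exp_add, ← Real.exp_add, Real.exp_le_exp, ← sub_nonneg]
  have h : a ^ 2 / (2 * b) + -(b / 2) * x ^ 2 - (a * |x| + -b * x ^ 2) =
      (a - b * |x|) ^ 2 / (2 * b) := by
    rw [← sq_abs x]
    field_simp
    ring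
  rw [h]
  positivity

lemma integrable_exp_abs_mul_gaussian (hμ : 0 < μ) (a : ℝ) {b : ℝ} (hb : 0 < b) :
    Integrable (fun x : ℝ => Real.exp (a * |x|) * Real.exp (-b * x ^ 2)) (weightMeasure μ) := by
  have hdom : Integrable (fun x : ℝ => Real.exp (-(b / 2) * x ^ 2)) (weightMeasure μ) :=
    (integrable_weightMeasure_iff μ _).2
      (integrable_abs_rpow_mul_gaussian (half_pos hb) (by linarith))
  refine (hdom.const_mul (Real.exp (a ^ 2 / (2 * b)))).mono'
    (Continuous.aestronglyMeasurable (by fun_prop)) (.of_forall fun x => ?_)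
  rw [Real.norm_of_nonneg (by positivity)]
  exact exp_abs_mul_gaussian_le a hb x

lemma memLp_exp_abs_mul_gaussian (hμ : 0 < μ) (a : ℝ) {b : ℝ} (hb : 0 < b) (q : ENNReal) :
    MemLp (fun x : ℝ => Real.exp (a * |x|) * Real.exp (-b * x ^ 2)) q (weightMeasure μ) := by
  have hm : AEStronglyMeasurable (fun x : ℝ => Real.exp (a * |x|) * Real.exp (-b * x ^ 2))
      (weightMeasure μ) := Continuous.aestronglyMeasurable (by fun_prop)
  rcases eq_or_ne q 0 with rfl | hq0
  · exact memLp_zero_iff_aestronglyMeasurable.2 hm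
  rcases eq_or_ne q ⊤ with rfl | hqt
  · refine memLp_top_of_bound hm (Real.exp (a ^ 2 / (2 * b))) (.of_forall fun x => ?_)
    rw [Real.norm_of_nonneg (by positivity)]
    refine (exp_abs_mul_gaussian_le a hb x).trans (mul_le_of_le_one_right (by positivity) ?_)
    exact Real.exp_le_one_iff.2 (mul_nonpos_of_nonpos_of_nonneg (by linarith) (sq_nonneg x))
  · rw [← integrable_norm_rpow_iff hm hq0 hqt]
    have hb' : 0 < b * q.toReal := mul_pos hb (ENNReal.toReal_pos hq0 hqt)
    refine (integrable_exp_abs_mul_gaussian hμ (a * q.toReal) hb').congr (.of_forall fun x => ?_)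
    simp only [← Real.exp_add, Real.norm_of_nonneg (Real.exp_pos _).le, ← Real.exp_mul]
    ring_nf

/-- The entire function `p(z) exp(-b z²)`. Widths `b` other than that of `gaussPoly` occur for
products of elements of `𝔖` (`b = 2`) and for Gaussians of the form `exp(-x²/4)`. -/
def gaussPolyWith (b : ℝ) (p : Polynomial ℂ) (z : ℂ) : ℂ := p.eval z * Complex.exp (-(b * z ^ 2))

variable {b : ℝ}

lemma gaussPoly_eq (p : Polynomial ℂ) : gaussPoly p = gaussPolyWith 1 p := by
  ext z; simp [gaussPoly, gaussPolyWith]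

lemma differentiable_gaussPolyWith (b : ℝ) (p : Polynomial ℂ) :
    Differentiable ℂ (gaussPolyWith b p) := by
  unfold gaussPolyWith
  exact p.differentiable.mul (by fun_prop)

@[fun_prop]
lemma continuous_gaussPolyWith (b : ℝ) (p : Polynomial ℂ) : Continuous (gaussPolyWith b p) :=
  (differentiable_gaussPolyWith b p).continuous

lemma gaussPolyWith_add (b : ℝ) (p q : Polynomial ℂ) (z : ℂ) :
    gaussPolyWith b (p + q) z = gaussPolyWith b p z + gaussPolyWith b q z := by
  simp [gaussPolyWith, add_mul]

lemma gaussPolyWith_smul (b : ℝ) (c : ℂ) (p : Polynomial ℂ) (z : ℂ) :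
    gaussPolyWith b (c • p) z = c * gaussPolyWith b p z := by
  simp [gaussPolyWith, mul_assoc]

lemma gaussPolyWith_mul_mul (a b : ℝ) (p q : Polynomial ℂ) (z : ℂ) :
    gaussPolyWith a p z * gaussPolyWith b q z = gaussPolyWith (a + b) (p * q) z := by
  simp only [gaussPolyWith, Polynomial.eval_mul]
  rw [mul_mul_mul_comm, ← Complex.exp_add]
  push_cast
  ring_nf

lemma exists_norm_eval_le (p : Polynomial ℂ) :
    ∃ C, 0 ≤ C ∧ ∀ x : ℝ, ‖p.eval (x : ℂ)‖ ≤ C * Real.exp |x| := by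
  induction p using Polynomial.induction_on' with
  | add p q hp hq =>
    obtain ⟨C, hC, h1⟩ := hp
    obtain ⟨D, hD, h2⟩ := hq
    refine ⟨C + D, by positivity, fun x => ?_⟩
    rw [Polynomial.eval_add, add_mul]
    exact (norm_add_le _ _).trans (add_le_add (h1 x) (h2 x))
  | monomial n a =>
    refine ⟨‖a‖ * n.factorial, by positivity, fun x => ?_⟩
    have := Real.pow_div_factorial_le_exp |x| (abs_nonneg x) n
    rw [div_le_iff₀' (by positivity)] at this
    rw [Polynomial.eval_monomial, norm_mul, norm_pow, Complex.norm_real, Real.norm_eq_abs,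
      mul_assoc]
    gcongr

lemma norm_exp_neg_mul_sq (b x : ℝ) :
    ‖Complex.exp (-((b : ℂ) * (x : ℂ) ^ 2))‖ = Real.exp (-b * x ^ 2) := by
  rw [neg_mul, ← Complex.norm_exp_ofReal]
  push_cast
  rfl

lemma exists_norm_gaussPolyWith_le (b : ℝ) (p : Polynomial ℂ) :
    ∃ C, 0 ≤ C ∧ ∀ x : ℝ, ‖gaussPolyWith b p x‖ ≤ C * (Real.exp |x| * Real.exp (-b * x ^ 2)) := by
  obtain ⟨C, hC, h⟩ := exists_norm_eval_le p
  refine ⟨C, hC, fun x => ?_⟩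
  rw [gaussPolyWith, norm_mul, norm_exp_neg_mul_sq, ← mul_assoc]
  gcongr
  exact h x

lemma memLp_exp_abs_mul_gaussPolyWith (hμ : 0 < μ) (hb : 0 < b) (a : ℝ) (p : Polynomial ℂ)
    (q : ENNReal) :
    MemLp (fun x : ℝ => (Real.exp (a * |x|) : ℂ) * gaussPolyWith b p x) q (weightMeasure μ) := by
  obtain ⟨C, -, h⟩ := exists_norm_gaussPolyWith_le b p
  refine (memLp_exp_abs_mul_gaussian hμ (a + 1) hb q).of_le_mul (c := C)
    (Continuous.aestronglyMeasurable (by fun_prop)) (.of_forall fun x => ?_)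
  rw [norm_mul, Complex.norm_real, Real.norm_of_nonneg (Real.exp_pos _).le,
    Real.norm_of_nonneg (by positivity)]
  refine (mul_le_mul_of_nonneg_left (h x) (Real.exp_pos _).le).trans_eq ?_
  rw [add_mul, Real.exp_add, one_mul]
  ring

lemma memLp_gaussPolyWith (hμ : 0 < μ) (hb : 0 < b) (p : Polynomial ℂ) (q : ENNReal) :
    MemLp (fun x : ℝ => gaussPolyWith b p x) q (weightMeasure μ) := by
  simpa using memLp_exp_abs_mul_gaussPolyWith hμ hb 0 p q

lemma integrable_gaussPolyWith (hμ : 0 < μ) (hb : 0 < b) (p : Polynomial ℂ) :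
    Integrable (fun x : ℝ => gaussPolyWith b p x) (weightMeasure μ) :=
  memLp_one_iff_integrable.1 (memLp_gaussPolyWith hμ hb p 1)

lemma hasExpMoments_gaussPolyWith (hμ : 0 < μ) (hb : 0 < b) (p : Polynomial ℂ) :
    HasExpMoments (weightMeasure μ) (fun x : ℝ => gaussPolyWith b p x) := fun a =>
  memLp_one_iff_integrable.1 (memLp_exp_abs_mul_gaussPolyWith hμ hb a p 1)

lemma hasExpMoments_mul_gaussPolyWith (hμ : 0 < μ) (hb : 0 < b) {q : ENNReal} (hq : 1 ≤ q)
    {f : ℝ → ℂ} (hf : MemLp f q (weightMeasure μ)) (p : Polynomial ℂ) :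
    HasExpMoments (weightMeasure μ) (fun x : ℝ => f x * gaussPolyWith b p x) := fun a => by
  have := ENNReal.HolderConjugate.conjExponent hq
  simpa only [Pi.mul_def, mul_left_comm] using
    hf.integrable_mul (memLp_exp_abs_mul_gaussPolyWith hμ hb a p q.conjExponent)

lemma ae_eq_of_forall_integral_mul_gaussPolyWith_eq {ν : Measure ℝ} {f g : ℝ → ℂ}
    (hf : HasExpMoments ν (fun x => f x * gaussPolyWith b 1 x))
    (hg : HasExpMoments ν (fun x => g x * gaussPolyWith b 1 x))
    (h : ∀ p : Polynomial ℂ,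
      ∫ x, f x * gaussPolyWith b p x ∂ν = ∫ x, g x * gaussPolyWith b p x ∂ν) : f =ᵐ[ν] g := by
  have hpow (u : ℝ → ℂ) (n : ℕ) (x : ℝ) :
      (x : ℂ) ^ n * (u x * gaussPolyWith b 1 x) = u x * gaussPolyWith b (.X ^ n) x := by
    simp only [gaussPolyWith, Polynomial.eval_one, Polynomial.eval_pow, Polynomial.eval_X]
    ring
  have h0 := (hf.sub hg).ae_eq_zero_of_moments fun n => by
    simp only [mul_sub]
    rw [integral_sub (hf.pow_mul n).integrable (hg.pow_mul n).integrable]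
    simp only [hpow, h, sub_self]
  filter_upwards [h0] with x hx
  rw [Pi.zero_apply, ← sub_mul] at hx
  refine sub_eq_zero.1 ((mul_eq_zero.1 hx).resolve_right ?_)
  simp [gaussPolyWith, Complex.exp_ne_zero]

end Gaussian

section Density

variable {b : ℝ}

/-- The functions `p(x) exp(-b x²)` as elements of `L²_μ(ℝ)`, linearly in `p`; for `b = 1` their
span is `𝔖`. -/
def gaussPolyLp (hμ : 0 < μ) (hb : 0 < b) : Polynomial ℂ →ₗ[ℂ] Lp ℂ 2 (weightMeasure μ) where
  toFun p := (memLp_gaussPolyWith hμ hb p 2).toLp _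
  map_add' p q := by
    rw [← MemLp.toLp_add]
    exact MemLp.toLp_congr _ _ (.of_forall fun x => gaussPolyWith_add b p q x)
  map_smul' c p := by
    rw [RingHom.id_apply, ← MemLp.toLp_const_smul]
    exact MemLp.toLp_congr _ _ (.of_forall fun x => gaussPolyWith_smul b c p x)

lemma gaussPolyLp_ae_eq (hμ : 0 < μ) (hb : 0 < b) (p : Polynomial ℂ) :
    gaussPolyLp hμ hb p =ᵐ[weightMeasure μ] fun x : ℝ => gaussPolyWith b p x :=
  (memLp_gaussPolyWith hμ hb p 2).coeFn_toLp

lemma norm_gaussPolyLp (hμ : 0 < μ) (hb : 0 < b) (p : Polynomial ℂ) :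
    ‖gaussPolyLp hμ hb p‖ =
      (eLpNorm (fun x : ℝ => gaussPolyWith b p x) 2 (weightMeasure μ)).toReal :=
  Lp.norm_toLp _ (memLp_gaussPolyWith hμ hb p 2)

lemma edist_toLp_gaussPolyLp (hμ : 0 < μ) (hb : 0 < b) {f : ℝ → ℂ}
    (hf : MemLp f 2 (weightMeasure μ)) (p : Polynomial ℂ) :
    edist (hf.toLp f) (gaussPolyLp hμ hb p) =
      eLpNorm (fun x : ℝ => f x - gaussPolyWith b p x) 2 (weightMeasure μ) :=
  Lp.edist_toLp_toLp _ _ hf (memLp_gaussPolyWith hμ hb p 2)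

lemma conj_gaussPolyWith (b : ℝ) (p : Polynomial ℂ) (x : ℝ) :
    (starRingEnd ℂ) (gaussPolyWith b p x) = gaussPolyWith b (p.map (starRingEnd ℂ)) x := by
  rw [gaussPolyWith, gaussPolyWith, map_mul, ← Complex.exp_conj, ← Polynomial.eval_map_apply]
  simp

lemma denseRange_gaussPolyLp (hμ : 0 < μ) (hb : 0 < b) : DenseRange (gaussPolyLp hμ hb) := by
  rw [DenseRange, ← LinearMap.coe_range, Submodule.dense_iff_topologicalClosure_eq_top,
    Submodule.topologicalClosure_eq_top_iff, Submodule.eq_bot_iff]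
  intro u hu
  rw [Lp.eq_zero_iff_ae_eq_zero]
  refine ae_eq_of_forall_integral_mul_gaussPolyWith_eq
    (hasExpMoments_mul_gaussPolyWith hμ hb one_le_two (Lp.memLp u) 1)
    (hasExpMoments_mul_gaussPolyWith hμ hb one_le_two MemLp.zero 1) fun p => ?_
  have horth := (Submodule.mem_orthogonal _ _).1 hu
    (gaussPolyLp hμ hb (p.map (starRingEnd ℂ))) ⟨_, rfl⟩
  rw [L2.inner_def] at horth
  simp only [Pi.zero_apply, zero_mul, integral_zero]
  rw [← horth]
  refine integral_congr_ae ?_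
  filter_upwards [gaussPolyLp_ae_eq hμ hb (p.map (starRingEnd ℂ))] with x hx
  rw [hx, RCLike.inner_apply, conj_gaussPolyWith, Polynomial.map_map]
  simp

end Density

/-! ### The operator `𝔇_μ` on Gaussian functions -/

section Moments

variable {b : ℝ}

/-- The moments `∫ xⁿ exp(-b x²) |x|^{2μ} dx` of a Gaussian. -/
def gaussMoment (μ b : ℝ) (n : ℕ) : ℝ := ∫ x : ℝ, x ^ n * Real.exp (-b * x ^ 2) ∂(weightMeasure μ)

lemma gaussMoment_odd (μ b : ℝ) {n : ℕ} (hn : Odd n) : gaussMoment μ b n = 0 := by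
  rw [gaussMoment, integral_weightMeasure, ← self_eq_neg, ← integral_neg, ← integral_neg_eq_self]
  simp [hn.neg_pow]

lemma gaussMoment_even (hμ : 0 < μ) (hb : 0 < b) (k : ℕ) :
    gaussMoment μ b (2 * k) = b ^ (-(k + μ + 1 / 2)) * Real.Gamma (k + μ + 1 / 2) := by
  have hhalf := integral_comp_abs
    (f := fun r : ℝ => r ^ (2 * μ) * (r ^ (2 * k) * Real.exp (-b * r ^ 2)))
  simp only [sq_abs, (even_two_mul k).pow_abs] at hhalf
  have hrpow : ∫ x in Ioi (0 : ℝ), x ^ (2 * μ) * (x ^ (2 * k) * Real.exp (-b * x ^ 2)) =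
      ∫ x in Ioi (0 : ℝ), x ^ (2 * (μ + k)) * Real.exp (-b * x ^ (2 : ℝ)) :=
    setIntegral_congr_fun measurableSet_Ioi fun x hx => by
      have hpow : x ^ (2 * (k : ℝ)) = x ^ (2 * k) := mod_cast Real.rpow_natCast x (2 * k)
      rw [mul_add, Real.rpow_add hx, Real.rpow_two, hpow, mul_assoc]
  rw [gaussMoment, integral_weightMeasure]
  simp only [smul_eq_mul]
  have hexp : (2 * (μ + k) + 1) / 2 = k + μ + 1 / 2 := by ring
  rw [hhalf, hrpow, integral_rpow_mul_exp_neg_mul_rpow two_pos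
    (by linarith [k.cast_nonneg (α := ℝ)]) hb, neg_div, hexp]
  ring

lemma gaussMoment_add_two (hμ : 0 < μ) (hb : 0 < b) (m : ℕ) :
    2 * b * gaussMoment μ b (m + 2) = dunklCoeff μ (m + 1) * gaussMoment μ b m := by
  rcases m.even_or_odd' with ⟨k, rfl | rfl⟩
  · have hk : 0 < (k : ℝ) + μ + 1 / 2 := by positivity
    have hcast : ((k + 1 : ℕ) : ℝ) + μ + 1 / 2 = (k + μ + 1 / 2) + 1 := by push_cast; ring
    rw [show 2 * k + 2 = 2 * (k + 1) by ring, gaussMoment_even hμ hb, gaussMoment_even hμ hb,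
      dunklCoeff_odd μ (odd_two_mul_add_one k), hcast, Real.Gamma_add_one hk.ne', neg_add,
      Real.rpow_add hb, Real.rpow_neg_one]
    push_cast
    field_simp
    ring
  · rw [gaussMoment_odd μ b (odd_two_mul_add_one k), gaussMoment_odd μ b (by grind), mul_zero,
      mul_zero]

lemma dunklCoeff_mul_gaussMoment_add (hμ : 0 < μ) (hb : 0 < b) (m n : ℕ) :
    dunklCoeff μ m * gaussMoment μ b (m - 1 + n) + dunklCoeff μ n * gaussMoment μ b (m + (n - 1)) =
      2 * b * gaussMoment μ b (m + n + 1) := by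
  rcases m with _ | m <;> rcases n with _ | n
  · simp [dunklCoeff_zero, gaussMoment_odd]
  · simpa [dunklCoeff_zero] using (gaussMoment_add_two hμ hb n).symm
  · simpa [dunklCoeff_zero] using (gaussMoment_add_two hμ hb m).symm
  · rw [Nat.add_sub_cancel, Nat.add_sub_cancel, show m + (n + 1) = m + n + 1 by ring,
      show m + 1 + n = m + n + 1 by ring, show m + 1 + (n + 1) + 1 = m + n + 1 + 2 by ring,
      gaussMoment_add_two hμ hb, ← add_mul]
    rcases Nat.even_or_odd (m + n) with h | h
    · rw [gaussMoment_odd μ b h.add_one, mul_zero, mul_zero]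
    · rw [dunklCoeff_add μ (by grind), show m + 1 + (n + 1) = m + n + 1 + 1 by ring]

end Moments

section DunklPolynomial

open Polynomial

/-- The operator `𝔇_μ` on polynomials. -/
def dunklPoly (μ : ℝ) : ℂ[X] →ₗ[ℂ] ℂ[X] :=
  lsum fun n => (dunklCoeff μ n : ℂ) • monomial (n - 1)

lemma dunklPoly_monomial (μ : ℝ) (n : ℕ) (c : ℂ) :
    dunklPoly μ (monomial n c) = monomial (n - 1) (dunklCoeff μ n * c) := by
  simp [dunklPoly, lsum_apply, sum_monomial_index, smul_monomial]

lemma coeff_dunklPoly (μ : ℝ) (p : ℂ[X]) (n : ℕ) :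
    (dunklPoly μ p).coeff n = dunklCoeff μ (n + 1) * p.coeff (n + 1) := by
  induction p using Polynomial.induction_on' with
  | add p q hp hq => rw [map_add, coeff_add, coeff_add, hp, hq, mul_add]
  | monomial m c =>
    rcases m with _ | m
    · rw [dunklPoly_monomial, dunklCoeff_zero, coeff_monomial_of_ne c n.succ_ne_zero]
      simp
    · rw [dunklPoly_monomial, coeff_monomial, coeff_monomial]
      by_cases h : m = n <;> simp [h]

lemma hasEntireSeries_eval (p : ℂ[X]) : HasEntireSeries p.coeff (fun z => p.eval z) := fun z => by
  simp only [eval_eq_sum_range]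
  exact hasSum_sum_of_ne_finset_zero fun n hn => by
    rw [coeff_eq_zero_of_natDegree_lt (by simpa using hn), zero_mul]

lemma dunklDeriv_eval (μ : ℝ) (p : ℂ[X]) :
    dunklDeriv μ (fun z => p.eval z) = fun z => (dunklPoly μ p).eval z := by
  refine ((hasEntireSeries_eval p).dunklDeriv μ).unique ?_
  simpa only [← coeff_dunklPoly] using hasEntireSeries_eval (dunklPoly μ p)

lemma dunklDeriv_mul_of_even (μ : ℝ) {f g : ℂ → ℂ} (hf : Differentiable ℂ f)
    (hg : Differentiable ℂ g) (heven : ∀ z, g (-z) = g z) (z : ℂ) :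
    dunklDeriv μ (fun z => f z * g z) z = dunklDeriv μ f z * g z + f z * deriv g z := by
  have hderiv : deriv (fun z => f z * g z) z = deriv f z * g z + f z * deriv g z :=
    deriv_fun_mul (hf z) (hg z)
  rcases eq_or_ne z 0 with rfl | hz
  · have hg0 : deriv g 0 = 0 := by
      have h := deriv_comp_neg g 0
      simp only [heven, neg_zero] at h
      exact self_eq_neg.1 h
    simp only [dunklDeriv, if_true, hderiv, hg0]
    ring
  · simp only [dunklDeriv, if_neg hz, hderiv, heven]
    ring

/-- The operator `q ↦ exp(bz²) 𝔇_μ (q exp(-bz²))` on polynomials. -/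
def dunklGauss (μ b : ℝ) : ℂ[X] →ₗ[ℂ] ℂ[X] :=
  dunklPoly μ - (2 * b : ℂ) • LinearMap.mulLeft ℂ X

lemma dunklGauss_apply (μ b : ℝ) (q : ℂ[X]) :
    dunklGauss μ b q = dunklPoly μ q - (2 * b : ℂ) • (X * q) := rfl

lemma dunklDeriv_gaussPolyWith (μ b : ℝ) (q : ℂ[X]) :
    dunklDeriv μ (gaussPolyWith b q) = gaussPolyWith b (dunklGauss μ b q) := by
  ext z
  have hg : HasDerivAt (fun z : ℂ => Complex.exp (-(b * z ^ 2)))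
      (Complex.exp (-(b * z ^ 2)) * (-(b * (2 * z)))) z := by
    simpa using (((hasDerivAt_pow 2 z).const_mul (b : ℂ)).fun_neg).cexp
  refine (dunklDeriv_mul_of_even μ q.differentiable (by fun_prop) (fun z => by simp) z).trans ?_
  rw [hg.deriv, dunklDeriv_eval, gaussPolyWith, dunklGauss_apply]
  simp only [eval_sub, eval_smul, eval_mul, eval_X, smul_eq_mul]
  ring

variable {b : ℝ}

/-- Integration of Gaussian functions as a linear functional. -/
def gaussFunctional (hμ : 0 < μ) (hb : 0 < b) : ℂ[X] →ₗ[ℂ] ℂ where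
  toFun p := ∫ x : ℝ, gaussPolyWith b p x ∂(weightMeasure μ)
  map_add' p q := by
    simp only [gaussPolyWith_add]
    exact integral_add (integrable_gaussPolyWith hμ hb p) (integrable_gaussPolyWith hμ hb q)
  map_smul' c p := by
    simp only [gaussPolyWith_smul, RingHom.id_apply, smul_eq_mul]
    exact integral_const_mul _ _

lemma gaussFunctional_monomial (hμ : 0 < μ) (hb : 0 < b) (n : ℕ) (c : ℂ) :
    gaussFunctional hμ hb (monomial n c) = c * gaussMoment μ b n := by
  rw [gaussMoment, ← integral_complex_ofReal, ← integral_const_mul]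
  refine integral_congr_ae (.of_forall fun x => ?_)
  simp [gaussPolyWith, mul_assoc]

lemma gaussFunctional_dunklGauss (hμ : 0 < μ) (hb : 0 < b) (q r : ℂ[X]) :
    gaussFunctional hμ (add_pos hb hb) (dunklGauss μ b q * r + q * dunklGauss μ b r) = 0 := by
  induction q using Polynomial.induction_on' with
  | add p q hp hq =>
    rw [map_add] at hp hq ⊢
    rw [map_add, add_mul, add_mul, map_add, map_add]
    linear_combination hp + hq
  | monomial m c =>
    induction r using Polynomial.induction_on' with
    | add p q hp hq =>
      rw [map_add] at hp hq ⊢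
      rw [map_add, mul_add, mul_add, map_add, map_add]
      linear_combination hp + hq
    | monomial n d =>
      have hrec : (dunklCoeff μ m * gaussMoment μ (b + b) (m - 1 + n) +
          dunklCoeff μ n * gaussMoment μ (b + b) (m + (n - 1)) : ℂ) =
          2 * (b + b) * gaussMoment μ (b + b) (m + n + 1) :=
        mod_cast dunklCoeff_mul_gaussMoment_add hμ (add_pos hb hb) m n
      simp only [dunklGauss_apply, dunklPoly_monomial, X_mul_monomial, smul_monomial, smul_eq_mul,
        sub_mul, mul_sub, monomial_mul_monomial, map_add, map_sub, gaussFunctional_monomial]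
      rw [show m + 1 + n = m + n + 1 by ring, ← add_assoc m n 1]
      linear_combination c * d * hrec

lemma integral_dunklGauss_mul (hμ : 0 < μ) (hb : 0 < b) (q r : ℂ[X]) :
    ∫ x : ℝ, gaussPolyWith b (dunklGauss μ b q) x * gaussPolyWith b r x ∂(weightMeasure μ) =
      -∫ x : ℝ, gaussPolyWith b q x * gaussPolyWith b (dunklGauss μ b r) x ∂(weightMeasure μ) := by
  have h := gaussFunctional_dunklGauss hμ hb q r
  rw [map_add] at h
  simp only [gaussPolyWith_mul_mul]
  exact eq_neg_of_add_eq_zero_left h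

end DunklPolynomial

/-! ### The generalized Fourier integral -/

section FourierIntegral

variable {f h : ℝ → ℂ}

/-- The generalized Fourier integral of `f` with a complex argument. -/
def fourierC (μ : ℝ) (f : ℝ → ℂ) (z : ℂ) : ℂ :=
  (((2 : ℝ) ^ (μ + 1 / 2) * Real.Gamma (μ + 1 / 2) : ℝ) : ℂ)⁻¹ *
    ∫ t, expMu μ (-(Complex.I * z * t)) * f t ∂(weightMeasure μ)

lemma norm_expMu_neg_I_mul_le (hμ : 0 < μ) (x t : ℝ) :
    ‖expMu μ (-(Complex.I * x * t))‖ ≤ 1 := by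
  have h := norm_expMu_I_mul_le hμ (-(x * t))
  push_cast at h
  rwa [mul_neg, ← mul_assoc] at h

lemma continuous_expMu_neg_I_mul (hμ : 0 < μ) :
    Continuous fun q : ℝ × ℝ => expMu μ (-(Complex.I * q.1 * q.2)) :=
  (continuous_expMu hμ).comp (by fun_prop)

lemma continuous_fourierC_ofReal (hμ : 0 < μ) (hf : Integrable f (weightMeasure μ)) :
    Continuous fun x : ℝ => fourierC μ f x := by
  refine (continuous_of_dominated (bound := fun t => ‖f t‖) (fun x => ?_) (fun x => ?_) hf.norm
    (.of_forall fun t => ?_)).const_mul _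
  · exact ((continuous_expMu_neg_I_mul hμ).comp (by fun_prop :
      Continuous fun t : ℝ => (x, t))).aestronglyMeasurable.mul hf.1
  · refine .of_forall fun t => ?_
    rw [norm_mul]
    exact mul_le_of_le_one_left (norm_nonneg _) (norm_expMu_neg_I_mul_le hμ x t)
  · exact ((continuous_expMu_neg_I_mul hμ).comp (by fun_prop :
      Continuous fun x : ℝ => (x, t))).mul_const _

lemma integral_fourierC_mul (hμ : 0 < μ) (hf : Integrable f (weightMeasure μ))
    (hh : Integrable h (weightMeasure μ)) :
    ∫ x : ℝ, fourierC μ f x * h x ∂(weightMeasure μ) =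
      ∫ t : ℝ, f t * fourierC μ h t ∂(weightMeasure μ) := by
  have hint : Integrable (fun q : ℝ × ℝ => expMu μ (-(Complex.I * q.1 * q.2)) * (h q.1 * f q.2))
      ((weightMeasure μ).prod (weightMeasure μ)) :=
    (hh.mul_prod hf).bdd_mul (c := 1) (continuous_expMu_neg_I_mul hμ).aestronglyMeasurable
      (.of_forall fun q => norm_expMu_neg_I_mul_le hμ q.1 q.2)
  have hswap := integral_integral_swap
    (f := fun x t : ℝ => expMu μ (-(Complex.I * x * t)) * (h x * f t)) hint
  simp only [fourierC, mul_left_comm (f _), mul_assoc _ _ (h _)]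
  rw [integral_const_mul, integral_const_mul]
  congr 1
  refine Eq.trans ?_ (hswap.trans ?_) <;> refine integral_congr_ae (.of_forall fun s => ?_)
  · simp only [← integral_mul_const, mul_assoc, mul_comm (h s)]
  · simp only [← integral_const_mul, mul_left_comm (f s), mul_comm (h _), mul_right_comm _ (s : ℂ)]

lemma fourierC_const_mul (f : ℝ → ℂ) (c z : ℂ) :
    fourierC μ (fun t => c * f t) z = c * fourierC μ f z := by
  simp only [fourierC, mul_left_comm _ c, integral_const_mul]

lemma integrable_expMu_mul (hμ : 0 < μ) (hf : HasExpMoments (weightMeasure μ) f) (z : ℂ) :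
    Integrable (fun t : ℝ => expMu μ (-(Complex.I * z * t)) * f t) (weightMeasure μ) := by
  simpa only [neg_mul] using
    hf.integrable_comp_mul (continuous_expMu hμ) (norm_expMu_le hμ) (-(Complex.I * z))

lemma fourierC_add (hμ : 0 < μ) (hf : HasExpMoments (weightMeasure μ) f)
    (hh : HasExpMoments (weightMeasure μ) h) (z : ℂ) :
    fourierC μ (fun t => f t + h t) z = fourierC μ f z + fourierC μ h z := by
  simp only [fourierC, mul_add]
  rw [integral_add (integrable_expMu_mul hμ hf z) (integrable_expMu_mul hμ hh z), mul_add]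

lemma hasEntireSeries_fourierC (hμ : 0 < μ) (hf : HasExpMoments (weightMeasure μ) f) :
    HasEntireSeries (fun k => (((2 : ℝ) ^ (μ + 1 / 2) * Real.Gamma (μ + 1 / 2) : ℝ) : ℂ)⁻¹ *
      ((-Complex.I) ^ k / gammaMu μ k * ∫ t : ℝ, (t : ℂ) ^ k * f t ∂(weightMeasure μ)))
      (fourierC μ f) := fun z => by
  have h := hf.hasEntireSeries_integral (hasEntireSeries_expMu hμ (-Complex.I)) (fun k => ?_) z
  · simpa only [fourierC, neg_mul, mul_assoc] using
      h.mul_left (((2 : ℝ) ^ (μ + 1 / 2) * Real.Gamma (μ + 1 / 2) : ℝ) : ℂ)⁻¹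
  · rw [norm_div, norm_pow, norm_neg, Complex.norm_I, one_pow, Complex.norm_real,
      Real.norm_of_nonneg (gammaMu_pos hμ k).le, one_div]
    exact inv_anti₀ (by positivity) (factorial_le_gammaMu hμ k)

lemma fourierC_ofReal_mul (hμ : 0 < μ) (hf : HasExpMoments (weightMeasure μ) f) (z : ℂ) :
    fourierC μ (fun t => (t : ℂ) * f t) z = Complex.I * dunklDeriv μ (fourierC μ f) z := by
  refine (hasEntireSeries_fourierC hμ hf.ofReal_mul z).unique <|
    (((hasEntireSeries_fourierC hμ hf).dunklDeriv μ z).mul_left Complex.I).congr_fun fun k => ?_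
  have hγ := gammaMu_ne_zero hμ k
  have hc : (dunklCoeff μ (k + 1) : ℂ) ≠ 0 := mod_cast (dunklCoeff_succ_pos hμ k).ne'
  simp only [← mul_assoc, ← pow_succ]
  rw [gammaMu_succ hμ, pow_succ (-Complex.I)]
  push_cast
  field_simp
  rw [Complex.I_sq]
  ring

end FourierIntegral

section FourierGaussian

variable {b : ℝ}

lemma gaussMoment_two_mul_div_gammaMu (hμ : 0 < μ) (hb : 0 < b) (m : ℕ) :
    gaussMoment μ b (2 * m) / gammaMu μ (2 * m) =
      gaussMoment μ b 0 * ((1 / (4 * b)) ^ m / m.factorial) := by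
  induction m with
  | zero => simp [gammaMu_zero hμ]
  | succ m ih =>
    have hγ := (gammaMu_pos hμ (2 * m)).ne'
    have hc := (dunklCoeff_succ_pos hμ (2 * m)).ne'
    have hM : gaussMoment μ b (2 * m + 2) =
        dunklCoeff μ (2 * m + 1) * gaussMoment μ b (2 * m) / (2 * b) := by
      rw [← gaussMoment_add_two hμ hb]
      field_simp
    have heven : dunklCoeff μ (2 * m + 1 + 1) = 2 * (m + 1) := by
      rw [dunklCoeff_even μ (by grind)]
      push_cast
      ring
    rw [mul_add, mul_one, hM, gammaMu_succ hμ, gammaMu_succ hμ, heven]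
    calc _ = gaussMoment μ b (2 * m) / gammaMu μ (2 * m) * (1 / (4 * b) / (m + 1)) := by
          field_simp
          ring
      _ = _ := by
          rw [ih, pow_succ, Nat.factorial_succ]
          push_cast
          field_simp

lemma hasSum_gaussPolyWith_one (b : ℝ) (z : ℂ) :
    HasSum (fun m : ℕ => (-b : ℂ) ^ m / m.factorial * z ^ (2 * m)) (gaussPolyWith b 1 z) := by
  have h := NormedSpace.expSeries_div_hasSum_exp (𝔸 := ℂ) (-(b * z ^ 2))
  rw [← Complex.exp_eq_exp_ℂ] at h
  rw [gaussPolyWith, Polynomial.eval_one, one_mul]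
  exact h.congr_fun fun m => by rw [← neg_mul, mul_pow, ← pow_mul, div_mul_eq_mul_div]

lemma integral_pow_mul_gaussian (μ b : ℝ) (n : ℕ) :
    ∫ x : ℝ, (x : ℂ) ^ n * gaussPolyWith b 1 x ∂(weightMeasure μ) = gaussMoment μ b n := by
  rw [gaussMoment, ← integral_complex_ofReal]
  refine integral_congr_ae (.of_forall fun x => ?_)
  simp [gaussPolyWith]

lemma fourierC_gaussian (hμ : 0 < μ) (hb : 0 < b) (z : ℂ) :
    fourierC μ (fun t => gaussPolyWith b 1 t) z =
      (((2 * b) ^ (-(μ + 1 / 2)) : ℝ) : ℂ) * gaussPolyWith (1 / (4 * b)) 1 z := by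
  have hconst : ((2 : ℝ) ^ (μ + 1 / 2) * Real.Gamma (μ + 1 / 2))⁻¹ * gaussMoment μ b 0 =
      (2 * b) ^ (-(μ + 1 / 2)) := by
    have : Real.Gamma (μ + 1 / 2) ≠ 0 := (Real.Gamma_pos_of_pos (by linarith)).ne'
    have hM := gaussMoment_even hμ hb 0
    rw [mul_zero, Nat.cast_zero, zero_add] at hM
    rw [hM, Real.mul_rpow zero_le_two hb.le, Real.rpow_neg zero_le_two]
    field_simp
  have hF := hasEntireSeries_fourierC hμ (hasExpMoments_gaussPolyWith hμ hb 1) z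
  simp only [integral_pow_mul_gaussian] at hF
  refine hF.unique ?_
  refine (Function.Injective.hasSum_iff (g := fun m : ℕ => 2 * m)
    (fun a b h => by simpa using h) (fun k hk => ?_)).1
    (((hasSum_gaussPolyWith_one (1 / (4 * b)) z).mul_left _).congr_fun fun m => ?_)
  · have hodd : Odd k := by
      rw [← Nat.not_even_iff_odd]
      exact fun hk' => hk (hk'.exists_two_nsmul.imp fun m hm => by simp [hm])
    simp [gaussMoment_odd μ b hodd]
  · have hratio := gaussMoment_two_mul_div_gammaMu hμ hb m
    have hI : (-Complex.I) ^ (2 * m) = (-1) ^ m := by rw [pow_mul, neg_sq, Complex.I_sq]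
    rw [← hconst, Function.comp_apply, hI, neg_pow ((1 / (4 * b) : ℝ) : ℂ)]
    have hratio' : (gaussMoment μ b (2 * m) : ℂ) / gammaMu μ (2 * m) =
        gaussMoment μ b 0 * (((1 / (4 * b) : ℝ) : ℂ) ^ m / m.factorial) := mod_cast hratio
    push_cast at hratio' ⊢
    linear_combination ((2 ^ (μ + 1 / 2) : ℝ) * Real.Gamma (μ + 1 / 2) : ℂ)⁻¹ * (-1) ^ m *
      z ^ (2 * m) * hratio'

end FourierGaussian

section Plancherel

open Polynomial

/-- The generalized Fourier integral on the polynomial factors: it takes `p(x) exp(-x²)` to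
`(fourierPoly μ p)(x) exp(-x²/4)`. On constants it is read off the transform of the Gaussian, and
multiplication by `x` becomes `i 𝔇_μ`. -/
def fourierPoly (μ : ℝ) : ℂ[X] →ₗ[ℂ] ℂ[X] :=
  LinearMap.applyₗ (C (((2 : ℝ) ^ (-(μ + 1 / 2)) : ℝ) : ℂ)) ∘ₗ
    (aeval (Complex.I • dunklGauss μ (1 / 4) : Module.End ℂ ℂ[X])).toLinearMap

lemma fourierPoly_C (μ : ℝ) (c : ℂ) :
    fourierPoly μ (C c) = C (c * (((2 : ℝ) ^ (-(μ + 1 / 2)) : ℝ) : ℂ)) := by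
  simp [fourierPoly, Algebra.algebraMap_eq_smul_one, smul_C]

lemma fourierPoly_X_mul (μ : ℝ) (p : ℂ[X]) :
    fourierPoly μ (X * p) = Complex.I • dunklGauss μ (1 / 4) (fourierPoly μ p) := by
  simp [fourierPoly]

lemma gaussPolyWith_C (b : ℝ) (c z : ℂ) : gaussPolyWith b (C c) z = c * gaussPolyWith b 1 z := by
  simp [gaussPolyWith]

lemma gaussPolyWith_X_mul (b : ℝ) (p : ℂ[X]) (z : ℂ) :
    gaussPolyWith b (X * p) z = z * gaussPolyWith b p z := by
  simp [gaussPolyWith, mul_assoc]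

lemma induction_X_mul {P : ℂ[X] → Prop} (p : ℂ[X]) (C : ∀ c, P (C c))
    (add : ∀ p q, P p → P q → P (p + q)) (X_mul : ∀ p, P p → P (X * p)) : P p :=
  Polynomial.induction_on p C add fun n c h => by
    rw [pow_succ, ← mul_assoc, mul_comm]
    exact X_mul _ h

lemma fourierC_gaussPoly (hμ : 0 < μ) (p : ℂ[X]) :
    fourierC μ (fun t => gaussPolyWith 1 p t) = gaussPolyWith (1 / 4) (fourierPoly μ p) := by
  induction p using induction_X_mul with
  | C c =>
    ext z
    simp only [gaussPolyWith_C, fourierC_const_mul, fourierPoly_C]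
    rw [fourierC_gaussian hμ one_pos, mul_one, mul_one, mul_assoc]
  | add p q hp hq =>
    ext z
    simp only [gaussPolyWith_add, map_add]
    rw [fourierC_add hμ (hasExpMoments_gaussPolyWith hμ one_pos p)
      (hasExpMoments_gaussPolyWith hμ one_pos q), hp, hq]
  | X_mul p hp =>
    ext z
    simp only [gaussPolyWith_X_mul]
    rw [fourierC_ofReal_mul hμ (hasExpMoments_gaussPolyWith hμ one_pos p), hp,
      dunklDeriv_gaussPolyWith, fourierPoly_X_mul, gaussPolyWith_smul]

lemma fourierIntegralMu_gaussPoly (hμ : 0 < μ) (p : ℂ[X]) (x : ℝ) :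
    fourierIntegralMu μ (fun t : ℝ => gaussPoly p t) x =
      gaussPolyWith (1 / 4) (fourierPoly μ p) x := by
  rw [← fourierC_gaussPoly hμ, gaussPoly_eq]
  rfl

lemma integral_fourierPoly_mul_C (hμ : 0 < μ) (p : ℂ[X]) (c : ℂ) :
    ∫ x : ℝ, gaussPolyWith (1 / 4) (fourierPoly μ p) x *
      gaussPolyWith (1 / 4) (fourierPoly μ (C c)) x ∂(weightMeasure μ) =
      ∫ x : ℝ, gaussPolyWith 1 p x * gaussPolyWith 1 (C c) x ∂(weightMeasure μ) := by
  have hq : (0 : ℝ) < 1 / 4 := by norm_num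
  have hconst : (2 : ℝ) ^ (-(μ + 1 / 2)) * (2 * (1 / 4)) ^ (-(μ + 1 / 2)) = 1 := by
    rw [← Real.mul_rpow (by norm_num) (by norm_num)]
    norm_num
  rw [← fourierC_gaussPoly hμ p, integral_fourierC_mul hμ (integrable_gaussPolyWith hμ one_pos p)
    (integrable_gaussPolyWith hμ hq _)]
  refine integral_congr_ae (.of_forall fun x => ?_)
  have hconst' := congrArg ((↑) : ℝ → ℂ) hconst
  rw [Complex.ofReal_mul, Complex.ofReal_one] at hconst'
  simp only [fourierPoly_C, gaussPolyWith_C, fourierC_const_mul, fourierC_gaussian hμ hq,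
    mul_one_div_cancel (four_ne_zero (α := ℝ)), div_one]
  linear_combination (c * gaussPolyWith 1 p x * gaussPolyWith 1 1 x) * hconst'

lemma integral_fourierPoly_mul (hμ : 0 < μ) (p r : ℂ[X]) :
    ∫ x : ℝ, gaussPolyWith (1 / 4) (fourierPoly μ p) x *
      gaussPolyWith (1 / 4) (fourierPoly μ r) x ∂(weightMeasure μ) =
      ∫ x : ℝ, gaussPolyWith 1 p x * gaussPolyWith 1 (r.comp (-X)) x ∂(weightMeasure μ) := by
  have hq : (0 : ℝ) < 1 / 4 := by norm_num
  induction r using induction_X_mul generalizing p with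
  | C c => simpa using integral_fourierPoly_mul_C hμ p c
  | add r s hr hs =>
    simp only [map_add, add_comp, gaussPolyWith_add, mul_add]
    rw [integral_add, integral_add, hr, hs] <;> simp only [gaussPolyWith_mul_mul]
    exacts [integrable_gaussPolyWith hμ (add_pos one_pos one_pos) _,
      integrable_gaussPolyWith hμ (add_pos one_pos one_pos) _,
      integrable_gaussPolyWith hμ (add_pos hq hq) _, integrable_gaussPolyWith hμ (add_pos hq hq) _]
  | X_mul r hr =>
    have hskew := integral_dunklGauss_mul hμ hq (fourierPoly μ p) (fourierPoly μ r)
    have hr' := hr (X * p)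
    have hcomp (z : ℂ) : gaussPolyWith 1 ((X * r).comp (-X)) z =
        -(z * gaussPolyWith 1 (r.comp (-X)) z) := by
      simp [gaussPolyWith, mul_assoc]
    simp only [fourierPoly_X_mul, hcomp, gaussPolyWith_smul, gaussPolyWith_X_mul, mul_assoc,
      mul_left_comm _ Complex.I, mul_neg, mul_left_comm _ (Complex.ofReal _), integral_const_mul,
      integral_neg, hskew] at hr' ⊢
    rw [← hr', neg_neg]

lemma integral_weightMeasure_comp_neg (μ : ℝ) (f : ℝ → ℂ) :
    ∫ x, f (-x) ∂(weightMeasure μ) = ∫ x, f x ∂(weightMeasure μ) := by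
  rw [integral_weightMeasure, integral_weightMeasure, ← integral_neg_eq_self]
  simp only [neg_neg, abs_neg]

lemma conj_fourierPoly (hμ : 0 < μ) (p : ℂ[X]) (x : ℝ) :
    (starRingEnd ℂ) (gaussPolyWith (1 / 4) (fourierPoly μ p) x) =
      gaussPolyWith (1 / 4) (fourierPoly μ ((p.map (starRingEnd ℂ)).comp (-X))) x := by
  rw [← fourierC_gaussPoly hμ, ← fourierC_gaussPoly hμ, fourierC, fourierC, map_mul, map_inv₀,
    Complex.conj_ofReal, ← integral_conj, ← integral_weightMeasure_comp_neg]
  congr 2 with t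
  rw [map_mul, conj_expMu, conj_gaussPolyWith]
  congr 1
  · simp
  · simp [gaussPolyWith]

lemma eLpNorm_two_eq_of_integral_mul_conj_eq {ν : Measure ℝ} {f g : ℝ → ℂ} (hf : MemLp f 2 ν)
    (hg : MemLp g 2 ν) (h : ∫ x, f x * (starRingEnd ℂ) (f x) ∂ν =
      ∫ x, g x * (starRingEnd ℂ) (g x) ∂ν) : eLpNorm f 2 ν = eLpNorm g 2 ν := by
  simp only [Complex.mul_conj, integral_complex_ofReal, Complex.normSq_eq_norm_sq,
    Complex.ofReal_inj] at h
  rw [hf.eLpNorm_eq_integral_rpow_norm two_ne_zero ENNReal.ofNat_ne_top,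
    hg.eLpNorm_eq_integral_rpow_norm two_ne_zero ENNReal.ofNat_ne_top]
  simp [h]

lemma eLpNorm_fourierPoly (hμ : 0 < μ) (p : ℂ[X]) :
    eLpNorm (fun x : ℝ => gaussPolyWith (1 / 4) (fourierPoly μ p) x) 2 (weightMeasure μ) =
      eLpNorm (fun x : ℝ => gaussPolyWith 1 p x) 2 (weightMeasure μ) := by
  refine eLpNorm_two_eq_of_integral_mul_conj_eq (memLp_gaussPolyWith hμ (by norm_num) _ 2)
    (memLp_gaussPolyWith hμ one_pos _ 2) ?_
  simp only [conj_fourierPoly hμ, conj_gaussPolyWith]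
  rw [integral_fourierPoly_mul hμ, comp_assoc]
  simp

end Plancherel

section FourierTransform

open Polynomial

variable {f g : ℝ → ℂ}

/-- The restriction to `𝔖` of the generalized Fourier transform of `L²_μ(ℝ)`, in terms of the
polynomial factors. -/
def fourierGaussPolyLp (hμ : 0 < μ) : ℂ[X] →ₗ[ℂ] Lp ℂ 2 (weightMeasure μ) :=
  gaussPolyLp hμ (one_div_pos.2 four_pos) ∘ₗ fourierPoly μ

lemma norm_fourierGaussPolyLp (hμ : 0 < μ) (p : ℂ[X]) :
    ‖fourierGaussPolyLp hμ p‖ = ‖gaussPolyLp hμ one_pos p‖ := by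
  rw [fourierGaussPolyLp, LinearMap.comp_apply, norm_gaussPolyLp, norm_gaussPolyLp,
    eLpNorm_fourierPoly hμ]

/-- The operator `𝓕_μ` on `L²_μ(ℝ)`. -/
def fourierLp (hμ : 0 < μ) : Lp ℂ 2 (weightMeasure μ) →L[ℂ] Lp ℂ 2 (weightMeasure μ) :=
  (fourierGaussPolyLp hμ).extendOfNorm (gaussPolyLp hμ one_pos)

lemma fourierLp_gaussPolyLp (hμ : 0 < μ) (p : ℂ[X]) :
    fourierLp hμ (gaussPolyLp hμ one_pos p) = fourierGaussPolyLp hμ p :=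
  LinearMap.extendOfNorm_eq (denseRange_gaussPolyLp hμ one_pos)
    ⟨1, fun p => by rw [one_mul, norm_fourierGaussPolyLp]⟩ p

lemma norm_fourierLp (hμ : 0 < μ) (u : Lp ℂ 2 (weightMeasure μ)) : ‖fourierLp hμ u‖ = ‖u‖ := by
  refine congrFun ((denseRange_gaussPolyLp hμ one_pos).equalizer (fourierLp hμ).continuous.norm
    continuous_norm ?_) u
  ext p
  simp only [Function.comp_apply, fourierLp_gaussPolyLp, norm_fourierGaussPolyLp]

lemma isometry_fourierLp (hμ : 0 < μ) : Isometry (fourierLp hμ) :=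
  AddMonoidHomClass.isometry_of_norm _ (norm_fourierLp hμ)

lemma isFourierMu_iff (hμ : 0 < μ) (hf : MemLp f 2 (weightMeasure μ))
    (hg : MemLp g 2 (weightMeasure μ)) :
    IsFourierMu μ f g ↔ fourierLp hμ (hf.toLp f) = hg.toLp g := by
  have hf_edist (p : ℂ[X]) : eLpNorm (fun x : ℝ => f x - gaussPoly p x) 2 (weightMeasure μ) =
      edist (hf.toLp f) (gaussPolyLp hμ one_pos p) := by
    rw [edist_toLp_gaussPolyLp, gaussPoly_eq]
  have hg_edist (p : ℂ[X]) : eLpNorm (fun x : ℝ => g x - fourierIntegralMu μ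
      (fun t : ℝ => gaussPoly p t) x) 2 (weightMeasure μ) =
      edist (hg.toLp g) (fourierGaussPolyLp hμ p) := by
    simp only [fourierIntegralMu_gaussPoly hμ]
    exact (edist_toLp_gaussPolyLp hμ (one_div_pos.2 four_pos) hg (fourierPoly μ p)).symm
  simp only [IsFourierMu, hf, hg, true_and, hf_edist, hg_edist]
  refine ⟨fun h => ?_, fun h ε hε => ?_⟩
  · have hclosed : IsClosed {w : Lp ℂ 2 (weightMeasure μ) × Lp ℂ 2 (weightMeasure μ) |
        fourierLp hμ w.1 = w.2} := isClosed_eq (by fun_prop) (by fun_prop)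
    refine hclosed.closure_subset (a := (hf.toLp f, hg.toLp g)) <|
      EMetric.mem_closure_iff.2 fun ε hε => ?_
    obtain ⟨p, hp⟩ := h ε hε
    exact ⟨(gaussPolyLp hμ one_pos p, fourierGaussPolyLp hμ p), fourierLp_gaussPolyLp hμ p,
      max_lt hp.1 hp.2⟩
  · obtain ⟨_, ⟨p, rfl⟩, hp⟩ :=
      EMetric.mem_closure_iff.1 (denseRange_gaussPolyLp hμ one_pos (hf.toLp f)) ε hε
    refine ⟨p, hp, ?_⟩
    rwa [← h, ← fourierLp_gaussPolyLp, (isometry_fourierLp hμ).edist_eq]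

lemma continuous_integral_mul {ν : Measure ℝ} {h : ℝ → ℂ} (hh : MemLp h 2 ν) :
    Continuous fun u : Lp ℂ 2 ν => ∫ x, u x * h x ∂ν := by
  have hpair (u : Lp ℂ 2 ν) : ∫ x, u x * h x ∂ν =
      (ContinuousLinearMap.mul ℂ ℂ).lpPairing ν 2 2 u (hh.toLp h) := by
    rw [ContinuousLinearMap.lpPairing_eq_integral]
    refine integral_congr_ae ?_
    filter_upwards [hh.coeFn_toLp] with x hx
    rw [hx, ContinuousLinearMap.mul_apply']
  simp only [hpair]
  fun_prop

lemma integral_fourierLp_mul (hμ : 0 < μ) (u : Lp ℂ 2 (weightMeasure μ)) (q : ℂ[X]) :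
    ∫ x, fourierLp hμ u x * gaussPolyWith 1 q x ∂(weightMeasure μ) =
      ∫ x, u x * gaussPolyWith (1 / 4) (fourierPoly μ q) x ∂(weightMeasure μ) := by
  have hquarter : (0 : ℝ) < 1 / 4 := one_div_pos.2 four_pos
  refine congrFun ((denseRange_gaussPolyLp hμ one_pos).equalizer
    ((continuous_integral_mul (memLp_gaussPolyWith hμ one_pos q 2)).comp (fourierLp hμ).continuous)
    (continuous_integral_mul (memLp_gaussPolyWith hμ hquarter (fourierPoly μ q) 2)) ?_) u
  ext p
  have hF : fourierLp hμ (gaussPolyLp hμ one_pos p) =ᵐ[weightMeasure μ]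
      fun x : ℝ => fourierC μ (fun t => gaussPolyWith 1 p t) x := by
    rw [fourierLp_gaussPolyLp, fourierC_gaussPoly hμ]
    exact gaussPolyLp_ae_eq hμ hquarter (fourierPoly μ p)
  calc ∫ x, fourierLp hμ (gaussPolyLp hμ one_pos p) x * gaussPolyWith 1 q x ∂(weightMeasure μ)
      = ∫ x : ℝ, fourierC μ (fun t => gaussPolyWith 1 p t) x * gaussPolyWith 1 q x
          ∂(weightMeasure μ) := integral_congr_ae (hF.mul .rfl)
    _ = ∫ x : ℝ, gaussPolyWith 1 p x * gaussPolyWith (1 / 4) (fourierPoly μ q) x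
          ∂(weightMeasure μ) := by
        rw [integral_fourierC_mul hμ (integrable_gaussPolyWith hμ one_pos p)
          (integrable_gaussPolyWith hμ one_pos q), fourierC_gaussPoly hμ]
    _ = _ := integral_congr_ae ((gaussPolyLp_ae_eq hμ one_pos p).symm.mul .rfl)

lemma memLp_top_fourierC (hμ : 0 < μ) (hf : Integrable f (weightMeasure μ)) :
    MemLp (fun x : ℝ => fourierC μ f x) ⊤ (weightMeasure μ) := by
  refine memLp_top_of_bound (continuous_fourierC_ofReal hμ hf).aestronglyMeasurable
    (‖(((2 : ℝ) ^ (μ + 1 / 2) * Real.Gamma (μ + 1 / 2) : ℝ) : ℂ)⁻¹‖ *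
      ∫ t, ‖f t‖ ∂(weightMeasure μ)) (.of_forall fun x => ?_)
  rw [fourierC, norm_mul]
  gcongr
  refine norm_integral_le_of_norm_le hf.norm (.of_forall fun t => ?_)
  rw [norm_mul]
  exact mul_le_of_le_one_left (norm_nonneg _) (norm_expMu_neg_I_mul_le hμ x t)

lemma fourierLp_toLp_ae_eq (hμ : 0 < μ) (hf : MemLp f 2 (weightMeasure μ))
    (hf1 : Integrable f (weightMeasure μ)) :
    fourierLp hμ (hf.toLp f) =ᵐ[weightMeasure μ] fun x : ℝ => fourierC μ f x := by
  refine ae_eq_of_forall_integral_mul_gaussPolyWith_eq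
    (hasExpMoments_mul_gaussPolyWith hμ one_pos one_le_two (Lp.memLp _) 1)
    (hasExpMoments_mul_gaussPolyWith hμ one_pos le_top (memLp_top_fourierC hμ hf1) 1) fun p => ?_
  rw [integral_fourierLp_mul, integral_fourierC_mul hμ hf1 (integrable_gaussPolyWith hμ one_pos p),
    fourierC_gaussPoly hμ]
  exact integral_congr_ae (hf.coeFn_toLp.mul .rfl)

end FourierTransform

/-! ### The generalized translation on `L²_μ(ℝ)` and on bounded functions -/

section L2Translation

variable {f φ : ℝ → ℂ}

lemma memLp_top_expMu (hμ : 0 < μ) (x : ℝ) :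
    MemLp (fun t : ℝ => expMu μ (Complex.I * x * t)) ⊤ (weightMeasure μ) := by
  refine memLp_top_of_bound ((continuous_expMu hμ).comp (by fun_prop)).aestronglyMeasurable 1
    (.of_forall fun t => ?_)
  simpa only [Complex.ofReal_mul, mul_assoc] using norm_expMu_I_mul_le hμ (x * t)

lemma fourierC_genTranslation (hμ : 0 < μ) (y : ℝ) (hf : Integrable f (weightMeasure μ)) (x : ℝ) :
    fourierC μ (genTranslation μ y f) x = expMu μ (Complex.I * y * x) * fourierC μ f x := by
  let e (t : ℝ) : ℂ := expMu μ (-(Complex.I * x) * t)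
  have he : MemLp e ⊤ (weightMeasure μ) := by simpa [e] using memLp_top_expMu hμ (-x)
  have hcharacter : genTranslation μ (-y) e =ᵐ[weightMeasure μ]
      fun t => expMu μ (Complex.I * y * x) * e t := by
    filter_upwards [ae_weightMeasure_ne_zero μ] with t ht
    rw [genTranslation_expMu hμ _ ht, mul_comm]
    congr 2
    push_cast
    ring
  have htranspose : ∫ t, e t * genTranslation μ y f t ∂(weightMeasure μ) =
      expMu μ (Complex.I * y * x) * ∫ t, e t * f t ∂(weightMeasure μ) := by
    calc ∫ t, e t * genTranslation μ y f t ∂(weightMeasure μ)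
        = ∫ t, genTranslation μ (-y) e t * f t ∂(weightMeasure μ) := by
          rw [integral_genTranslation_mul hμ (-y) he (memLp_one_iff_integrable.2 hf), neg_neg]
      _ = ∫ t, expMu μ (Complex.I * y * x) * (e t * f t) ∂(weightMeasure μ) := by
          simp only [← mul_assoc]
          exact integral_congr_ae (hcharacter.mul .rfl)
      _ = _ := integral_const_mul _ _
  have hfourier (h : ℝ → ℂ) : fourierC μ h x =
      (((2 : ℝ) ^ (μ + 1 / 2) * Real.Gamma (μ + 1 / 2) : ℝ) : ℂ)⁻¹ *
        ∫ t, e t * h t ∂(weightMeasure μ) := by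
    simp only [fourierC, e, neg_mul]
  rw [hfourier, hfourier, htranspose, mul_left_comm]

/-- The operator `𝔗_y` on `L²_μ(ℝ)`. -/
def translationLp (hμ : 0 < μ) (y : ℝ) : Lp ℂ 2 (weightMeasure μ) →+ Lp ℂ 2 (weightMeasure μ) :=
  .ofMapSub (fun u => (memLp_genTranslation hμ y one_le_two (Lp.memLp u)).toLp _) fun u v => by
    rw [← MemLp.toLp_sub, MemLp.toLp_eq_toLp_iff]
    exact (genTranslation_congr_ae hμ y one_le_two (Lp.memLp _) (Lp.coeFn_sub u v)).trans
      (genTranslation_sub_ae_eq hμ y one_le_two (Lp.memLp u) (Lp.memLp v))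

lemma translationLp_toLp (hμ : 0 < μ) (y : ℝ) (hφ : MemLp φ 2 (weightMeasure μ)) :
    translationLp hμ y (hφ.toLp φ) = (memLp_genTranslation hμ y one_le_two hφ).toLp _ :=
  MemLp.toLp_congr (memLp_genTranslation hμ y one_le_two (Lp.memLp _)) _
    (genTranslation_congr_ae hμ y one_le_two (Lp.memLp _) hφ.coeFn_toLp)

lemma continuous_translationLp (hμ : 0 < μ) (y : ℝ) : Continuous (translationLp hμ y) := by
  refine AddMonoidHomClass.continuous_of_bound _ (translationBound μ).toReal fun u => ?_
  rw [Lp.norm_def u, ← ENNReal.toReal_mul]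
  refine (Lp.norm_toLp _ (memLp_genTranslation hμ y one_le_two (Lp.memLp u))).trans_le ?_
  exact ENNReal.toReal_mono
    (ENNReal.mul_ne_top (translationBound_ne_top hμ) (Lp.eLpNorm_ne_top u))
    (eLpNorm_genTranslation_le_mul hμ y one_le_two (Lp.memLp u))

/-- Multiplication by `e_μ(i y t)` on `L²_μ(ℝ)`. -/
def expMuMulLp (hμ : 0 < μ) (y : ℝ) : Lp ℂ 2 (weightMeasure μ) →L[ℂ] Lp ℂ 2 (weightMeasure μ) :=
  (ContinuousLinearMap.mul ℂ ℂ).holderL (weightMeasure μ) ⊤ 2 2 ((memLp_top_expMu hμ y).toLp _)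

lemma expMuMulLp_ae_eq (hμ : 0 < μ) (y : ℝ) (u : Lp ℂ 2 (weightMeasure μ)) :
    expMuMulLp hμ y u =ᵐ[weightMeasure μ] fun t => expMu μ (Complex.I * y * t) * u t := by
  refine ((ContinuousLinearMap.mul ℂ ℂ).coeFn_holder _ u).trans ?_
  filter_upwards [(memLp_top_expMu hμ y).coeFn_toLp] with t ht
  rw [ht, ContinuousLinearMap.mul_apply']

lemma norm_expMuMulLp_le (hμ : 0 < μ) (y : ℝ) (u : Lp ℂ 2 (weightMeasure μ)) :
    ‖expMuMulLp hμ y u‖ ≤ ‖u‖ := by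
  refine Lp.norm_le_norm_of_ae_le ?_
  filter_upwards [expMuMulLp_ae_eq hμ y u] with t ht
  rw [ht, norm_mul]
  refine mul_le_of_le_one_left (norm_nonneg _) ?_
  simpa only [Complex.ofReal_mul, mul_assoc] using norm_expMu_I_mul_le hμ (y * t)

lemma fourierLp_translationLp (hμ : 0 < μ) (y : ℝ) (u : Lp ℂ 2 (weightMeasure μ)) :
    fourierLp hμ (translationLp hμ y u) = expMuMulLp hμ y (fourierLp hμ u) := by
  refine congrFun ((denseRange_gaussPolyLp hμ one_pos).equalizer
    ((fourierLp hμ).continuous.comp (continuous_translationLp hμ y))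
    ((expMuMulLp hμ y).continuous.comp (fourierLp hμ).continuous) ?_) u
  ext p : 1
  have hp := memLp_gaussPolyWith hμ one_pos p
  have hTp : Integrable (genTranslation μ y fun x : ℝ => gaussPolyWith 1 p x) (weightMeasure μ) :=
    memLp_one_iff_integrable.1 (memLp_genTranslation hμ y le_rfl (hp 1))
  change fourierLp hμ (translationLp hμ y ((hp 2).toLp _)) =
    expMuMulLp hμ y (fourierLp hμ ((hp 2).toLp _))
  refine Lp.ext ?_
  rw [translationLp_toLp]
  filter_upwards [fourierLp_toLp_ae_eq hμ (memLp_genTranslation hμ y one_le_two (hp 2)) hTp,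
    expMuMulLp_ae_eq hμ y (fourierLp hμ ((hp 2).toLp _)),
    fourierLp_toLp_ae_eq hμ (hp 2) (memLp_one_iff_integrable.1 (hp 1))] with t hleft hright hfourier
  rw [hleft, hright, hfourier, fourierC_genTranslation hμ y (memLp_one_iff_integrable.1 (hp 1))]

lemma eLpNorm_genTranslation_le (hμ : 0 < μ) (y : ℝ) (hφ : MemLp φ 2 (weightMeasure μ)) :
    eLpNorm (genTranslation μ y φ) 2 (weightMeasure μ) ≤ eLpNorm φ 2 (weightMeasure μ) := by
  have hnorm : ‖translationLp hμ y (hφ.toLp φ)‖ ≤ ‖hφ.toLp φ‖ := by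
    rw [← norm_fourierLp hμ, fourierLp_translationLp, ← norm_fourierLp hμ (hφ.toLp φ)]
    exact norm_expMuMulLp_le hμ y _
  rw [translationLp_toLp, Lp.norm_toLp, Lp.norm_toLp] at hnorm
  exact (ENNReal.toReal_le_toReal (memLp_genTranslation hμ y one_le_two hφ).2.ne hφ.2.ne).1 hnorm

lemma isL2Translate_iff (hμ : 0 < μ) (y : ℝ) (hφ : MemLp φ 2 (weightMeasure μ)) (ψ : ℝ → ℂ) :
    IsL2Translate μ y φ ψ ↔ ψ =ᵐ[volume] genTranslation μ y φ := by
  have hTφ := memLp_genTranslation hμ y one_le_two hφ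
  have hfourier : fourierLp hμ (hTφ.toLp _) = expMuMulLp hμ y (fourierLp hμ (hφ.toLp φ)) := by
    rw [← translationLp_toLp hμ y hφ, fourierLp_translationLp]
  rw [← ae_weightMeasure μ]
  constructor
  · rintro ⟨g, hg, hψ⟩
    have hmul : hψ.2.1.toLp _ = expMuMulLp hμ y (hg.2.1.toLp g) := by
      refine Lp.ext ?_
      filter_upwards [hψ.2.1.coeFn_toLp, hg.2.1.coeFn_toLp, expMuMulLp_ae_eq hμ y (hg.2.1.toLp g)]
        with t h h' h''
      rw [h, h'', h']
    rw [← MemLp.toLp_eq_toLp_iff hψ.1 hTφ]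
    refine (isometry_fourierLp hμ).injective ?_
    rw [(isFourierMu_iff hμ hψ.1 hψ.2.1).1 hψ, hmul, hfourier,
      (isFourierMu_iff hμ hφ hg.2.1).1 hg]
  · intro h
    have hψ : MemLp ψ 2 (weightMeasure μ) := hTφ.ae_eq h.symm
    have hg := Lp.memLp (fourierLp hμ (hφ.toLp φ))
    have heg := (Lp.memLp _).ae_eq (expMuMulLp_ae_eq hμ y (fourierLp hμ (hφ.toLp φ)))
    refine ⟨fourierLp hμ (hφ.toLp φ), (isFourierMu_iff hμ hφ hg).2 (Lp.toLp_coeFn _ hg).symm,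
      (isFourierMu_iff hμ hψ heg).2 ?_⟩
    rw [MemLp.toLp_congr hψ hTφ h, hfourier]
    exact Lp.ext ((expMuMulLp_ae_eq hμ y _).trans heg.coeFn_toLp.symm)

end L2Translation

section BoundedTranslation

variable {f φ : ℝ → ℂ}

lemma memLp_top_weightMeasure_iff (μ : ℝ) :
    MemLp f ⊤ (weightMeasure μ) ↔ MemLp f ⊤ volume := by
  have hmeas : AEStronglyMeasurable f (weightMeasure μ) ↔ AEStronglyMeasurable f volume :=
    ⟨fun h => h.mono_ac (Measure.ae_le_iff_absolutelyContinuous.1 (ae_weightMeasure μ).ge),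
      fun h => h.mono_ac (Measure.ae_le_iff_absolutelyContinuous.1 (ae_weightMeasure μ).le)⟩
  simp only [MemLp, hmeas, eLpNorm_exponent_top, eLpNormEssSup, essSup, ae_weightMeasure]

lemma exists_hasSum_translationTerm_gaussPoly (hμ : 0 < μ) (y : ℝ) (p : Polynomial ℂ) :
    ∃ h : ℝ → ℂ, (∀ x : ℝ, HasSum (translationTerm μ y (gaussPoly p) x) (h x)) ∧
      h =ᵐ[weightMeasure μ] genTranslation μ y fun x : ℝ => gaussPoly p x := by
  have hdiff : Differentiable ℂ (gaussPoly p) := gaussPoly_eq p ▸ differentiable_gaussPolyWith 1 p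
  refine ⟨fun x => ∑' n, translationTerm μ y (gaussPoly p) x n,
    fun x => (summable_translationTerm hμ hdiff x y).hasSum, ?_⟩
  filter_upwards [ae_weightMeasure_ne_zero μ] with x hx
    using (hasSum_translationTerm_genTranslation hμ hdiff hx y).tsum_eq

lemma isBoundedTranslate_genTranslation (hμ : 0 < μ) (y : ℝ) (hφ : MemLp φ ⊤ volume) :
    IsBoundedTranslate μ y φ (genTranslation μ y φ) := by
  have hφ' := (memLp_top_weightMeasure_iff μ).2 hφ
  refine ⟨(memLp_top_weightMeasure_iff μ).1 (memLp_genTranslation hμ y le_top hφ'), fun p => ?_⟩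
  obtain ⟨h, hsum, hae⟩ := exists_hasSum_translationTerm_gaussPoly hμ (-y) p
  have hp : MemLp (fun x : ℝ => gaussPoly p x) 1 (weightMeasure μ) :=
    gaussPoly_eq p ▸ memLp_gaussPolyWith hμ one_pos p 1
  refine ⟨h, hsum, (memLp_one_iff_integrable.1
    (memLp_genTranslation hμ (-y) le_rfl hp)).congr hae.symm, ?_⟩
  rw [integral_genTranslation_mul hμ y hφ' hp]
  refine integral_congr_ae ?_
  filter_upwards [hae] with x hx
  rw [hx]

lemma isBoundedTranslate_iff (hμ : 0 < μ) (y : ℝ) (hφ : MemLp φ ⊤ volume) (ψ : ℝ → ℂ) :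
    IsBoundedTranslate μ y φ ψ ↔ ψ =ᵐ[volume] genTranslation μ y φ := by
  have hTφ := isBoundedTranslate_genTranslation hμ y hφ
  refine ⟨fun hψ => ?_, fun h => ⟨hTφ.1.ae_eq h.symm, fun p => ?_⟩⟩
  · rw [← ae_weightMeasure μ]
    have hmoments {u : ℝ → ℂ} (hu : MemLp u ⊤ volume) :=
      hasExpMoments_mul_gaussPolyWith hμ one_pos le_top ((memLp_top_weightMeasure_iff μ).2 hu) 1
    refine ae_eq_of_forall_integral_mul_gaussPolyWith_eq (hmoments hψ.1) (hmoments hTφ.1)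
      fun p => ?_
    obtain ⟨h, hsum, -, hint⟩ := hψ.2 p
    obtain ⟨h', hsum', -, hint'⟩ := hTφ.2 p
    have : h = h' := funext fun x => (hsum x).unique (hsum' x)
    rw [← gaussPoly_eq, hint, hint', this]
  · obtain ⟨u, hsum, hu, hint⟩ := hTφ.2 p
    refine ⟨u, hsum, hu, (integral_congr_ae ?_).trans hint⟩
    filter_upwards [(ae_weightMeasure μ).le h] with x hx
    rw [hx]

lemma genTranslation_comm (μ x y : ℝ) (φ : ℝ → ℂ) :
    genTranslation μ y φ x = genTranslation μ x φ y := by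
  simp only [genTranslation, omegaTilde_comm x y, add_comm x y]

end BoundedTranslation

end GenHermite

end

theorem theorem4p8 (μ : ℝ) (hμ : 0 < μ) :
    (∀ φ : ℝ → ℂ, MeasureTheory.MemLp φ ⊤ MeasureTheory.volume →
      (∀ (y : ℝ) (ψ : ℝ → ℂ), GenHermite.IsBoundedTranslate μ y φ ψ ↔
        ψ =ᵐ[MeasureTheory.volume] GenHermite.genTranslation μ y φ) ∧
      ∀ᵐ q : ℝ × ℝ, GenHermite.genTranslation μ q.2 φ q.1 =
        GenHermite.genTranslation μ q.1 φ q.2) ∧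
    (∀ (y : ℝ) (φ : ℝ → ℂ), MeasureTheory.MemLp φ 2 (GenHermite.weightMeasure μ) →
      (∀ ψ : ℝ → ℂ, GenHermite.IsL2Translate μ y φ ψ ↔
        ψ =ᵐ[MeasureTheory.volume] GenHermite.genTranslation μ y φ) ∧
      MeasureTheory.MemLp (GenHermite.genTranslation μ y φ) 2 (GenHermite.weightMeasure μ) ∧
      MeasureTheory.eLpNorm (GenHermite.genTranslation μ y φ) 2 (GenHermite.weightMeasure μ) ≤
        MeasureTheory.eLpNorm φ 2 (GenHermite.weightMeasure μ)) := by
  refine ⟨fun φ hφ => ⟨fun y => GenHermite.isBoundedTranslate_iff hμ y hφ,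
    .of_forall fun q => GenHermite.genTranslation_comm μ q.1 q.2 φ⟩, fun y φ hφ => ⟨?_, ?_, ?_⟩⟩
  · exact GenHermite.isL2Translate_iff hμ y hφ
  · exact GenHermite.memLp_genTranslation hμ y one_le_two hφ
  · exact GenHermite.eLpNorm_genTranslation_le hμ y hφ
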